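/- Let $c_0,\dots,c_n\in\mathbb R[\gamma]$ have degree at most $d$, with $c_0\not\equiv 0$, and put $p_\gamma(x)=\sum_{k=0}^n(-1)^k x^{n-k}c_k(\gamma)$. A real polynomial is called real-rooted if it is zero or all its complex roots are real. For $c_0(\gamma)\ne 0$ let $m_j(p_\gamma)$ be the sum of the $j$-th powers of the $n$ complex roots of $p_\gamma$ (with multiplicity), let $\nu$ be the least even integer with $\nu\ge n$ and $\nu\ge 2n-2$, and let $H(\gamma)$ be the $n\times n$ Hankel matrix with entries $H(\gamma)_{k,l}=c_0(\gamma)^\nu m_{k+l-2}(p_\gamma)$; its entries are polynomials in $\gamma$. For a matrix $A$ let $e_k(A)$ be the sum of its $k\times k$ principal minors. The algorithm SimpleRR takes the coefficients of $c_0,\dots,c_n$ as input and proceeds as follows. Let $N=n(d+1)(2n-2+\nu)$ and let $s_1,\dots,s_N$ be the $N$-th roots of unity. For each $i$, evaluate $c_0(s_i),\dots,c_n(s_i)$, compute $H(s_i)$ by the Newton identities for $r_j=c_0^j m_j$ (with cleared denominators), and compute $e_1(H(s_i)),\dots,e_n(H(s_i))$ from the characteristic polynomial of $H(s_i)$, which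 a subroutine computes. For each $k=1,\dots,n$, a second subroutine computes the coefficients of the polynomial $q_k$ of degree less than $N$ with $q_k(s_i)=e_k(H(s_i))$ for all $i$. Output $q_1,\dots,q_n$. Theorem. (1) The output polynomials $q_1,\dots,q_n$ are real polynomials of degree at most $3n^2d$ and satisfy $q_k(\gamma)=e_k(H(\gamma))$ for every real $\gamma$ with $c_0(\gamma)\neq 0$; and $p_\gamma$ is real-rooted for all $\gamma\in\mathbb R$ if and only if $q_1,\dots,q_n$ are all nonnegative on $\mathbb R$. (2) Count arithmetic operations and zero tests in exact arithmetic over $\mathbb C$ (algebraic computation trees). Let $\omega$ be a real number such that $n\times n$ complex matrices can be multiplied in $O(n^\omega)$ operations. Then, with suitable correct subroutines for the characteristic polynomial and for the interpolation, SimpleRR runs in time $\tilde O(dn^{2+\omega}+d^2n^3)$ for $n,d\ge 1$: there are constants $C$ and $\kappa$, independent of $n$, $d$ and the input, such that it uses at most $C\,(dn^{2+\omega}+d^2n^3)\,(\log(nd+2))^\kappa$ operations. -/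

import Mathlib

open Polynomial

/-! ### A machine model: algebraic computation trees with unit costs

A program over a field `K` works on a list of registers, each holding an element of `K`, and refers
to registers by their index. Each instruction either appends one new register or tests whether a
register is zero. The continuation of an instruction only receives the index of the new register or
the truth value of the test, so that a program can use the values only through instructions. -/

/-- The four field operations. -/
inductive ArithOp : Type
  | add
  | sub
  | mul
  | div

/-- The value of a field operation (with `x / 0 = 0`; a program can test for zero). -/
def ArithOp.apply {K : Type} [Field K] : ArithOp → K → K → K
  | .add, x, y => x + y
  | .sub, x, y => x - y
  | .mul, x, y => x * y
  | .div, x, y => x / y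

/-- Programs (computation trees) over `K` that return an element of `α`, typically a family of
register indices. -/
inductive Prog (K : Type) (α : Type) : Type
  | ret (a : α) : Prog K α
  | const (z : K) (k : ℕ → Prog K α) : Prog K α
  | arith (o : ArithOp) (i j : ℕ) (k : ℕ → Prog K α) : Prog K α
  | test (i : ℕ) (k : Bool → Prog K α) : Prog K α

/-- The result of a run: returned object, final registers, number of executed instructions. -/
structure RunResult (K : Type) (α : Type) : Type where
  out : α
  mem : List K
  cost : ℕ

namespace Prog

variable {K : Type} {α β : Type}

/-- Execution. The register with index `i` is entry `i` of the list; each instruction costs `1`. -/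
def run [Field K] [DecidableEq K] : Prog K α → List K → RunResult K α
  | ret a, mem => ⟨a, mem, 0⟩
  | const z k, mem =>
      let r := run (k mem.length) (mem ++ [z])
      ⟨r.out, r.mem, r.cost + 1⟩
  | arith o i j k, mem =>
      let r := run (k mem.length) (mem ++ [o.apply (mem.getD i 0) (mem.getD j 0)])
      ⟨r.out, r.mem, r.cost + 1⟩
  | test i k, mem =>
      let r := run (k (decide (mem.getD i 0 = 0))) mem
      ⟨r.out, r.mem, r.cost + 1⟩

/-- Sequential composition. -/
def bind : Prog K α → (α → Prog K β) → Prog K β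
  | ret a, f => f a
  | const z k, f => const z fun i => bind (k i) f
  | arith o i j k, f => arith o i j fun l => bind (k l) f
  | test i k, f => test i fun b => bind (k b) f

instance : Monad (Prog K) where
  pure := ret
  bind := bind

/-- Load a constant. -/
def lit (z : K) : Prog K ℕ := const z ret

/-- Add two registers. -/
def add (i j : ℕ) : Prog K ℕ := arith .add i j ret

/-- Multiply two registers. -/
def mul (i j : ℕ) : Prog K ℕ := arith .mul i j ret

/-- Execute `f 0, …, f (n - 1)` in this order and collect the results. -/
def forFin : (n : ℕ) → (Fin n → Prog K β) → Prog K (Fin n → β)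
  | 0, _ => pure Fin.elim0
  | n + 1, f => do
      let b ← f 0
      let bs ← forFin n fun i => f i.succ
      pure (Fin.cons b bs)

/-- `Σ x * y` over a list of pairs of registers. -/
def dot [Field K] : List (ℕ × ℕ) → Prog K ℕ
  | [] => lit 0
  | t :: ts => do
      let s ← dot ts
      let w ← mul t.1 t.2
      add s w

/-- Horner's rule: `a₀ + a₁ x + a₂ x² + ⋯`. -/
def horner [Field K] (x : ℕ) : List ℕ → Prog K ℕ
  | [] => lit 0
  | a :: as => do
      let v ← horner x as
      let w ← mul v x
      add w a

/-- The list `x⁰, x¹, …, xᵐ`. -/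
def powers [Field K] (x : ℕ) : ℕ → Prog K (List ℕ)
  | 0 => do
      let o ← lit 1
      pure [o]
  | m + 1 => do
      let l ← powers x m
      let y ← mul (l.getD m 0) x
      pure (l ++ [y])

end Prog

/-- The registers `h i` exist and hold the values `v i`. -/
def Holds {K ι : Type} (mem : List K) (h : ι → ℕ) (v : ι → K) : Prop :=
  ∀ i, mem[h i]? = some (v i)

/-! ### The algorithm -/

namespace SimpleRR

open Prog

/-- The least even integer `ν` with `ν ≥ n` and `ν ≥ 2n - 2`. -/
def nu (n : ℕ) : ℕ := 2 * max ((n + 1) / 2) (n - 1)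

/-- The number of sample points. -/
def numPoints (n d : ℕ) : ℕ := n * (d + 1) * (2 * n - 2 + nu n)

/-- The sample points are the powers of this primitive `N`-th root of unity. -/
noncomputable def rootOfUnity (N : ℕ) : ℂ := Complex.exp (2 * Real.pi * Complex.I / N)

/-- Programs that take (the registers of) an `n × n` matrix and return `n + 1` registers. -/
abbrev CharpolyRoutine (K : Type) : Type :=
  (n : ℕ) → (Fin n → Fin n → ℕ) → Prog K (Fin (n + 1) → ℕ)

/-- Programs that take `N` registers and return `N` registers. -/
abbrev InterpRoutine (K : Type) : Type :=
  (N : ℕ) → (Fin N → ℕ) → Prog K (Fin N → ℕ)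

/-- Newton's identities with cleared denominators. If register `u j` holds `(-1)^j c_{j+1} c_0^j`,
this computes `r_0, …, r_m`, where `r_k = c_0^k m_k` is a polynomial in the `c_j`:
`r_0 = n` and `r_{k+1} = Σ_{j < min n k} u_j r_{k-j} + [k < n] (k + 1) u_k`. -/
def scaledMoments {K : Type} [Field K] (n : ℕ) (u : Fin n → ℕ) : ℕ → Prog K (List ℕ)
  | 0 => do
      let h ← lit (n : K)
      pure [h]
  | k + 1 => do
      let r ← scaledMoments n u k
      let s ← dot (((List.finRange n).filter fun j => j.val < k).map
        fun j => (u j, r.getD (k - j.val) 0))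
      let y ← if h : k < n then do
          let t ← lit ((k : K) + 1)
          let w ← mul t (u ⟨k, h⟩)
          add s w
        else pure s
      pure (r ++ [y])

/-- The Hankel matrix at the sample point `s`, with entries
`c_0(s)^ν m_{a+b} = c_0(s)^(ν-(a+b)) r_{a+b}`, where `a, b` are counted from `0`. -/
def hankelProg {K : Type} [Field K] (n d : ℕ) (c : Fin (n + 1) → Fin (d + 1) → ℕ) (s : K) :
    Prog K (Fin n → Fin n → ℕ) := do
  let x ← lit s
  let cv ← forFin (n + 1) fun k => horner x (List.ofFn (c k))
  let pw ← powers (cv 0) (nu n)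
  let u ← forFin n fun j => do
    let sg ← lit ((-1 : K) ^ j.val)
    let t ← mul sg (cv j.succ)
    mul t (pw.getD j.val 0)
  let r ← scaledMoments n u (2 * n - 2)
  let h ← forFin (2 * n - 1) fun j => mul (pw.getD (nu n - j.val) 0) (r.getD j.val 0)
  pure fun a b => h ⟨a.val + b.val, by omega⟩

/-- One pass of the main loop: the values `e_1(H(s)), …, e_n(H(s))`, read off the characteristic
polynomial `Σ_k (-1)^k z^(n-k) e_k(H(s))`. -/
def sampleProg {K : Type} [Field K] (charpolyR : CharpolyRoutine K) (n d : ℕ)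
    (c : Fin (n + 1) → Fin (d + 1) → ℕ) (s : K) : Prog K (Fin n → ℕ) := do
  let H ← hankelProg n d c s
  let f ← charpolyR n H
  forFin n fun k => do
    let sg ← lit ((-1 : K) ^ (k.val + 1))
    mul sg (f ⟨n - (k.val + 1), by omega⟩)

/-- The main loop over `N` sample points `ζ^0, …, ζ^(N-1)` and the final interpolation. -/
def progWith {K : Type} [Field K] (charpolyR : CharpolyRoutine K) (interpR : InterpRoutine K)
    (N : ℕ) (ζ : K) (n d : ℕ) (c : Fin (n + 1) → Fin (d + 1) → ℕ) :
    Prog K (Fin n → Fin N → ℕ) := do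
  let e ← forFin N fun i => sampleProg charpolyR n d c (ζ ^ i.val)
  forFin n fun k => interpR N fun i => e i k

/-- The algorithm SimpleRR, given the two subroutines that it calls. Register `c k j` holds the
coefficient of `γ^j` in `c_k`; the returned register `(k, j)` is meant to hold the coefficient of
`γ^j` in `q_{k+1}`. -/
noncomputable def prog (charpolyR : CharpolyRoutine ℂ) (interpR : InterpRoutine ℂ) (n d : ℕ)
    (c : Fin (n + 1) → Fin (d + 1) → ℕ) : Prog ℂ (Fin n → Fin (numPoints n d) → ℕ) :=
  progWith charpolyR interpR (numPoints n d) (rootOfUnity (numPoints n d)) n d c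

/-- The routine computes the coefficients of the characteristic polynomial of every complex
square matrix. -/
def ComputesCharpoly (R : CharpolyRoutine ℂ) : Prop :=
  ∀ (n : ℕ) (A : Matrix (Fin n) (Fin n) ℂ) (h : Fin n → Fin n → ℕ) (mem : List ℂ),
    (∀ a, Holds mem (h a) (A a)) →
    Holds ((R n h).run mem).mem ((R n h).run mem).out fun j => A.charpoly.coeff j

/-- The routine computes, for every list of `N` complex values, the coefficients of the polynomial
of degree `< N` that takes these values at the `N`-th roots of unity. -/
def ComputesInterp (R : InterpRoutine ℂ) : Prop :=
  ∀ (N : ℕ) (v : Fin N → ℂ) (h : Fin N → ℕ) (mem : List ℂ), Holds mem h v →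
    ∃ a : Fin N → ℂ, (∀ i : Fin N, ∑ j : Fin N, a j * (rootOfUnity N ^ i.val) ^ j.val = v i) ∧
      Holds ((R N h).run mem).mem ((R N h).run mem).out a

end SimpleRR

/-- `n × n` complex matrices can be multiplied in `O(n^ω)` arithmetic operations. -/
def IsMatMulExponent (ω : ℝ) : Prop :=
  ∃ (mm : (n : ℕ) → (Fin n → Fin n → ℕ) → (Fin n → Fin n → ℕ) → Prog ℂ (Fin n → Fin n → ℕ))
    (C : ℝ), ∀ n : ℕ, 1 ≤ n → ∀ (A B : Matrix (Fin n) (Fin n) ℂ) (hA hB : Fin n → Fin n → ℕ)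
      (mem : List ℂ), (∀ a, Holds mem (hA a) (A a)) → (∀ a, Holds mem (hB a) (B a)) →
      (∀ a, Holds ((mm n hA hB).run mem).mem (((mm n hA hB).run mem).out a) ((A * B) a)) ∧
      (((mm n hA hB).run mem).cost : ℝ) ≤ C * (n : ℝ) ^ ω

/-! ### The mathematical objects -/

/-- A real polynomial is real-rooted if it is zero or all its complex roots are real. -/
def RealRooted (p : ℝ[X]) : Prop := p = 0 ∨ ∀ z : ℂ, aeval z p = 0 → z.im = 0

/-- `p_γ(x) = Σ_{k=0}^n (-1)^k x^(n-k) c_k(γ)`. -/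
noncomputable def family {n : ℕ} (c : Fin (n + 1) → ℝ[X]) (γ : ℝ) : ℝ[X] :=
  ∑ k : Fin (n + 1), C ((-1) ^ k.val * (c k).eval γ) * X ^ (n - k.val)

/-- The `k`-th moment `Σ x_i^k` of the complex roots, with multiplicity. -/
noncomputable def rootMoment (p : ℝ[X]) (k : ℕ) : ℂ := ((p.aroots ℂ).map fun x => x ^ k).sum

/-- `H(γ) = c_0(γ)^ν (m_{a+b}(p_γ))_{a,b}` with `0 ≤ a, b < n`, for `c_0(γ) ≠ 0`. -/
noncomputable def hankel {n : ℕ} (c : Fin (n + 1) → ℝ[X]) (γ : ℝ) : Matrix (Fin n) (Fin n) ℂ :=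
  Matrix.of fun a b =>
    (((c 0).eval γ : ℝ) : ℂ) ^ SimpleRR.nu n * rootMoment (family c γ) (a.val + b.val)

/-- `e_k(A)`, the sum of the `k × k` principal minors. -/
noncomputable def sumPrincipalMinors {n : ℕ} (k : ℕ) (A : Matrix (Fin n) (Fin n) ℂ) : ℂ :=
  ∑ S ∈ (Finset.univ : Finset (Fin n)).powersetCard k,
    (A.submatrix (fun i : S => (i : Fin n)) fun i : S => (i : Fin n)).det

namespace SimpleRR

/-- A valid input: `c_0, …, c_n` have degree at most `d`, `c_0` is not the zero polynomial, and the
registers `h k j` hold the coefficients. -/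
def ValidInput {n : ℕ} (d : ℕ) (c : Fin (n + 1) → ℝ[X]) (h : Fin (n + 1) → Fin (d + 1) → ℕ)
    (mem : List ℂ) : Prop :=
  (∀ k, (c k).natDegree ≤ d) ∧ c 0 ≠ 0 ∧
    ∀ k, Holds mem (h k) fun j => (((c k).coeff j : ℝ) : ℂ)

/-- The result of a run outputs the polynomials `q` (all of degree less than `numPoints n d`). -/
def Outputs {n d : ℕ} (r : RunResult ℂ (Fin n → Fin (numPoints n d) → ℕ)) (q : Fin n → ℝ[X]) :
    Prop :=
  ∀ k, (q k).natDegree < numPoints n d ∧ Holds r.mem (r.out k) fun j => (((q k).coeff j : ℝ) : ℂ)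

end SimpleRR

/-! ### A program logic with costs -/

namespace Prog

variable {K : Type} {α β : Type}

section

variable [Field K] [DecidableEq K]

/-! Correctness. Newton's identities, multiplied by powers of c_0, become a recursion for r_k =
c_0^k m_k that uses ring operations only. So the matrix with entries c_0^(ν-(a+b)) r_{a+b}
(`hankelMat`) makes sense over every commutative ring and commutes with ring homomorphisms, in
particular with evaluation at real γ and at roots of unity. Over ℝ[γ] its entries have degree at
most dν, hence its sums of principal minors have degree at most ndν < N, and interpolation at the
N-th roots of unity recovers them exactly (`SimpleRR.outputs_prog`).

The criterion is Hermite's. For c_0(γ) ≠ 0 the quadratic form of H(γ) at a real vector y is c_0^ν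
Σ_i f_y(x_i)^2, where f_y is the polynomial with coefficients y and the x_i are the roots
(`coe_quadratic_form`). As ν is even, real roots make it nonnegative. If w is a non-real root, a
real f_y with values i at w, -i at its conjugate and 0 at the other roots makes it negative. A
symmetric matrix is positive semidefinite iff all e_k are nonnegative
(`posSemidef_iff_minorSum_nonneg`). The parameters with c_0(γ) = 0 are limits of others:
nonnegativity passes to the limit by continuity, and real-rootedness because it implies |p(a + isb)|
≤ |p(a + ib)| for 0 ≤ s ≤ 1, a closed condition on γ (`realRooted_family_of_eval_ne_zero`).

Running time. The characteristic polynomial is reduced to matrix multiplication with a factor log^3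
n. Block elimination with zero tests gives generalized inverses of arbitrary matrices
(`IsPivotInverse.fromCols`); repeated doubling gives a matrix whose range is the Krylov space of
half of a set of generators; this invariant subspace and its quotient are treated recursively, each
with half of the generators (`FastMul.achieves_charpolyGen`). With a single generator, the
coefficients solve a linear system. Interpolation is a mixed radix Fourier transform over the prime
factors of N, of cost O(N · sum of the prime factors). Since N is by definition a product of three
factors of size O(n), d + 1 and O(n), that sum is O(n + d), so the n interpolations cost O(dn^4 +
d^2 n^3). Horner evaluation at all sample points also costs O(d^2 n^3 + dn^2·n). The terms dn^4 are
absorbed because ω ≥ 2, which itself follows by counting output registers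
(`IsMatMulExponent.two_le`). -/

theorem run_bind (p : Prog K α) (f : α → Prog K β) (mem : List K) :
    (p >>= f).run mem =
      ⟨((f (p.run mem).out).run (p.run mem).mem).out,
        ((f (p.run mem).out).run (p.run mem).mem).mem,
        (p.run mem).cost + ((f (p.run mem).out).run (p.run mem).mem).cost⟩ := by
  change (p.bind f).run mem = _
  induction p generalizing mem with
  | ret a => simp [Prog.bind, run]
  | const z k ih => simp [Prog.bind, run, ih]; omega
  | arith o i j k ih => simp [Prog.bind, run, ih]; omega
  | test i k ih => simp [Prog.bind, run, ih]; omega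

/-- Registers are never overwritten, so every fact about register contents persists through later
instructions. -/
theorem prefix_run (p : Prog K α) (mem : List K) : mem <+: (p.run mem).mem := by
  induction p generalizing mem with
  | ret a => simp [run]
  | const z k ih => exact (List.prefix_append mem [z]).trans (ih _ _)
  | arith o i j k ih => exact (List.prefix_append mem _).trans (ih _ _)
  | test i k ih => exact ih _ _

/-- An instruction appends at most one register. Counting new registers therefore bounds the cost
from below. -/
theorem length_run_le (p : Prog K α) (mem : List K) :
    (p.run mem).mem.length ≤ mem.length + (p.run mem).cost := by
  induction p generalizing mem with
  | ret a => simp [run]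
  | const z k ih =>
    have := ih mem.length (mem ++ [z])
    simp only [List.length_append, List.length_singleton] at this
    simp only [run]; omega
  | arith o i j k ih =>
    have := ih mem.length (mem ++ [o.apply (mem.getD i 0) (mem.getD j 0)])
    simp only [List.length_append, List.length_singleton] at this
    simp only [run]; omega
  | test i k ih =>
    have := ih (decide (mem.getD i 0 = 0)) mem
    simp only [run]; omega

end

/-- Register `i` exists and holds `x`. -/
def HasVal (mem : List K) (i : ℕ) (x : K) : Prop := mem[i]? = some x

theorem HasVal.mono {mem mem' : List K} {i : ℕ} {x : K} (h : HasVal mem i x)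
    (hm : mem <+: mem') : HasVal mem' i x := by
  obtain ⟨l, rfl⟩ := hm
  unfold HasVal at *
  rw [List.getElem?_append_left (List.getElem?_eq_some_iff.1 h).1, h]

theorem HasVal.getD_eq {mem : List K} {i : ℕ} {x d : K} (h : HasVal mem i x) :
    mem.getD i d = x := by
  unfold HasVal at h
  simp [List.getD, h]

theorem hasVal_append (mem : List K) (x : K) : HasVal (mem ++ [x]) mem.length x := by
  simp [HasVal]

variable [Field K] [DecidableEq K]

/-- The run of `p` from `mem` ends with postcondition `Q` and, if timed (`t`), costs at most `c`. -/
structure Achieves (t : Prop) (p : Prog K α) (mem : List K) (c : ℝ)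
    (Q : α → List K → Prop) : Prop where
  post : Q (p.run mem).out (p.run mem).mem
  cost_le : t → ((p.run mem).cost : ℝ) ≤ c

variable {t : Prop} {mem : List K} {c c' : ℝ}

theorem Achieves.mono {p : Prog K α} {Q Q' : α → List K → Prop} (h : Achieves t p mem c Q)
    (hc : c ≤ c') (hQ : ∀ a m, mem <+: m → Q a m → Q' a m) : Achieves t p mem c' Q' :=
  ⟨hQ _ _ (prefix_run p mem) h.post, fun ht => (h.cost_le ht).trans hc⟩

theorem Achieves.mono_cost {p : Prog K α} {Q : α → List K → Prop} (h : Achieves t p mem c Q)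
    (hc : c ≤ c') : Achieves t p mem c' Q :=
  h.mono hc fun _ _ _ h => h

theorem Achieves.bind {p : Prog K α} {f : α → Prog K β} {Q : α → List K → Prop}
    {R : β → List K → Prop} (h : Achieves t p mem c Q)
    (hf : ∀ a m, mem <+: m → Q a m → Achieves t (f a) m c' R) :
    Achieves t (p >>= f) mem (c + c') R := by
  have hf' := hf _ _ (prefix_run p mem) h.post
  refine ⟨?_, fun ht => ?_⟩
  · rw [run_bind]; exact hf'.post
  · rw [run_bind]
    push_cast
    exact add_le_add (h.cost_le ht) (hf'.cost_le ht)

theorem achieves_pure {a : α} {Q : α → List K → Prop} (h : Q a mem) :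
    Achieves t (pure a) mem 0 Q :=
  ⟨h, fun _ => by simp [pure, run]⟩

theorem achieves_lit (z : K) : Achieves t (lit z) mem 1 fun i m => HasVal m i z :=
  ⟨hasVal_append _ _, fun _ => by simp [lit, run]⟩

theorem achieves_arith (o : ArithOp) {i j : ℕ} {x y : K} (hi : HasVal mem i x)
    (hj : HasVal mem j y) :
    Achieves t (arith o i j ret) mem 1 fun l m => HasVal m l (o.apply x y) := by
  refine ⟨?_, fun _ => by simp [run]⟩
  have := hasVal_append mem (o.apply (mem.getD i 0) (mem.getD j 0))
  rw [hi.getD_eq, hj.getD_eq] at this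
  simpa only [run, hi.getD_eq, hj.getD_eq] using this

theorem achieves_add {i j : ℕ} {x y : K} (hi : HasVal mem i x) (hj : HasVal mem j y) :
    Achieves t (add i j) mem 1 fun l m => HasVal m l (x + y) :=
  achieves_arith .add hi hj

theorem achieves_mul {i j : ℕ} {x y : K} (hi : HasVal mem i x) (hj : HasVal mem j y) :
    Achieves t (mul i j) mem 1 fun l m => HasVal m l (x * y) :=
  achieves_arith .mul hi hj

theorem achieves_test {i : ℕ} {x : K} (hi : HasVal mem i x) :
    Achieves t (test i ret) mem 1 fun b _ => (b = true ↔ x = 0) := by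
  refine ⟨?_, fun _ => by simp [run]⟩
  simp only [run, hi.getD_eq, decide_eq_true_eq]

/-- The postconditions have to be stable under extension of the memory, since the results of early
passes are used only after the later passes have run. -/
theorem achieves_forFin {n : ℕ} {f : Fin n → Prog K β} {Q : Fin n → β → List K → Prop}
    (hQ : ∀ i b m m', m <+: m' → Q i b m → Q i b m')
    (hf : ∀ i m, mem <+: m → Achieves t (f i) m c (Q i)) :
    Achieves t (forFin n f) mem (n * c) fun bs m => ∀ i, Q i (bs i) m := by
  induction n generalizing mem with
  | zero => exact (achieves_pure fun i => i.elim0).mono_cost (by simp)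
  | succ n ih =>
    refine Achieves.mono_cost (c := c + (n * c + 0)) ?_ (by push_cast; linarith)
    refine (hf 0 mem List.prefix_rfl).bind fun b m hm hb => ?_
    refine (ih (fun i => hQ i.succ) fun i m' hm' => hf i.succ m' (hm.trans hm')).bind
      fun bs m' hm' hbs => ?_
    refine achieves_pure fun i => ?_
    refine Fin.cases ?_ (fun i => ?_) i
    · exact hQ 0 b m m' hm' hb
    · exact hbs i

theorem achieves_forFin_val {n : ℕ} {f : Fin n → Prog K ℕ} {v : Fin n → K}
    (hf : ∀ i m, mem <+: m → Achieves t (f i) m c fun l m' => HasVal m' l (v i)) :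
    Achieves t (forFin n f) mem (n * c) fun bs m => ∀ i, HasVal m (bs i) (v i) :=
  achieves_forFin (Q := fun i b m => HasVal m b (v i)) (fun _ _ _ _ hm h => h.mono hm) hf

/-- Execute `f i` for all elements `i` of a finite type and collect the results. -/
noncomputable def forAll {ι : Type} [Fintype ι] (f : ι → Prog K β) : Prog K (ι → β) := do
  let b ← forFin (Fintype.card ι) fun i => f ((Fintype.equivFin ι).symm i)
  pure fun i => b (Fintype.equivFin ι i)

theorem achieves_forAll {ι : Type} [Fintype ι] {f : ι → Prog K ℕ} {v : ι → K}
    (hf : ∀ i m, mem <+: m → Achieves t (f i) m c fun l m' => HasVal m' l (v i)) :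
    Achieves t (forAll f) mem (Fintype.card ι * c) fun bs m => ∀ i, HasVal m (bs i) (v i) := by
  refine Achieves.mono_cost (c := Fintype.card ι * c + 0) ?_ (by simp)
  refine (achieves_forFin_val (v := fun i => v ((Fintype.equivFin ι).symm i))
    fun i m hm => hf _ m hm).bind fun b m _ hb => achieves_pure fun i => ?_
  simpa using hb (Fintype.equivFin ι i)

theorem achieves_dot {X : Type} (l : List X) {a b : X → ℕ} {x y : X → K}
    (ha : ∀ i ∈ l, HasVal mem (a i) (x i)) (hb : ∀ i ∈ l, HasVal mem (b i) (y i)) :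
    Achieves t (dot (l.map fun i => (a i, b i))) mem (2 * l.length + 1) fun r m =>
      HasVal m r (l.map fun i => x i * y i).sum := by
  induction l with
  | nil => exact (achieves_lit 0).mono_cost (by simp)
  | cons i l ih =>
    simp only [List.mem_cons, forall_eq_or_imp] at ha hb
    refine Achieves.mono_cost (c := (2 * l.length + 1) + (1 + 1)) ?_
      (by push_cast [List.length_cons]; linarith)
    refine (ih ha.2 hb.2).bind fun s m hm hs => ?_
    refine (achieves_mul (ha.1.mono hm) (hb.1.mono hm)).bind fun w m' hm' hw => ?_
    refine (achieves_add (hs.mono hm') hw).mono le_rfl fun r m'' _ hr => ?_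
    simpa [add_comm] using hr

theorem achieves_horner {x : ℕ} {z : K} (hx : HasVal mem x z) {l : List ℕ} {v : List K}
    (h : List.Forall₂ (HasVal mem) l v) :
    Achieves t (horner x l) mem (2 * l.length + 1) fun r m =>
      HasVal m r (v.foldr (fun a s => s * z + a) 0) := by
  induction h with
  | nil => exact (achieves_lit 0).mono_cost (by simp)
  | @cons a y l v ha _ ih =>
    refine Achieves.mono_cost (c := (2 * l.length + 1) + (1 + 1)) ?_
      (by push_cast [List.length_cons]; linarith)
    refine ih.bind fun s m hm hs => ?_
    refine (achieves_mul hs (hx.mono hm)).bind fun w m' hm' hw => ?_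
    exact achieves_add hw ((ha.mono hm).mono hm')

theorem foldr_ofFn_horner (z : K) {n : ℕ} (a : Fin n → K) :
    (List.ofFn a).foldr (fun a s => s * z + a) 0 = ∑ j, a j * z ^ j.val := by
  induction n with
  | zero => simp
  | succ n ih =>
    rw [List.ofFn_succ, List.foldr_cons, ih, Fin.sum_univ_succ, Finset.sum_mul]
    simp [pow_succ, mul_assoc, add_comm]

theorem achieves_horner_ofFn {x : ℕ} {z : K} (hx : HasVal mem x z) {n : ℕ} {h : Fin n → ℕ}
    {a : Fin n → K} (ha : ∀ j, HasVal mem (h j) (a j)) :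
    Achieves t (horner x (List.ofFn h)) mem (2 * n + 1) fun r m =>
      HasVal m r (∑ j, a j * z ^ j.val) := by
  have h2 : List.Forall₂ (HasVal mem) (List.ofFn h) (List.ofFn a) := by
    rw [List.forall₂_iff_get]
    refine ⟨by simp, fun i h₁ h₂ => ?_⟩
    simpa using ha _
  refine (achieves_horner hx h2).mono (by simp) fun r m _ hr => ?_
  rwa [foldr_ofFn_horner] at hr

theorem achieves_powers {x : ℕ} {z : K} (hx : HasVal mem x z) (n : ℕ) :
    Achieves t (powers x n) mem (n + 1) fun l m =>
      l.length = n + 1 ∧ ∀ j ≤ n, HasVal m (l.getD j 0) (z ^ j) := by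
  induction n with
  | zero =>
    refine Achieves.mono_cost (c := 1 + 0) ?_ (by simp)
    refine (achieves_lit 1).bind fun o m _ ho => achieves_pure ⟨rfl, fun j hj => ?_⟩
    obtain rfl : j = 0 := by omega
    simpa using ho
  | succ n ih =>
    refine Achieves.mono_cost (c := (n + 1) + (1 + 0)) ?_ (by push_cast; linarith)
    refine ih.bind fun l m hm hl => ?_
    refine (achieves_mul (hl.2 n le_rfl) (hx.mono hm)).bind fun y m' hm' hy => ?_
    refine achieves_pure ⟨by simp [hl.1], fun j hj => ?_⟩
    rcases Nat.lt_or_ge j (n + 1) with h | h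
    · rw [List.getD_append _ _ _ _ (by omega)]
      exact (hl.2 j (by omega)).mono hm'
    · obtain rfl : j = n + 1 := by omega
      rw [List.getD_append_right _ _ _ _ (by omega), hl.1]
      simpa [pow_succ] using hy

end Prog

/-! ### Matrix programs -/

open Prog in
/-- A matrix multiplication program has to write `n ^ 2` new registers. -/
theorem sq_le_cost_of_computes_mul {n : ℕ}
    (p : (Fin n → Fin n → ℕ) → (Fin n → Fin n → ℕ) → Prog ℂ (Fin n → Fin n → ℕ))
    (hp : ∀ (A B : Matrix (Fin n) (Fin n) ℂ) (hA hB : Fin n → Fin n → ℕ) (mem : List ℂ),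
      (∀ a, Holds mem (hA a) (A a)) → (∀ a, Holds mem (hB a) (B a)) →
      ∀ a, Holds ((p hA hB).run mem).mem (((p hA hB).run mem).out a) ((A * B) a)) :
    ∃ (A B : Matrix (Fin n) (Fin n) ℂ) (hA hB : Fin n → Fin n → ℕ) (mem : List ℂ),
      (∀ a, Holds mem (hA a) (A a)) ∧ (∀ a, Holds mem (hB a) (B a)) ∧
      n ^ 2 ≤ ((p hA hB).run mem).cost := by
  let idx : Fin n × Fin n ≃ Fin (n * n) := finProdFinEquiv
  -- A is (n² + 2) times the identity and B has the distinct entries 2, …, n² + 1. The entries of A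
  -- B are then pairwise distinct and at least 2(n² + 2), larger than every input entry.
  let A' : Fin n → Fin n → ℕ := fun a b => if a = b then n * n + 2 else 0
  let B' : Fin n → Fin n → ℕ := fun a b => 2 + (idx (a, b)).val
  let A : Matrix (Fin n) (Fin n) ℂ := Matrix.of fun a b => (A' a b : ℂ)
  let B : Matrix (Fin n) (Fin n) ℂ := Matrix.of fun a b => (B' a b : ℂ)
  let mem : List ℂ := (List.ofFn fun x => A (idx.symm x).1 (idx.symm x).2) ++
    List.ofFn fun x => B (idx.symm x).1 (idx.symm x).2
  let hA : Fin n → Fin n → ℕ := fun a b => (idx (a, b)).val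
  let hB : Fin n → Fin n → ℕ := fun a b => n * n + (idx (a, b)).val
  have hAh : ∀ a, Holds mem (hA a) (A a) := fun a b => by
    simp only [mem, hA]
    rw [List.getElem?_append_left (by simp)]
    simp
  have hBh : ∀ a, Holds mem (hB a) (B a) := fun a b => by
    simp only [mem, hB]
    rw [List.getElem?_append_right (by simp)]
    simp
  have hAB : ∀ a b, (A * B) a b = (((n * n + 2) * B' a b : ℕ) : ℂ) := fun a b => by
    simp [Matrix.mul_apply, A, B, A', ite_mul]
  refine ⟨A, B, hA, hB, mem, hAh, hBh, ?_⟩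
  have hout := hp A B hA hB mem hAh hBh
  set r := (p hA hB).run mem with hr
  have hlen : r.mem.length ≤ mem.length + r.cost := length_run_le _ _
  -- An output register from the initial memory would still hold an input entry, and no entry of A B
  -- is one.
  have hge : ∀ a b, mem.length ≤ r.out a b := by
    intro a b
    by_contra! hlt
    have h1 : r.mem[r.out a b]? = some (mem[r.out a b]) :=
      HasVal.mono (List.getElem?_eq_getElem hlt) (prefix_run _ mem)
    have h2 : (A * B) a b ∈ mem := by
      have := hout a b
      rw [h1] at this
      exact Option.some.inj this ▸ List.getElem_mem hlt
    rw [hAB, List.mem_append, List.mem_ofFn, List.mem_ofFn] at h2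
    rcases h2 with ⟨x, hx⟩ | ⟨x, hx⟩
    · simp only [A, A', Matrix.of_apply] at hx
      have hx := Nat.cast_injective (R := ℂ) hx
      simp only [B'] at hx
      split_ifs at hx <;> nlinarith [(idx (a, b)).val.zero_le]
    · simp only [B, B', Matrix.of_apply] at hx
      have hx := Nat.cast_injective (R := ℂ) hx
      have h3 := (idx ((idx.symm x).1, (idx.symm x).2)).isLt
      nlinarith [(idx (a, b)).val.zero_le]
  have hlt : ∀ a b, r.out a b < r.mem.length := fun a b =>
    (List.getElem?_eq_some_iff.1 (hout a b)).1
  have hinj : Function.Injective fun x : Fin n × Fin n => r.out x.1 x.2 := by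
    intro x y hxy
    have h1 := hout x.1 x.2
    have h2 := hout y.1 y.2
    simp only at hxy
    rw [hxy, h2, Option.some_inj, hAB, hAB] at h1
    have h3 := Nat.eq_of_mul_eq_mul_left (by omega) (Nat.cast_injective (R := ℂ) h1)
    exact (idx.injective (Fin.ext (Nat.add_left_cancel h3))).symm
  have hcard := Finset.card_le_card_of_injOn (s := Finset.univ)
    (t := Finset.Ico mem.length r.mem.length) (fun x : Fin n × Fin n => r.out x.1 x.2)
    (fun x _ => by simp [hge, hlt]) hinj.injOn
  simp only [Finset.card_univ, Fintype.card_prod, Fintype.card_fin, Nat.card_Ico] at hcard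
  rw [sq]
  omega

/-- Writing the n² entries of a product forces n² ≤ C n^ω for all n ≥ 1. All later cost estimates
depend on this: quadratic work is free and halving the size divides the cost by at least 4. -/
theorem IsMatMulExponent.two_le {ω : ℝ} (h : IsMatMulExponent ω) : 2 ≤ ω := by
  obtain ⟨mm, C, h⟩ := h
  by_contra! hω
  have key : ∀ n : ℕ, 1 ≤ n → ((n : ℕ) : ℝ) ^ (2 - ω) ≤ C := by
    intro n hn
    obtain ⟨A, B, hA, hB, mem, hAh, hBh, hc⟩ := sq_le_cost_of_computes_mul (mm n)
      fun A B hA hB mem h1 h2 => (h n hn A B hA hB mem h1 h2).1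
    have h1 := (h n hn A B hA hB mem hAh hBh).2
    have hn0 : (0 : ℝ) < n := by exact_mod_cast hn
    have h2 : ((n : ℝ)) ^ (2 : ℝ) ≤ C * (n : ℝ) ^ ω := by
      refine le_trans ?_ h1
      rw [Real.rpow_two]
      exact_mod_cast hc
    rw [Real.rpow_sub hn0, div_le_iff₀ (Real.rpow_pos_of_pos hn0 _)]
    exact h2
  have ht : Filter.Tendsto (fun n : ℕ => ((n : ℕ) : ℝ) ^ (2 - ω)) Filter.atTop Filter.atTop :=
    (tendsto_rpow_atTop (by linarith)).comp tendsto_natCast_atTop_atTop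
  obtain ⟨n, hn, hn'⟩ := ((ht.eventually_gt_atTop C).and (Filter.eventually_ge_atTop 1)).exists
  exact absurd (key n hn') (not_le.2 hn)

/-- A matrix multiplication program of cost at most `C n ^ ω`. -/
structure FastMul (ω : ℝ) where
  mm : (n : ℕ) → (Fin n → Fin n → ℕ) → (Fin n → Fin n → ℕ) → Prog ℂ (Fin n → Fin n → ℕ)
  C : ℝ
  one_le : 1 ≤ C
  two_le : 2 ≤ ω
  spec : ∀ n : ℕ, 1 ≤ n → ∀ (A B : Matrix (Fin n) (Fin n) ℂ) (hA hB : Fin n → Fin n → ℕ)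
    (mem : List ℂ), (∀ a, Holds mem (hA a) (A a)) → (∀ a, Holds mem (hB a) (B a)) →
    (∀ a, Holds ((mm n hA hB).run mem).mem (((mm n hA hB).run mem).out a) ((A * B) a)) ∧
    (((mm n hA hB).run mem).cost : ℝ) ≤ C * (n : ℝ) ^ ω

theorem IsMatMulExponent.nonempty_fastMul {ω : ℝ} (h : IsMatMulExponent ω) :
    Nonempty (FastMul ω) := by
  have h2 := h.two_le
  obtain ⟨mm, C, h⟩ := h
  refine ⟨⟨mm, max C 1, le_max_right _ _, h2, fun n hn A B hA hB mem h1 h2 => ?_⟩⟩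
  refine ⟨(h n hn A B hA hB mem h1 h2).1, (h n hn A B hA hB mem h1 h2).2.trans ?_⟩
  gcongr
  exact le_max_left _ _

/-- The registers `h i j` hold the entries of the matrix `A`. -/
def RegMat {ι κ : Type} (mem : List ℂ) (h : ι → κ → ℕ) (A : Matrix ι κ ℂ) : Prop :=
  ∀ i j, Prog.HasVal mem (h i j) (A i j)

theorem RegMat.mono {ι κ : Type} {mem mem' : List ℂ} {h : ι → κ → ℕ} {A : Matrix ι κ ℂ}
    (hA : RegMat mem h A) (hm : mem <+: mem') : RegMat mem' h A :=
  fun i j => (hA i j).mono hm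

/-- Registers or entries of a matrix, extended by a default value. -/
noncomputable def padMat {ι κ ι' κ' X : Type} (e : ι → ι') (f : κ → κ') (z : X) (h : ι → κ → X) :
    ι' → κ' → X :=
  Function.extend e (fun i => Function.extend f (h i) fun _ => z) fun _ _ => z

section padMat

variable {ι κ ι' κ' X : Type} {e : ι → ι'} {f : κ → κ'} {z : X} {h : ι → κ → X}

theorem padMat_apply (he : e.Injective) (hf : f.Injective) (i : ι) (j : κ) :
    padMat e f z h (e i) (f j) = h i j := by
  rw [padMat, he.extend_apply, hf.extend_apply]

theorem padMat_of_notMem_left {i : ι'} (hi : i ∉ Set.range e) (j : κ') :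
    padMat e f z h i j = z := by
  rw [padMat, Function.extend_apply' _ _ _ (by simpa using hi)]

theorem padMat_of_notMem_right (he : e.Injective) (i : ι') {j : κ'} (hj : j ∉ Set.range f) :
    padMat e f z h i j = z := by
  by_cases hi : i ∈ Set.range e
  · obtain ⟨i, rfl⟩ := hi
    rw [padMat, he.extend_apply, Function.extend_apply' _ _ _ (by simpa using hj)]
  · exact padMat_of_notMem_left hi j

/-- A matrix extended by zeros. -/
noncomputable def Matrix.pad (e : ι → ι') (f : κ → κ') (A : Matrix ι κ ℂ) : Matrix ι' κ' ℂ :=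
  Matrix.of (padMat e f 0 fun i j => A i j)

theorem Matrix.pad_apply (he : e.Injective) (hf : f.Injective) (A : Matrix ι κ ℂ) (i : ι) (j : κ) :
    A.pad e f (e i) (f j) = A i j := by
  rw [Matrix.pad, Matrix.of_apply, padMat_apply he hf]

theorem Matrix.pad_of_notMem_left {A : Matrix ι κ ℂ} {i : ι'} (hi : i ∉ Set.range e) (j : κ') :
    A.pad e f i j = 0 := by
  rw [Matrix.pad, Matrix.of_apply, padMat_of_notMem_left hi]

theorem Matrix.pad_of_notMem_right (he : e.Injective) {A : Matrix ι κ ℂ} (i : ι') {j : κ'}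
    (hj : j ∉ Set.range f) : A.pad e f i j = 0 := by
  rw [Matrix.pad, Matrix.of_apply, padMat_of_notMem_right he _ hj]

/-- All padding positions refer to one register that holds 0, so padding costs a single instruction.
-/
theorem RegMat.pad (he : e.Injective) (hf : f.Injective) {mem : List ℂ} {h : ι → κ → ℕ}
    {A : Matrix ι κ ℂ} (hA : RegMat mem h A) {z : ℕ} (hz : Prog.HasVal mem z 0) :
    RegMat mem (padMat e f z h) (A.pad e f) := by
  intro i j
  by_cases hi : i ∈ Set.range e
  · by_cases hj : j ∈ Set.range f
    · obtain ⟨i, rfl⟩ := hi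
      obtain ⟨j, rfl⟩ := hj
      rw [padMat_apply he hf, Matrix.pad_apply he hf]
      exact hA i j
    · rw [padMat_of_notMem_right he _ hj, Matrix.pad_of_notMem_right he _ hj]
      exact hz
  · rw [padMat_of_notMem_left hi, Matrix.pad_of_notMem_left hi]
    exact hz

theorem Matrix.pad_mul {l l' : Type} {g : l → l'} [Fintype κ] [Fintype κ'] (he : e.Injective)
    (hf : f.Injective) (hg : g.Injective) (A : Matrix ι κ ℂ) (B : Matrix κ l ℂ) :
    A.pad e f * B.pad f g = (A * B).pad e g := by
  ext i j
  rw [Matrix.mul_apply]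
  by_cases hi : i ∈ Set.range e
  · by_cases hj : j ∈ Set.range g
    · obtain ⟨i, rfl⟩ := hi
      obtain ⟨j, rfl⟩ := hj
      rw [Matrix.pad_apply he hg, Matrix.mul_apply]
      refine (Fintype.sum_of_injective f hf _ _ (fun k hk => ?_) fun k => ?_).symm
      · rw [Matrix.pad_of_notMem_left hk, mul_zero]
      · rw [Matrix.pad_apply he hf, Matrix.pad_apply hf hg]
    · rw [Matrix.pad_of_notMem_right he _ hj]
      exact Finset.sum_eq_zero fun k _ => by rw [Matrix.pad_of_notMem_right hf _ hj, mul_zero]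
  · rw [Matrix.pad_of_notMem_left hi]
    exact Finset.sum_eq_zero fun k _ => by rw [Matrix.pad_of_notMem_left hi, zero_mul]

end padMat

/-- An enumeration of a type with at most `s` elements. -/
noncomputable def enumFin (ι : Type) [Fintype ι] {s : ℕ} (h : Fintype.card ι ≤ s) : ι → Fin s :=
  fun i => Fin.castLE h (Fintype.equivFin ι i)

theorem enumFin_injective (ι : Type) [Fintype ι] {s : ℕ} (h : Fintype.card ι ≤ s) :
    (enumFin ι h).Injective :=
  (Fin.castLE_injective h).comp (Fintype.equivFin ι).injective

open Prog

/-- Entrywise subtraction. -/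
noncomputable def msub {ι κ : Type} [Fintype ι] [Fintype κ] (h h' : ι → κ → ℕ) :
    Prog ℂ (ι → κ → ℕ) := do
  let r ← forAll fun x : ι × κ => arith .sub (h x.1 x.2) (h' x.1 x.2) ret
  pure fun i j => r (i, j)

namespace FastMul

variable {ω : ℝ} (F : FastMul ω) {ι κ l : Type} [Fintype ι] [Fintype κ] [Fintype l]

/-- The padded size for a product. -/
noncomputable def size (ι κ l : Type) [Fintype ι] [Fintype κ] [Fintype l] : ℕ :=
  max 1 (max (Fintype.card ι) (max (Fintype.card κ) (Fintype.card l)))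

theorem card_le_size_left : Fintype.card ι ≤ size ι κ l := by simp [size]

theorem card_le_size_mid : Fintype.card κ ≤ size ι κ l := by simp [size]

theorem card_le_size_right : Fintype.card l ≤ size ι κ l := by simp [size]

/-- Multiplication of rectangular matrices. -/
noncomputable def mmul (h : ι → κ → ℕ) (h' : κ → l → ℕ) : Prog ℂ (ι → l → ℕ) := do
  let z ← lit 0
  let r ← F.mm (size ι κ l)
    (padMat (enumFin ι card_le_size_left) (enumFin κ card_le_size_mid) z h)
    (padMat (enumFin κ card_le_size_mid) (enumFin l card_le_size_right) z h')
  pure fun i j => r (enumFin ι card_le_size_left i) (enumFin l card_le_size_right j)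

/-- A bound for the cost of an operation on matrices with at most `s` rows and columns. -/
noncomputable def cost (s : ℕ) : ℝ := (F.C + 1) * (s : ℝ) ^ ω

theorem cost_mono {s s' : ℕ} (h : s ≤ s') : F.cost s ≤ F.cost s' := by
  have := F.one_le
  have := F.two_le
  unfold cost
  gcongr

theorem sq_le_cost (s : ℕ) : (s : ℝ) ^ 2 ≤ F.cost s := by
  have h1 := F.one_le
  have h2 := F.two_le
  rcases Nat.eq_zero_or_pos s with rfl | hs
  · have : ω ≠ 0 := by linarith
    simp [cost, Real.zero_rpow this]
  · have hs' : (1 : ℝ) ≤ s := by exact_mod_cast hs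
    have h3 : (s : ℝ) ^ (2 : ℝ) ≤ (s : ℝ) ^ ω := Real.rpow_le_rpow_of_exponent_le hs' h2
    rw [Real.rpow_two] at h3
    unfold cost
    nlinarith [sq_nonneg (s : ℝ)]

theorem one_le_cost {s : ℕ} (hs : 1 ≤ s) : 1 ≤ F.cost s := by
  have hs' : (1 : ℝ) ≤ s := by exact_mod_cast hs
  nlinarith [F.sq_le_cost s]

theorem cost_nonneg (s : ℕ) : 0 ≤ F.cost s := (sq_nonneg _).trans (F.sq_le_cost s)

/-- Superadditivity of s ↦ s^ω for ω ≥ 1. It bounds the joint cost of a subspace and its quotient.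
-/
theorem cost_add_le (s s' : ℕ) : F.cost s + F.cost s' ≤ F.cost (s + s') := by
  have h1 := F.one_le
  have h2 := F.two_le
  have h3 := NNReal.add_rpow_le_rpow_add (s : NNReal) (s' : NNReal) (p := ω) (by linarith)
  have h4 : (s : ℝ) ^ ω + (s' : ℝ) ^ ω ≤ ((s + s' : ℕ) : ℝ) ^ ω := by exact_mod_cast h3
  unfold cost
  nlinarith

/-- This is 2^ω ≥ 4. It pays for the four half-size calls in the pivot inversion. -/
theorem four_mul_cost_le (s : ℕ) : 4 * F.cost s ≤ F.cost (2 * s) := by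
  have h1 := F.one_le
  have h2 := F.two_le
  unfold cost
  push_cast
  rw [Real.mul_rpow (by norm_num) (by positivity)]
  have h3 : (2 : ℝ) ^ (2 : ℝ) ≤ (2 : ℝ) ^ ω := Real.rpow_le_rpow_of_exponent_le (by norm_num) h2
  rw [Real.rpow_two] at h3
  have h4 : (0 : ℝ) ≤ (F.C + 1) * (s : ℝ) ^ ω := by positivity
  nlinarith

variable {t : Prop} {mem : List ℂ} {s : ℕ}

/-- The summand 1 in `F.C + 1` pays for loading the padding zero. -/
theorem achieves_mmul {h : ι → κ → ℕ} {h' : κ → l → ℕ} {A : Matrix ι κ ℂ} {B : Matrix κ l ℂ}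
    (hA : RegMat mem h A) (hB : RegMat mem h' B) (hs : 1 ≤ s) (h₁ : Fintype.card ι ≤ s)
    (h₂ : Fintype.card κ ≤ s) (h₃ : Fintype.card l ≤ s) :
    Achieves t (F.mmul h h') mem (F.cost s) fun o m => RegMat m o (A * B) := by
  have hsz : size ι κ l ≤ s := by simp [size, hs, h₁, h₂, h₃]
  have h1 := F.one_le
  have hω := F.two_le
  refine Achieves.mono_cost (c := 1 + (F.C * (s : ℝ) ^ ω + 0)) ?_ ?_
  · refine (achieves_lit 0).bind fun z m hm hz => ?_
    refine Achieves.bind (Q := fun o m => RegMat m o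
      ((A * B).pad (enumFin ι card_le_size_left) (enumFin l card_le_size_right) :
        Matrix (Fin (size ι κ l)) (Fin (size ι κ l)) ℂ)) ?_
      fun o m' hm' ho => achieves_pure fun i j => ?_
    · have hsp := F.spec (size ι κ l) (by simp [size])
        (A.pad (enumFin ι card_le_size_left) (enumFin κ card_le_size_mid))
        (B.pad (enumFin κ card_le_size_mid) (enumFin l card_le_size_right))
        _ _ m ((hA.mono hm).pad (enumFin_injective _ _) (enumFin_injective _ _) hz)
        ((hB.mono hm).pad (enumFin_injective _ _) (enumFin_injective _ _) hz)
      refine ⟨?_, fun _ => hsp.2.trans ?_⟩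
      · rw [← Matrix.pad_mul (enumFin_injective _ _) 
          (enumFin_injective κ (card_le_size_mid (ι := ι) (l := l))) (enumFin_injective _ _)]
        exact fun i j => hsp.1 i j
      · gcongr
    · have := ho (enumFin ι card_le_size_left i) (enumFin l card_le_size_right j)
      rwa [Matrix.pad_apply (enumFin_injective _ _) (enumFin_injective _ _)] at this
  · have hs' : (1 : ℝ) ≤ (s : ℝ) ^ ω :=
      Real.one_le_rpow (by exact_mod_cast hs) (by linarith)
    unfold cost
    linarith

theorem achieves_msub {h h' : ι → κ → ℕ} {A B : Matrix ι κ ℂ}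
    (hA : RegMat mem h A) (hB : RegMat mem h' B) (h₁ : Fintype.card ι ≤ s)
    (h₂ : Fintype.card κ ≤ s) :
    Achieves t (msub h h') mem (F.cost s) fun o m => RegMat m o (A - B) := by
  refine Achieves.mono_cost (c := Fintype.card (ι × κ) * 1 + 0) ?_ ?_
  · refine (achieves_forAll (v := fun x : ι × κ => A x.1 x.2 - B x.1 x.2) fun x m hm =>
      achieves_arith .sub ((hA x.1 x.2).mono hm) ((hB x.1 x.2).mono hm)).bind fun r m _ hr =>
        achieves_pure fun i j => hr (i, j)
  · refine le_trans ?_ (F.sq_le_cost s)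
    rw [Fintype.card_prod]
    push_cast
    rw [mul_one, add_zero, sq]
    gcongr

end FastMul

/-! ### Pivot inverses: generalized inverses supported on an invertible minor of full rank -/

/-- `G` is a generalized inverse of `M` that vanishes off `col × row`, where the minor of `M` on
`row × col` is invertible of full rank. -/
structure IsPivotInverse {ι κ : Type} [Fintype ι] [Fintype κ] [DecidableEq ι] [DecidableEq κ]
    (M : Matrix ι κ ℂ) (G : Matrix κ ι ℂ) (row : ι → Bool) (col : κ → Bool) : Prop where
  mul_mul : M * (G * M) = M
  row_eq : ∀ i, row i = true → ∀ j, (M * G) i j = (1 : Matrix ι ι ℂ) i j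
  col_eq : ∀ j, col j = true → ∀ i, (G * M) i j = (1 : Matrix κ κ ℂ) i j
  row_zero : ∀ i, row i = false → ∀ j, G j i = 0
  col_zero : ∀ j, col j = false → ∀ i, G j i = 0

namespace IsPivotInverse

variable {ι κ κ' : Type} [Fintype ι] [Fintype κ] [Fintype κ'] [DecidableEq ι] [DecidableEq κ]
  [DecidableEq κ']

theorem transpose {M : Matrix ι κ ℂ} {G : Matrix κ ι ℂ} {row : ι → Bool} {col : κ → Bool}
    (h : IsPivotInverse M G row col) : IsPivotInverse M.transpose G.transpose col row where
  mul_mul := by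
    rw [← Matrix.transpose_mul, ← Matrix.transpose_mul, Matrix.mul_assoc, h.mul_mul]
  row_eq i hi j := by
    rw [← Matrix.transpose_mul, Matrix.transpose_apply, h.col_eq i hi, Matrix.one_apply,
      Matrix.one_apply]
    simp [eq_comm]
  col_eq i hi j := by
    rw [← Matrix.transpose_mul, Matrix.transpose_apply, h.row_eq i hi, Matrix.one_apply,
      Matrix.one_apply]
    simp [eq_comm]
  row_zero i hi j := h.col_zero i hi j
  col_zero i hi j := h.row_zero i hi j

/-- Block elimination. The residual Q = (1 - M₁G)M₂ is what remains of M₂ after the pivots of M₁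
have been used. The matrix H' = H(1 - M₁G) inverts Q and annihilates M₁, and G - G M₂ H' is back
substitution. -/
theorem fromCols {M₁ : Matrix ι κ ℂ} {M₂ : Matrix ι κ' ℂ} {G : Matrix κ ι ℂ} {H : Matrix κ' ι ℂ}
    {r₁ r₂ : ι → Bool} {c₁ : κ → Bool} {c₂ : κ' → Bool} (h₁ : IsPivotInverse M₁ G r₁ c₁)
    (h₂ : IsPivotInverse (M₂ - M₁ * (G * M₂)) H r₂ c₂) :
    IsPivotInverse (Matrix.fromCols M₁ M₂)
      (Matrix.fromRows (G - G * M₂ * (H - H * M₁ * G)) (H - H * M₁ * G))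
      (fun i => r₁ i || r₂ i) (Sum.elim c₁ c₂) := by
  set Q := M₂ - M₁ * (G * M₂) with hQ
  set H' := H - H * M₁ * G with hH'
  have hMG : Matrix.fromCols M₁ M₂ * Matrix.fromRows (G - G * M₂ * H') H' =
      M₁ * G + Q * H' := by
    rw [Matrix.fromCols_mul_fromRows, hQ, Matrix.mul_sub, Matrix.sub_mul]
    simp only [Matrix.mul_assoc]
    abel
  have hH1 : H' * M₁ = 0 := by
    rw [hH', Matrix.sub_mul, Matrix.mul_assoc, Matrix.mul_assoc, h₁.mul_mul, sub_self]
  have hH2 : H' * M₂ = H * Q := by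
    rw [hH', hQ, Matrix.sub_mul, Matrix.mul_sub]
    simp only [Matrix.mul_assoc]
  -- The product is block triangular with the idempotents G M₁ and H Q on the diagonal; the pivot
  -- columns can be read off from it.
  have hGM : Matrix.fromRows (G - G * M₂ * H') H' * Matrix.fromCols M₁ M₂ =
      Matrix.fromBlocks (G * M₁) (G * M₂ - G * M₂ * (H * Q)) 0 (H * Q) := by
    rw [Matrix.fromRows_mul_fromCols, Matrix.sub_mul, Matrix.sub_mul, Matrix.mul_assoc _ H',
      Matrix.mul_assoc _ H', hH1, hH2, Matrix.mul_zero, sub_zero]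
  have hQH : Q * H' = Q * H - Q * H * (M₁ * G) := by
    rw [hH', Matrix.mul_sub]
    simp only [Matrix.mul_assoc]
  refine ⟨?_, ?_, ?_, ?_, ?_⟩
  · have hQ2 : Q * H' * M₂ = Q := by rw [Matrix.mul_assoc, hH2, h₂.mul_mul]
    have hQ1 : Q * H' * M₁ = 0 := by rw [Matrix.mul_assoc, hH1, Matrix.mul_zero]
    rw [← Matrix.mul_assoc, hMG, Matrix.mul_fromCols, Matrix.add_mul, Matrix.add_mul, hQ1, hQ2,
      Matrix.mul_assoc, h₁.mul_mul, add_zero, Matrix.mul_assoc, hQ, add_sub_cancel]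
  · intro i hi j
    rw [hMG, Matrix.add_apply]
    by_cases h1 : r₁ i = true
    · have hz : ∀ x, Q i x = 0 := fun x => by
        rw [hQ, Matrix.sub_apply, ← Matrix.mul_assoc, Matrix.mul_apply]
        simp [h₁.row_eq i h1, Matrix.one_apply]
      rw [h₁.row_eq i h1, Matrix.mul_apply]
      simp [hz]
    · have h2 : r₂ i = true := by simpa [h1] using hi
      -- In a pivot row of Q the matrix Q H agrees with the identity, so the correction term in Q H'
      -- cancels M₁G.
      have : (Q * H * (M₁ * G)) i j = (M₁ * G) i j := by
        rw [Matrix.mul_apply]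
        simp [h₂.row_eq i h2, Matrix.one_apply]
      rw [hQH, Matrix.sub_apply, this, h₂.row_eq i h2]
      ring
  · intro j hj i
    rw [hGM]
    rcases j with j | j
    · have := h₁.col_eq j hj
      rcases i with i | i <;> simp [this, Matrix.one_apply]
    · have := h₂.col_eq j hj
      rcases i with i | i
      · have h3 : (G * M₂ * (H * Q)) i j = (G * M₂) i j := by
          rw [Matrix.mul_apply]
          simp [this, Matrix.one_apply]
        simp [h3]
      · simp [this, Matrix.one_apply]
  · intro i hi j
    rw [Bool.or_eq_false_iff] at hi
    have hz : ∀ x, H' x i = 0 := fun x => by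
      rw [hH', Matrix.sub_apply, h₂.row_zero i hi.2, Matrix.mul_apply]
      simp [h₁.row_zero i hi.1]
    rcases j with j | j
    · rw [Matrix.fromRows_apply_inl, Matrix.sub_apply, h₁.row_zero i hi.1, Matrix.mul_apply]
      simp [hz]
    · rw [Matrix.fromRows_apply_inr, hz]
  · intro j hj i
    rcases j with j | j
    · have hj : c₁ j = false := hj
      rw [Matrix.fromRows_apply_inl, Matrix.sub_apply, h₁.col_zero j hj, Matrix.mul_assoc,
        Matrix.mul_apply]
      simp [h₁.col_zero j hj]
    · have hj : c₂ j = false := hj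
      rw [Matrix.fromRows_apply_inr, hH', Matrix.sub_apply, h₂.col_zero j hj, Matrix.mul_assoc,
        Matrix.mul_apply]
      simp [h₂.col_zero j hj]

/-- The rows and columns added to M are zero, so the parts of G that are cut off do not contribute
to either product. -/
theorem of_pad {ι' κ₁ : Type} [Fintype ι'] [Fintype κ₁] [DecidableEq ι'] [DecidableEq κ₁]
    {e : ι → ι'} {f : κ → κ₁} (he : e.Injective) (hf : f.Injective) {M : Matrix ι κ ℂ}
    {G : Matrix κ₁ ι' ℂ} {row : ι' → Bool} {col : κ₁ → Bool}
    (h : IsPivotInverse (M.pad e f) G row col) :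
    IsPivotInverse M (G.submatrix f e) (fun i => row (e i)) (fun j => col (f j)) := by
  have h1 : ∀ i x, (M * G.submatrix f e) i x = (M.pad e f * G) (e i) (e x) := fun i x => by
    rw [Matrix.mul_apply, Matrix.mul_apply]
    refine Fintype.sum_of_injective f hf _ _ (fun k hk => ?_) fun k => ?_
    · rw [Matrix.pad_of_notMem_right he _ hk, zero_mul]
    · rw [Matrix.pad_apply he hf, Matrix.submatrix_apply]
  have h2 : ∀ j y, (G.submatrix f e * M) j y = (G * M.pad e f) (f j) (f y) := fun j y => by
    rw [Matrix.mul_apply, Matrix.mul_apply]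
    refine Fintype.sum_of_injective e he _ _ (fun k hk => ?_) fun k => ?_
    · rw [Matrix.pad_of_notMem_left hk, mul_zero]
    · rw [Matrix.pad_apply he hf, Matrix.submatrix_apply]
  refine ⟨?_, fun i hi x => ?_, fun j hj y => ?_, fun i hi j => h.row_zero _ hi _,
    fun j hj i => h.col_zero _ hj _⟩
  · ext i j
    rw [← Matrix.pad_apply he hf M i j, ← h.mul_mul, Matrix.mul_apply, Matrix.mul_apply]
    refine Fintype.sum_of_injective f hf _ _ (fun k hk => ?_) fun k => ?_
    · rw [Matrix.pad_of_notMem_right he _ hk, zero_mul]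
    · rw [Matrix.pad_apply he hf, h2]
  · rw [h1, h.row_eq _ hi]
    simp [Matrix.one_apply, he.eq_iff]
  · rw [h2, h.col_eq _ hj]
    simp [Matrix.one_apply, hf.eq_iff]

end IsPivotInverse

/-! ### Pivot inversion by recursive halving of columns and rows -/

/-- The registers of a pivot inverse, together with the pivot rows and columns. -/
structure PivotRegs (ι κ : Type) where
  reg : κ → ι → ℕ
  row : ι → Bool
  col : κ → Bool

/-- The registers hold a pivot inverse of `M`. -/
def PivotRegs.Valid {ι κ : Type} [Fintype ι] [Fintype κ] [DecidableEq ι] [DecidableEq κ]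
    (o : PivotRegs ι κ) (mem : List ℂ) (M : Matrix ι κ ℂ) : Prop :=
  ∃ G : Matrix κ ι ℂ, RegMat mem o.reg G ∧ IsPivotInverse M G o.row o.col

theorem RegMat.transpose {ι κ : Type} {mem : List ℂ} {h : ι → κ → ℕ} {A : Matrix ι κ ℂ}
    (hA : RegMat mem h A) : RegMat mem (fun j i => h i j) A.transpose := fun j i => hA i j

/-- Transpose, apply a pivot inversion program, and transpose back. -/
def invTranspose {ι κ : Type} (p : (κ → ι → ℕ) → Prog ℂ (PivotRegs κ ι)) (h : ι → κ → ℕ) :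
    Prog ℂ (PivotRegs ι κ) := do
  let o ← p fun j i => h i j
  pure ⟨fun j i => o.reg i j, o.col, o.row⟩

namespace FastMul

variable {ω : ℝ} (F : FastMul ω) {ι κ κ' : Type} [Fintype ι] [Fintype κ] [Fintype κ']

/-- Pivot inversion of a matrix with two column blocks. -/
noncomputable def invCols (p₁ : (ι → κ → ℕ) → Prog ℂ (PivotRegs ι κ))
    (p₂ : (ι → κ' → ℕ) → Prog ℂ (PivotRegs ι κ')) (h : ι → κ ⊕ κ' → ℕ) :
    Prog ℂ (PivotRegs ι (κ ⊕ κ')) := do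
  let o₁ ← p₁ fun i j => h i (.inl j)
  let x ← F.mmul o₁.reg fun i j => h i (.inr j)
  let y ← F.mmul (fun i j => h i (.inl j)) x
  let q ← msub (fun i j => h i (.inr j)) y
  let o₂ ← p₂ q
  let u ← F.mmul o₂.reg fun i j => h i (.inl j)
  let v ← F.mmul u o₁.reg
  let w ← msub o₂.reg v
  let a ← F.mmul x w
  let b ← msub o₁.reg a
  pure ⟨Sum.elim b w, fun i => o₁.row i || o₂.row i, Sum.elim o₁.col o₂.col⟩

variable [DecidableEq ι] [DecidableEq κ] [DecidableEq κ'] {t : Prop} {mem : List ℂ} {s : ℕ}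
  {c c₁ c₂ : ℝ}

theorem _root_.achieves_invTranspose {p : (κ → ι → ℕ) → Prog ℂ (PivotRegs κ ι)}
    (hp : ∀ (h : κ → ι → ℕ) (M : Matrix κ ι ℂ) (mem : List ℂ), RegMat mem h M →
      Achieves t (p h) mem c fun o m => o.Valid m M)
    {h : ι → κ → ℕ} {M : Matrix ι κ ℂ} (hM : RegMat mem h M) :
    Achieves t (invTranspose p h) mem c fun o m => o.Valid m M := by
  refine Achieves.mono_cost (c := c + 0) ?_ (by simp)
  refine (hp _ _ _ hM.transpose).bind fun o m _ ⟨G, hG, hinv⟩ => achieves_pure ?_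
  exact ⟨G.transpose, hG.transpose, hinv.transpose⟩

theorem achieves_invCols {p₁ : (ι → κ → ℕ) → Prog ℂ (PivotRegs ι κ)}
    {p₂ : (ι → κ' → ℕ) → Prog ℂ (PivotRegs ι κ')}
    (hp₁ : ∀ (h : ι → κ → ℕ) (M : Matrix ι κ ℂ) (mem : List ℂ), RegMat mem h M →
      Achieves t (p₁ h) mem c₁ fun o m => o.Valid m M)
    (hp₂ : ∀ (h : ι → κ' → ℕ) (M : Matrix ι κ' ℂ) (mem : List ℂ), RegMat mem h M →
      Achieves t (p₂ h) mem c₂ fun o m => o.Valid m M)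
    (hs : 1 ≤ s) (hι : Fintype.card ι ≤ s) (hκ : Fintype.card κ ≤ s) (hκ' : Fintype.card κ' ≤ s)
    {h : ι → κ ⊕ κ' → ℕ} {M : Matrix ι (κ ⊕ κ') ℂ} (hM : RegMat mem h M) :
    Achieves t (F.invCols p₁ p₂ h) mem (c₁ + c₂ + 8 * F.cost s) fun o m => o.Valid m M := by
  have hM₁ : RegMat mem (fun i j => h i (.inl j)) M.toCols₁ := fun i j => hM i (.inl j)
  have hM₂ : RegMat mem (fun i j => h i (.inr j)) M.toCols₂ := fun i j => hM i (.inr j)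
  refine Achieves.mono_cost (c := c₁ + (F.cost s + (F.cost s + (F.cost s + (c₂ + (F.cost s +
    (F.cost s + (F.cost s + (F.cost s + (F.cost s + 0)))))))))) ?_ (by linarith)
  refine (hp₁ _ _ _ hM₁).bind fun o₁ m₁ hm₁ ⟨G, hG, hinv₁⟩ => ?_
  refine (F.achieves_mmul hG (hM₂.mono hm₁) hs hκ hι hκ').bind fun x m₂ hm₂ hx => ?_
  refine (F.achieves_mmul (hM₁.mono (hm₁.trans hm₂)) hx hs hι hκ hκ').bind fun y m₃ hm₃ hy => ?_
  refine (F.achieves_msub (hM₂.mono ((hm₁.trans hm₂).trans hm₃)) hy hι hκ').bind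
    fun q m₄ hm₄ hq => ?_
  refine (hp₂ _ _ _ hq).bind fun o₂ m₅ hm₅ ⟨H, hH, hinv₂⟩ => ?_
  have h25 := (hm₃.trans hm₄).trans hm₅
  have h15 := hm₂.trans h25
  refine (F.achieves_mmul hH (hM₁.mono (hm₁.trans h15)) hs hκ' hι hκ).bind
    fun u m₆ hm₆ hu => ?_
  refine (F.achieves_mmul hu (hG.mono (h15.trans hm₆)) hs hκ' hκ hι).bind fun v m₇ hm₇ hv => ?_
  refine (F.achieves_msub (hH.mono (hm₆.trans hm₇)) hv hκ' hι).bind fun w m₈ hm₈ hw => ?_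
  have h58 := (hm₆.trans hm₇).trans hm₈
  refine (F.achieves_mmul (hx.mono (h25.trans h58)) hw hs hκ hκ' hι).bind fun a m₉ hm₉ ha => ?_
  refine (F.achieves_msub (hG.mono (h15.trans (h58.trans hm₉))) ha hκ hι).bind
    fun b m hm hb => achieves_pure ?_
  have hw' := hw.mono (hm₉.trans hm)
  refine ⟨Matrix.fromRows (G - G * M.toCols₂ * (H - H * M.toCols₁ * G)) (H - H * M.toCols₁ * G),
    ?_, ?_⟩
  · rintro (j | j) i
    · exact hb j i
    · exact hw' j i
  · have := hinv₁.fromCols hinv₂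
    rwa [Matrix.fromCols_toCols] at this

end FastMul

/-- A type with `2 ^ k` elements. -/
def BinIdx : ℕ → Type
  | 0 => Unit
  | k + 1 => BinIdx k ⊕ BinIdx k

instance BinIdx.instFintype : (k : ℕ) → Fintype (BinIdx k)
  | 0 => inferInstanceAs (Fintype Unit)
  | k + 1 => by
    have := BinIdx.instFintype k
    exact inferInstanceAs (Fintype (BinIdx k ⊕ BinIdx k))

instance BinIdx.instDecidableEq : (k : ℕ) → DecidableEq (BinIdx k)
  | 0 => inferInstanceAs (DecidableEq Unit)
  | k + 1 => by
    have := BinIdx.instDecidableEq k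
    exact inferInstanceAs (DecidableEq (BinIdx k ⊕ BinIdx k))

theorem BinIdx.card (k : ℕ) : Fintype.card (BinIdx k) = 2 ^ k := by
  induction k with
  | zero => rfl
  | succ k ih =>
    have : Fintype.card (BinIdx (k + 1)) = Fintype.card (BinIdx k ⊕ BinIdx k) := rfl
    rw [this, Fintype.card_sum, ih, pow_succ]
    ring

namespace FastMul

variable {ω : ℝ} (F : FastMul ω)

/-- Pivot inversion of a `2 ^ k × 2 ^ k` matrix. -/
noncomputable def invBin : (k : ℕ) → (BinIdx k → BinIdx k → ℕ) →
    Prog ℂ (PivotRegs (BinIdx k) (BinIdx k))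
  | 0, h => do
      let b ← test (h () ()) ret
      let o ← lit 1
      let y ← arith .div o (h () ()) ret
      pure ⟨fun _ _ => y, fun _ => !b, fun _ => !b⟩
  | k + 1, h =>
      F.invCols (ι := BinIdx k ⊕ BinIdx k)
        (invTranspose (F.invCols (invTranspose (invBin k)) (invTranspose (invBin k))))
        (invTranspose (F.invCols (invTranspose (invBin k)) (invTranspose (invBin k)))) h

/-- The pivot inverse of a zero entry is 0, which the convention 1 / 0 = 0 supplies. The program
therefore divides in either case and uses the test only for the pivot flags. -/
theorem isPivotInverse_unit {M : Matrix (BinIdx 0) (BinIdx 0) ℂ} {b : Bool}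
    (hb : b = true ↔ M () () = 0) :
    IsPivotInverse M (Matrix.of fun _ _ => 1 / M () ()) (fun _ => !b) (fun _ => !b) := by
  have hu : ∀ f : BinIdx 0 → ℂ, ∑ i, f i = f () := fun f => Fintype.sum_unique (ι := Unit) f
  have hM : ∀ i j, M i j = M () () := fun i j => rfl
  have h1 : ∀ i j, (1 : Matrix (BinIdx 0) (BinIdx 0) ℂ) i j = 1 := fun i j =>
    Matrix.one_apply_eq (n := BinIdx 0) ()
  cases b
  · have h0 : M () () ≠ 0 := fun h => by simpa using hb.2 h
    refine ⟨?_, fun i _ j => ?_, fun i _ j => ?_, fun i hi => by simp at hi,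
      fun i hi => by simp at hi⟩
    · ext i j
      simp [Matrix.mul_apply, hu, hM i j, hM i (), hM () j, h0]
    · simp [Matrix.mul_apply, hu, hM i (), h0, h1]
    · simp [Matrix.mul_apply, hu, hM () i, h0, h1]
  · have h0 : M () () = 0 := hb.1 rfl
    refine ⟨?_, fun i hi => by simp at hi, fun i hi => by simp at hi, fun i _ j => ?_,
      fun i _ j => ?_⟩
    · ext i j
      simp [Matrix.mul_apply, hu, hM i j, h0]
    · simp [h0]
    · simp [h0]

variable {t : Prop}

/-- Halving the columns and, after transposition, the rows leads to four calls of half size and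
three block eliminations with 8 matrix operations each. By `four_mul_cost_le` the four calls
together cost no more than the bound for one factor k + 1, and the elimination adds 24 at each
level. -/
theorem achieves_invBin (k : ℕ) {h : BinIdx k → BinIdx k → ℕ}
    {M : Matrix (BinIdx k) (BinIdx k) ℂ} {mem : List ℂ} (hM : RegMat mem h M) :
    Achieves t (F.invBin k h) mem (24 * (k + 1) * F.cost (2 ^ k)) fun o m => o.Valid m M := by
  induction k generalizing mem with
  | zero =>
    refine Achieves.mono_cost (c := 1 + (1 + (1 + 0))) ?_ ?_
    · refine (achieves_test (hM () ())).bind fun b m₁ hm₁ hb => ?_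
      refine (achieves_lit 1).bind fun o m₂ hm₂ ho => ?_
      refine (achieves_arith .div ho ((hM () ()).mono (hm₁.trans hm₂))).bind fun y m hm hy => ?_
      exact achieves_pure ⟨_, fun _ _ => hy, isPivotInverse_unit hb⟩
    · have := F.one_le_cost (s := 2 ^ 0) (by norm_num)
      norm_num at this ⊢
      linarith
  | succ k ih =>
    have hs : 1 ≤ 2 ^ (k + 1) := Nat.one_le_two_pow
    have h1 : Fintype.card (BinIdx k) ≤ 2 ^ (k + 1) := by
      rw [BinIdx.card, pow_succ]; omega
    have h2 : Fintype.card (BinIdx k ⊕ BinIdx k) ≤ 2 ^ (k + 1) := by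
      rw [Fintype.card_sum, BinIdx.card, pow_succ]; omega
    set T := 24 * ((k : ℝ) + 1) * F.cost (2 ^ k) with hT
    have hcol : ∀ (h : BinIdx k → BinIdx k ⊕ BinIdx k → ℕ)
        (M : Matrix (BinIdx k) (BinIdx k ⊕ BinIdx k) ℂ) (mem : List ℂ), RegMat mem h M →
        Achieves t (F.invCols (invTranspose (F.invBin k)) (invTranspose (F.invBin k)) h) mem
          (T + T + 8 * F.cost (2 ^ (k + 1))) fun o m => o.Valid m M := fun h M mem hM =>
      F.achieves_invCols (fun _ _ _ h => achieves_invTranspose (fun _ _ _ h => ih h) h)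
        (fun _ _ _ h => achieves_invTranspose (fun _ _ _ h => ih h) h) hs h1 h1 h1 hM
    refine Achieves.mono_cost (F.achieves_invCols (ι := BinIdx k ⊕ BinIdx k)
      (fun _ _ _ h => achieves_invTranspose hcol h) (fun _ _ _ h => achieves_invTranspose hcol h)
      hs h2 h1 h1 hM) ?_
    have h4 := F.four_mul_cost_le (2 ^ k)
    rw [← pow_succ'] at h4
    have hk : (0 : ℝ) ≤ (k : ℝ) + 1 := by positivity
    have h5 := mul_le_mul_of_nonneg_left h4 hk
    push_cast
    rw [hT]
    linarith

variable {ι κ : Type} [Fintype ι] [Fintype κ]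

/-- An embedding into `BinIdx k`, if there is one. -/
noncomputable def toBin (ι : Type) [Fintype ι] {k : ℕ} (h : Fintype.card ι ≤ 2 ^ k) :
    ι ↪ BinIdx k :=
  (Function.Embedding.nonempty_of_card_le (h.trans_eq (BinIdx.card k).symm)).some

theorem card_le_two_pow_left :
    Fintype.card ι ≤ 2 ^ Nat.clog 2 (max (Fintype.card ι) (Fintype.card κ)) :=
  (le_max_left _ _).trans (Nat.le_pow_clog (by norm_num) _)

theorem card_le_two_pow_right :
    Fintype.card κ ≤ 2 ^ Nat.clog 2 (max (Fintype.card ι) (Fintype.card κ)) :=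
  (le_max_right _ _).trans (Nat.le_pow_clog (by norm_num) _)

/-- Pivot inversion of a rectangular matrix. -/
noncomputable def inv (h : ι → κ → ℕ) : Prog ℂ (PivotRegs ι κ) := do
  let z ← lit 0
  let o ← F.invBin (Nat.clog 2 (max (Fintype.card ι) (Fintype.card κ)))
    (padMat (toBin ι (card_le_two_pow_left (κ := κ))) (toBin κ (card_le_two_pow_right (ι := ι))) z h)
  pure ⟨fun j i => o.reg (toBin κ (card_le_two_pow_right (ι := ι)) j)
      (toBin ι (card_le_two_pow_left (κ := κ)) i),
    fun i => o.row (toBin ι (card_le_two_pow_left (κ := κ)) i),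
    fun j => o.col (toBin κ (card_le_two_pow_right (ι := ι)) j)⟩

theorem two_pow_clog_le {s : ℕ} (hs : 1 ≤ s) : 2 ^ Nat.clog 2 s ≤ 2 * s := by
  rcases Nat.lt_or_ge 1 s with h | h
  · have h1 := Nat.pow_pred_clog_lt_self (b := 2) (by norm_num) h
    have h2 : 0 < Nat.clog 2 s := Nat.clog_pos (by norm_num) h
    obtain ⟨k, hk⟩ : ∃ k, Nat.clog 2 s = k + 1 := ⟨_, (Nat.succ_pred_eq_of_pos h2).symm⟩
    rw [hk, pow_succ]
    rw [hk, Nat.pred_succ] at h1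
    omega
  · obtain rfl : s = 1 := by omega
    simp

theorem achieves_inv [DecidableEq ι] [DecidableEq κ] {h : ι → κ → ℕ} {M : Matrix ι κ ℂ}
    {mem : List ℂ} (hM : RegMat mem h M) {s : ℕ} (hs : 1 ≤ s) (hι : Fintype.card ι ≤ s)
    (hκ : Fintype.card κ ≤ s) :
    Achieves t (F.inv h) mem (25 * (Nat.clog 2 s + 1) * F.cost (2 * s)) fun o m => o.Valid m M := by
  set k := Nat.clog 2 (max (Fintype.card ι) (Fintype.card κ)) with hk
  have hks : k ≤ Nat.clog 2 s := Nat.clog_mono_right 2 (max_le hι hκ)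
  have h2k : 2 ^ k ≤ 2 * s :=
    (Nat.pow_le_pow_right (by norm_num) hks).trans (two_pow_clog_le hs)
  -- The constant 25 is 24 for the recursion plus 1 for the padding zero. The argument 2s accounts
  -- for rounding up to a power of two.
  refine Achieves.mono_cost (c := 1 + (24 * (k + 1) * F.cost (2 ^ k) + 0)) ?_ ?_
  · refine (achieves_lit 0).bind fun z m₁ hm₁ hz => ?_
    refine (F.achieves_invBin k ((hM.mono hm₁).pad (toBin ι card_le_two_pow_left).injective
      (toBin κ card_le_two_pow_right).injective hz)).bind fun o m hm ⟨G, hG, hinv⟩ =>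
      achieves_pure ?_
    exact ⟨_, fun j i => hG _ _, hinv.of_pad (toBin ι card_le_two_pow_left).injective
      (toBin κ card_le_two_pow_right).injective⟩
  · have h1 := F.cost_mono h2k
    have h2 := F.one_le_cost (s := 2 * s) (by omega)
    have h3 : (k : ℝ) ≤ Nat.clog 2 s := by exact_mod_cast hks
    have h4 : 24 * ((k : ℝ) + 1) * F.cost (2 ^ k) ≤
        24 * ((Nat.clog 2 s : ℝ) + 1) * F.cost (2 * s) := by
      have := F.cost_nonneg (2 ^ k)
      gcongr
    have h5 : (0 : ℝ) ≤ (Nat.clog 2 s : ℝ) := by positivity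
    nlinarith

end FastMul

/-! ### Krylov spaces and splitting of the characteristic polynomial -/

section Krylov

open Matrix

variable {ι κ κ' : Type} [Fintype ι] [Fintype κ] [Fintype κ'] [DecidableEq ι]

/-- The columns of `B` generate the whole space as a module over `ℂ[A]`. -/
def Generates (A : Matrix ι ι ℂ) (B : Matrix ι κ ℂ) : Prop :=
  ∀ N : Submodule ℂ (ι → ℂ), (∀ x ∈ N, A *ᵥ x ∈ N) → (∀ y, B *ᵥ y ∈ N) → N = ⊤

/-- The range of `M` is the smallest `A`-invariant subspace that contains the columns of `B`. -/
structure IsKrylov (A : Matrix ι ι ℂ) (B : Matrix ι κ ℂ) (M : Matrix ι κ' ℂ) : Prop where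
  map_mem : ∀ x, ∃ y, A *ᵥ (M *ᵥ x) = M *ᵥ y
  contains : ∀ x, ∃ y, B *ᵥ x = M *ᵥ y
  minimal : ∀ N : Submodule ℂ (ι → ℂ), (∀ x ∈ N, A *ᵥ x ∈ N) → (∀ y, B *ᵥ y ∈ N) →
    ∀ y, M *ᵥ y ∈ N

/-- The span of the vectors `A ^ j b` for `j < k` and `b` in the range of `B`. -/
def krylovSpan (A : Matrix ι ι ℂ) (B : Matrix ι κ ℂ) (k : ℕ) : Submodule ℂ (ι → ℂ) :=
  Submodule.span ℂ {x | ∃ j < k, ∃ y, x = (A ^ j * B) *ᵥ y}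

theorem mem_krylovSpan (A : Matrix ι ι ℂ) (B : Matrix ι κ ℂ) {j k : ℕ} (hj : j < k)
    (y : κ → ℂ) : (A ^ j * B) *ᵥ y ∈ krylovSpan A B k :=
  Submodule.subset_span ⟨j, hj, y, rfl⟩

theorem mem_krylovSpan_one (A : Matrix ι ι ℂ) (B : Matrix ι κ ℂ) (x : ι → ℂ) :
    x ∈ krylovSpan A B 1 ↔ ∃ y, x = B *ᵥ y := by
  constructor
  · intro hx
    have hle : krylovSpan A B 1 ≤ LinearMap.range B.mulVecLin := by
      refine Submodule.span_le.2 ?_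
      rintro _ ⟨j, hj, y, rfl⟩
      obtain rfl : j = 0 := by omega
      exact ⟨y, by simp⟩
    obtain ⟨y, hy⟩ := hle hx
    exact ⟨y, hy.symm⟩
  · rintro ⟨y, rfl⟩
    have := mem_krylovSpan A B (j := 0) (k := 1) (by norm_num) y
    rwa [pow_zero, Matrix.one_mul] at this

/-- By Cayley–Hamilton, a power of A is a combination of powers below the dimension, so the Krylov
spans are stationary from there on. -/
theorem pow_mul_mulVec_mem_krylovSpan (A : Matrix ι ι ℂ) (B : Matrix ι κ ℂ) {k : ℕ}
    (hk : Fintype.card ι ≤ k) (j : ℕ) (y : κ → ℂ) : (A ^ j * B) *ᵥ y ∈ krylovSpan A B k := by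
  -- The characteristic polynomial is 1 when the index type is empty; a remainder of smaller degree
  -- does not exist then.
  have hdeg : (X ^ j %ₘ A.charpoly).natDegree < Fintype.card ι ∨ A.charpoly = 1 := by
    rcases eq_or_ne A.charpoly 1 with h | h
    · exact Or.inr h
    · left
      have := natDegree_modByMonic_lt (X ^ j : ℂ[X]) A.charpoly_monic h
      rwa [A.charpoly_natDegree_eq_dim] at this
  rw [A.pow_eq_aeval_mod_charpoly]
  rcases hdeg with hdeg | h1
  · rw [aeval_eq_sum_range' hdeg, Matrix.sum_mul, sum_mulVec]
    refine Submodule.sum_mem _ fun i hi => ?_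
    rw [Matrix.smul_mul, smul_mulVec]
    exact Submodule.smul_mem _ _ (mem_krylovSpan A B ((Finset.mem_range.1 hi).trans_le hk) y)
  · rw [h1, modByMonic_one]
    simp

theorem mulVec_mem_krylovSpan_add (A : Matrix ι ι ℂ) (B : Matrix ι κ ℂ) (k l : ℕ) {x : ι → ℂ}
    (hx : x ∈ krylovSpan A B k) : (A ^ l) *ᵥ x ∈ krylovSpan A B (l + k) := by
  have : krylovSpan A B k ≤ (krylovSpan A B (l + k)).comap (A ^ l).mulVecLin := by
    refine Submodule.span_le.2 ?_
    rintro _ ⟨j, hj, y, rfl⟩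
    simp only [SetLike.mem_coe, Submodule.mem_comap, mulVecLin_apply, mulVec_mulVec]
    rw [← Matrix.mul_assoc, ← pow_add]
    exact mem_krylovSpan A B (by omega) y
  exact this hx

theorem krylovSpan_mono (A : Matrix ι ι ℂ) (B : Matrix ι κ ℂ) {k l : ℕ} (h : k ≤ l) :
    krylovSpan A B k ≤ krylovSpan A B l :=
  Submodule.span_mono fun _ ⟨j, hj, y, hy⟩ => ⟨j, hj.trans_le h, y, hy⟩

theorem mulVec_mem_krylovSpan (A : Matrix ι ι ℂ) (B : Matrix ι κ ℂ) {k : ℕ}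
    (hk : Fintype.card ι ≤ k) {x : ι → ℂ} (hx : x ∈ krylovSpan A B k) :
    A *ᵥ x ∈ krylovSpan A B k := by
  have h1 : krylovSpan A B (1 + k) ≤ krylovSpan A B k := by
    refine Submodule.span_le.2 ?_
    rintro _ ⟨j, _, y, rfl⟩
    exact pow_mul_mulVec_mem_krylovSpan A B hk j y
  have := mulVec_mem_krylovSpan_add A B k 1 hx
  rw [pow_one] at this
  exact h1 this

theorem krylovSpan_le (A : Matrix ι ι ℂ) (B : Matrix ι κ ℂ) (k : ℕ) {N : Submodule ℂ (ι → ℂ)}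
    (hA : ∀ x ∈ N, A *ᵥ x ∈ N) (hB : ∀ y, B *ᵥ y ∈ N) : krylovSpan A B k ≤ N := by
  refine Submodule.span_le.2 ?_
  rintro _ ⟨j, -, y, rfl⟩
  change _ ∈ N
  induction j with
  | zero => simpa using hB y
  | succ j ih =>
    rw [pow_succ', Matrix.mul_assoc, ← mulVec_mulVec]
    exact hA _ ih

theorem isKrylov_of_mem_krylovSpan {A : Matrix ι ι ℂ} {B : Matrix ι κ ℂ} {M : Matrix ι κ' ℂ}
    {k : ℕ} (hk : Fintype.card ι ≤ k) (h : ∀ x, x ∈ krylovSpan A B k ↔ ∃ y, x = M *ᵥ y) :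
    IsKrylov A B M where
  map_mem x := (h _).1 (mulVec_mem_krylovSpan A B hk ((h _).2 ⟨x, rfl⟩))
  contains x := (h _).1 (by simpa using pow_mul_mulVec_mem_krylovSpan A B hk 0 x)
  minimal N hA hB y := krylovSpan_le A B k hA hB ((h _).2 ⟨y, rfl⟩)

/-- The exponents below 2k are those below k and their translates by k. So log n doublings suffice
instead of n applications of A. -/
theorem mem_krylovSpan_two_mul {A : Matrix ι ι ℂ} {B : Matrix ι κ ℂ} {P : Matrix ι κ' ℂ}
    {k : ℕ} (h : ∀ x, x ∈ krylovSpan A B k ↔ ∃ y, x = P *ᵥ y) (x : ι → ℂ) :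
    x ∈ krylovSpan A B (2 * k) ↔ ∃ y, x = fromCols P (A ^ k * P) *ᵥ y := by
  constructor
  · have : krylovSpan A B (2 * k) ≤ LinearMap.range (fromCols P (A ^ k * P)).mulVecLin := by
      refine Submodule.span_le.2 ?_
      rintro _ ⟨j, hj, y, rfl⟩
      change _ ∈ LinearMap.range (fromCols P (A ^ k * P)).mulVecLin
      rw [LinearMap.mem_range]
      rcases Nat.lt_or_ge j k with hjk | hjk
      · obtain ⟨z, hz⟩ := (h _).1 (mem_krylovSpan A B hjk y)
        refine ⟨Sum.elim z 0, ?_⟩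
        rw [mulVecLin_apply, fromCols_mulVec_sumElim, hz, mulVec_zero, add_zero]
      · obtain ⟨z, hz⟩ := (h _).1 (mem_krylovSpan A B (j := j - k) (k := k) (by omega) y)
        refine ⟨Sum.elim 0 z, ?_⟩
        rw [mulVecLin_apply, fromCols_mulVec_sumElim, mulVec_zero, zero_add, ← mulVec_mulVec,
          ← hz, mulVec_mulVec, ← Matrix.mul_assoc, ← pow_add, Nat.add_sub_cancel' hjk]
    intro hx
    obtain ⟨y, hy⟩ := LinearMap.mem_range.1 (this hx)
    exact ⟨y, hy.symm⟩
  · rintro ⟨y, rfl⟩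
    rw [← Sum.elim_comp_inl_inr y, fromCols_mulVec_sumElim]
    refine Submodule.add_mem _ ?_ ?_
    · exact krylovSpan_mono A B (by omega) ((h _).2 ⟨_, rfl⟩)
    · rw [← mulVec_mulVec]
      have := mulVec_mem_krylovSpan_add A B k k ((h _).2 ⟨y ∘ Sum.inr, rfl⟩)
      rwa [← two_mul] at this

/-- M and M G have the same range, but M G is square. This keeps the number of columns fixed while
the Krylov span is doubled. -/
theorem IsPivotInverse.exists_mulVec_iff [DecidableEq κ] {M : Matrix ι κ ℂ} {G : Matrix κ ι ℂ} {row : ι → Bool}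
    {col : κ → Bool} (h : IsPivotInverse M G row col) (x : ι → ℂ) :
    (∃ y, x = M *ᵥ y) ↔ ∃ y, x = (M * G) *ᵥ y := by
  constructor
  · rintro ⟨y, rfl⟩
    refine ⟨M *ᵥ y, ?_⟩
    rw [mulVec_mulVec, Matrix.mul_assoc, h.mul_mul]
  · rintro ⟨y, rfl⟩
    exact ⟨G *ᵥ y, by rw [mulVec_mulVec]⟩

/-- The charpoly coefficients of a matrix with a cyclic vector. -/
theorem charpoly_coeff_of_cyclic {A : Matrix ι ι ℂ} {b : Matrix ι Unit ℂ} (h : Generates A b)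
    {K : Matrix ι (Fin (Fintype.card ι)) ℂ} (hK : ∀ i j, K i j = (A ^ j.val * b) i ())
    {G : Matrix (Fin (Fintype.card ι)) ι ℂ} (hG : K * (G * K) = K)
    (j : Fin (Fintype.card ι)) :
    A.charpoly.coeff j = 0 - (G * (A ^ Fintype.card ι * b)) j () := by
  -- The Krylov matrix of a cyclic vector is invertible, so its generalized inverse G is its
  -- inverse.
  have hsurj : Function.Surjective K.mulVec := by
    have htop : krylovSpan A b (Fintype.card ι) = ⊤ := h _
      (fun x hx => mulVec_mem_krylovSpan A b le_rfl hx)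
      (fun y => by simpa using pow_mul_mulVec_mem_krylovSpan A b le_rfl 0 y)
    have hle : krylovSpan A b (Fintype.card ι) ≤ LinearMap.range K.mulVecLin := by
      refine Submodule.span_le.2 ?_
      rintro _ ⟨j, hj, y, rfl⟩
      refine ⟨Pi.single ⟨j, hj⟩ (y ()), ?_⟩
      ext i
      rw [mulVecLin_apply, mulVec_single, Pi.smul_apply, col_apply, hK]
      simp [mulVec, dotProduct, mul_comm]
    intro x
    obtain ⟨y, hy⟩ := LinearMap.mem_range.1 (hle (htop ▸ Submodule.mem_top : x ∈ _))
    exact ⟨y, hy⟩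
  obtain ⟨K', hK'⟩ := mulVec_surjective_iff_exists_right_inverse.1 hsurj
  have hK'K : K' * K = 1 := (mul_eq_one_comm_of_card_eq _ _ _ (by simp)).1 hK'
  have hGK : G * K = 1 := by
    have h1 := congrArg (K' * ·) hG
    simp only [← Matrix.mul_assoc, hK'K, Matrix.one_mul] at h1
    exact h1
  -- Cayley–Hamilton applied to b is a linear system for the lower coefficients; the leading
  -- coefficient 1 leaves -A^n b on the right.
  have hCH : K * Matrix.of (fun (i : Fin (Fintype.card ι)) (_ : Unit) => A.charpoly.coeff i) =
      -(A ^ Fintype.card ι * b) := by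
    have h0 := A.aeval_self_charpoly
    rw [aeval_eq_sum_range, A.charpoly_natDegree_eq_dim, Finset.sum_range_succ] at h0
    have hlc : A.charpoly.coeff (Fintype.card ι) = 1 := by
      rw [← A.charpoly_natDegree_eq_dim]
      exact A.charpoly_monic.coeff_natDegree
    rw [hlc, one_smul] at h0
    have h1 := congrArg (· * b) h0
    simp only [Matrix.add_mul, Matrix.zero_mul, Matrix.sum_mul] at h1
    rw [neg_eq_of_add_eq_zero_left h1, Finset.sum_range]
    ext i u
    rw [Matrix.mul_apply, Matrix.sum_apply]
    refine Finset.sum_congr rfl fun j _ => ?_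
    rw [hK, Matrix.of_apply, Matrix.smul_mul, Matrix.smul_apply, smul_eq_mul, mul_comm]
  have h2 : G * (A ^ Fintype.card ι * b) =
      -Matrix.of (fun (i : Fin (Fintype.card ι)) (_ : Unit) => A.charpoly.coeff i) := by
    rw [← Matrix.one_mul (Matrix.of _), ← hGK, Matrix.mul_assoc, hCH, Matrix.mul_neg, neg_neg]
  rw [h2]
  simp

/-! ### Splitting the space along an invariant subspace -/

section split

variable {A : Matrix ι ι ℂ} {M : Matrix ι κ ℂ} {G : Matrix κ ι ℂ} {row : ι → Bool}
  {col : κ → Bool}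

/-- The pivot columns together with the non-pivot unit vectors form a basis. -/
structure IsSplitting (A : Matrix ι ι ℂ) {γ δ : Type} [Fintype γ] [Fintype δ] [DecidableEq γ]
    [DecidableEq δ] (U : Matrix ι γ ℂ) (U' : Matrix γ ι ℂ) (E : Matrix ι δ ℂ) (T : Matrix δ ι ℂ) :
    Prop where
  inv_mul : U' * U = 1
  inv_mul_compl : U' * E = 0
  proj_mul : T * U = 0
  proj_mul_compl : T * E = 1
  sum_eq : U * U' + E * T = 1
  proj_map : T * (A * U) = 0

namespace IsSplitting

variable {γ δ : Type} [Fintype γ] [Fintype δ] [DecidableEq γ] [DecidableEq δ] {U : Matrix ι γ ℂ}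
  {U' : Matrix γ ι ℂ} {E : Matrix ι δ ℂ} {T : Matrix δ ι ℂ}

theorem mul_eq_one (h : IsSplitting A U U' E T) : fromCols U E * fromRows U' T = 1 := by
  rw [fromCols_mul_fromRows, h.sum_eq]

theorem mul_eq_one' (h : IsSplitting A U U' E T) : fromRows U' T * fromCols U E = 1 := by
  rw [fromRows_mul_fromCols, h.inv_mul, h.inv_mul_compl, h.proj_mul, h.proj_mul_compl,
    fromBlocks_one]

theorem card_add_card (h : IsSplitting A U U' E T) :
    Fintype.card γ + Fintype.card δ = Fintype.card ι := by
  rw [← Fintype.card_sum]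
  exact (square_of_invertible _ _ h.mul_eq_one h.mul_eq_one').symm

/-- In the basis (U, E) the matrix A is block triangular because T A U = 0. The diagonal blocks
describe A on the subspace and on the quotient. -/
theorem charpoly_eq (h : IsSplitting A U U' E T) :
    A.charpoly = (U' * (A * U)).charpoly * (T * (A * E)).charpoly := by
  have h1 : A = A * fromCols U E * fromRows U' T := by
    rw [Matrix.mul_assoc, h.mul_eq_one, Matrix.mul_one]
  have h2 := charpoly_mul_comm_of_le (A * fromCols U E) (fromRows U' T)
    (by rw [Fintype.card_sum, h.card_add_card])
  rw [← h1, Fintype.card_sum, h.card_add_card, Nat.sub_self, pow_zero, one_mul, mul_fromCols,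
    fromRows_mul_fromCols, h.proj_map, charpoly_fromBlocks_zero₂₁] at h2
  exact h2

theorem map_eq (h : IsSplitting A U U' E T) : U * (U' * (A * U)) = A * U := by
  have h1 := congrArg (· * (A * U)) h.sum_eq
  simp only [Matrix.add_mul, Matrix.one_mul, Matrix.mul_assoc, h.proj_map, Matrix.mul_zero,
    add_zero] at h1
  exact h1

theorem proj_map_eq (h : IsSplitting A U U' E T) : T * (A * E) * T = T * A := by
  have h1 := congrArg (fun Y => T * (A * Y)) h.sum_eq
  simp only [Matrix.mul_add, Matrix.mul_one] at h1
  rw [← Matrix.mul_assoc A, ← Matrix.mul_assoc T, h.proj_map, Matrix.zero_mul, zero_add] at h1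
  rw [← h1]
  simp only [Matrix.mul_assoc]

/-- An invariant subspace in the coordinates of U is carried by U to an A-invariant subspace that
contains the range of B, and minimality applies to it. -/
theorem generates_left {ε : Type} [Fintype ε] (h : IsSplitting A U U' E T) {B : Matrix ι ε ℂ}
    (hB : T * B = 0) (hmin : ∀ N : Submodule ℂ (ι → ℂ), (∀ x ∈ N, A *ᵥ x ∈ N) →
      (∀ y, B *ᵥ y ∈ N) → ∀ y, U *ᵥ y ∈ N) : Generates (U' * (A * U)) (U' * B) := by
  intro N hN hBN
  have hUB : U * (U' * B) = B := by
    have h1 := congrArg (· * B) h.sum_eq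
    simpa only [Matrix.add_mul, Matrix.one_mul, Matrix.mul_assoc, hB, Matrix.mul_zero,
      add_zero] using h1
  have h1 := hmin (N.map U.mulVecLin) ?_ ?_
  · refine Submodule.eq_top_iff'.2 fun x => ?_
    obtain ⟨y, hy, hxy⟩ := Submodule.mem_map.1 (h1 x)
    have h2 := congrArg (U' *ᵥ ·) hxy
    simp only [mulVecLin_apply, mulVec_mulVec, h.inv_mul, one_mulVec] at h2
    exact h2 ▸ hy
  · intro x hx
    obtain ⟨y, hy, rfl⟩ := Submodule.mem_map.1 hx
    refine Submodule.mem_map.2 ⟨_, hN y hy, ?_⟩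
    simp only [mulVecLin_apply, mulVec_mulVec, h.map_eq]
  · intro y
    refine Submodule.mem_map.2 ⟨_, hBN y, ?_⟩
    simp only [mulVecLin_apply, mulVec_mulVec, hUB]

/-- The first half of the generators dies in the quotient, so the second half has to generate it.
The proof pulls an invariant subspace back along T. -/
theorem generates_right {ε ε' : Type} [Fintype ε] [Fintype ε'] (h : IsSplitting A U U' E T)
    {B : Matrix ι (ε ⊕ ε') ℂ} (hB : T * B.toCols₁ = 0) (hgen : Generates A B) :
    Generates (T * (A * E)) (T * B.toCols₂) := by
  intro N hN hBN
  have h1 := hgen (N.comap T.mulVecLin) ?_ ?_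
  · refine Submodule.eq_top_iff'.2 fun x => ?_
    have h2 : E *ᵥ x ∈ N.comap T.mulVecLin := h1 ▸ Submodule.mem_top
    rw [Submodule.mem_comap, mulVecLin_apply, mulVec_mulVec, h.proj_mul_compl, one_mulVec] at h2
    exact h2
  · intro x hx
    have h2 := hN _ hx
    rw [mulVecLin_apply, mulVec_mulVec, h.proj_map_eq, ← mulVec_mulVec] at h2
    exact h2
  · intro y
    rw [Submodule.mem_comap, mulVecLin_apply, ← fromCols_toCols B, ← Sum.elim_comp_inl_inr y,
      fromCols_mulVec_sumElim, mulVec_add, mulVec_mulVec, hB, zero_mulVec, zero_add,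
      mulVec_mulVec]
    exact hBN _

end IsSplitting

/-- The pivot columns of M are a basis of its range, and the unit vectors at the non-pivot rows
complete it. G has zero columns at the non-pivot rows, so U' E = 0; 1 - M G has zero rows at the
pivot rows, which gives the sum formula. Invariance of the range gives T A U = 0. -/
theorem IsPivotInverse.isSplitting [DecidableEq κ] (h : IsPivotInverse M G row col)
    (hA : ∀ x, ∃ y, A *ᵥ (M *ᵥ x) = M *ᵥ y) :
    IsSplitting A (M.submatrix id (Subtype.val : {j // col j = true} → κ))
      (G.submatrix (Subtype.val : {j // col j = true} → κ) id)
      ((1 : Matrix ι ι ℂ).submatrix id (Subtype.val : {i // row i = false} → ι))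
      ((1 - M * G).submatrix (Subtype.val : {i // row i = false} → ι) id) := by
  have hTM : (1 - M * G) * M = 0 := by
    rw [Matrix.sub_mul, Matrix.one_mul, Matrix.mul_assoc, h.mul_mul, sub_self]
  have hTAM : (1 - M * G) * (A * M) = 0 := by
    refine ext_of_mulVec_single fun j => ?_
    obtain ⟨y, hy⟩ := hA (Pi.single j 1)
    rw [← mulVec_mulVec, ← mulVec_mulVec, hy, mulVec_mulVec, hTM, zero_mulVec, zero_mulVec]
  refine ⟨?_, ?_, ?_, ?_, ?_, ?_⟩
  · ext i j
    have := h.col_eq j j.2 i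
    rw [Matrix.one_apply, Matrix.mul_apply] at this
    rw [Matrix.mul_apply, Matrix.one_apply]
    simp only [submatrix_apply, id, this, Subtype.ext_iff]
  · ext i j
    rw [Matrix.mul_apply]
    simp [Matrix.one_apply, h.row_zero j j.2]
  · ext i j
    have := congrFun (congrFun hTM i) j
    rw [Matrix.mul_apply] at this
    rw [Matrix.mul_apply]
    simpa only [submatrix_apply, id, Matrix.zero_apply] using this
  · ext i j
    have h0 : (M * G) i j = 0 := by
      rw [Matrix.mul_apply]
      simp [h.row_zero j j.2]
    rw [Matrix.mul_apply]
    simp [Matrix.one_apply, h0, Subtype.ext_iff]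
  · ext i j
    rw [Matrix.add_apply, Matrix.mul_apply, Matrix.mul_apply]
    have h1 : ∑ x : {j // col j = true}, (M.submatrix id Subtype.val) i x *
        (G.submatrix Subtype.val id) x j = (M * G) i j := by
      rw [Matrix.mul_apply]
      refine Fintype.sum_of_injective Subtype.val Subtype.val_injective _ _ (fun k hk => ?_)
        fun k => rfl
      rw [h.col_zero k (by simpa using hk), mul_zero]
    have h2 : ∑ x : {i // row i = false}, ((1 : Matrix ι ι ℂ).submatrix id Subtype.val) i x *
        ((1 - M * G).submatrix Subtype.val id) x j = (1 - M * G : Matrix ι ι ℂ) i j := by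
      rw [← Matrix.one_mul (1 - M * G), Matrix.mul_apply]
      refine Fintype.sum_of_injective Subtype.val Subtype.val_injective _ _ (fun k hk => ?_)
        fun k => by rw [Matrix.submatrix_apply, Matrix.one_mul, Matrix.submatrix_apply]; rfl
      rw [Matrix.sub_apply, h.row_eq k (by simpa using hk), sub_self, mul_zero]
    rw [h1, h2, Matrix.sub_apply, add_sub_cancel]
  · ext i j
    have := congrFun (congrFun hTAM i) j
    rw [Matrix.mul_apply] at this
    rw [Matrix.mul_apply]
    simpa only [submatrix_apply, id, Matrix.mul_apply, Matrix.zero_apply] using this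

theorem IsPivotInverse.proj_mul_eq_zero [DecidableEq κ] {ε δ : Type} [Fintype ε] [DecidableEq ε]
    {B : Matrix ι ε ℂ} (h : IsPivotInverse M G row col) (hB : ∀ x, ∃ y, B *ᵥ x = M *ᵥ y)
    (f : δ → ι) : (1 - M * G).submatrix f id * B = (0 : Matrix δ ε ℂ) := by
  have h0 : (1 - M * G) * M = 0 := by
    rw [Matrix.sub_mul, Matrix.one_mul, Matrix.mul_assoc, h.mul_mul, sub_self]
  have h1 : (1 - M * G) * B = 0 := by
    refine ext_of_mulVec_single fun j => ?_
    obtain ⟨y, hy⟩ := hB (Pi.single j 1)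
    rw [← mulVec_mulVec, hy, mulVec_mulVec, h0, zero_mulVec, zero_mulVec]
  ext i j
  have := congrFun (congrFun h1 (f i)) j
  rw [Matrix.mul_apply] at this
  rw [Matrix.mul_apply]
  simpa only [submatrix_apply, id, Matrix.zero_apply] using this

theorem IsKrylov.submatrix_mulVec_mem [DecidableEq κ] {ε δ : Type} [Fintype ε] [Fintype δ]
    {B : Matrix ι ε ℂ} (h : IsKrylov A B M) (f : δ → κ) (N : Submodule ℂ (ι → ℂ))
    (hA : ∀ x ∈ N, A *ᵥ x ∈ N) (hB : ∀ y, B *ᵥ y ∈ N) (y : δ → ℂ) :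
    M.submatrix id f *ᵥ y ∈ N := by
  have : M.submatrix id f = M * (1 : Matrix κ κ ℂ).submatrix id f := by
    ext i j
    simp [Matrix.mul_apply, Matrix.one_apply]
  rw [this, ← mulVec_mulVec]
  exact h.minimal N hA hB _

/-- The quotient matrix is a submatrix of A - M G A, so a product, a difference and a selection of
registers produce it. The next lemma does the same for the generators. -/
theorem proj_mul_map_apply {δ : Type} (f : δ → ι) (i j : δ) :
    ((1 - M * G).submatrix f id * (A * (1 : Matrix ι ι ℂ).submatrix id f)) i j =
      (A - M * G * A) (f i) (f j) := by
  have h1 : A * (1 : Matrix ι ι ℂ).submatrix id f = A.submatrix id f := by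
    ext i j
    simp [Matrix.mul_apply, Matrix.one_apply]
  have h2 : A - M * G * A = (1 - M * G) * A := by rw [Matrix.sub_mul, Matrix.one_mul]
  rw [h1, h2, Matrix.mul_apply, Matrix.mul_apply]
  simp only [submatrix_apply, id]

theorem proj_mul_apply {δ ε : Type} (f : δ → ι) (B : Matrix ι ε ℂ) (i : δ) (j : ε) :
    ((1 - M * G).submatrix f id * B) i j = (B - M * G * B) (f i) j := by
  have h2 : B - M * G * B = (1 - M * G) * B := by rw [Matrix.sub_mul, Matrix.one_mul]
  rw [h2, Matrix.mul_apply, Matrix.mul_apply]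
  simp only [submatrix_apply, id]

end split

end Krylov

/-! ### The characteristic polynomial in `O(n ^ ω log ^ 3 n)` operations -/

/-- The registers `f j` hold the coefficients of `p`. -/
def RegPoly (mem : List ℂ) (f : ℕ → ℕ) (p : ℂ[X]) : Prop := ∀ j, HasVal mem (f j) (p.coeff j)

theorem RegPoly.mono {mem mem' : List ℂ} {f : ℕ → ℕ} {p : ℂ[X]} (h : RegPoly mem f p)
    (hm : mem <+: mem') : RegPoly mem' f p := fun j => (h j).mono hm

/-- Multiplication of polynomials whose product has degree at most `n`. -/
noncomputable def polyMul (n : ℕ) (f g : ℕ → ℕ) : Prog ℂ (ℕ → ℕ) := do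
  let z ← lit 0
  let r ← forFin (n + 1) fun k => dot ((List.range (k.val + 1)).map fun i => (f i, g (k.val - i)))
  pure fun j => if h : j < n + 1 then r ⟨j, h⟩ else z

/-- Schoolbook multiplication is fast enough: quadratic cost is below that of a matrix product. -/
theorem achieves_polyMul {t : Prop} {mem : List ℂ} {n : ℕ} {f g : ℕ → ℕ} {p q : ℂ[X]}
    (hp : RegPoly mem f p) (hq : RegPoly mem g q) (hn : (p * q).natDegree ≤ n) :
    Achieves t (polyMul n f g) mem (4 * ((n : ℝ) + 1) ^ 2) fun r m => RegPoly m r (p * q) := by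
  refine Achieves.mono_cost (c := 1 + ((n + 1 : ℕ) * (2 * (n + 1 : ℕ) + 1) + 0)) ?_ ?_
  · refine (achieves_lit 0).bind fun z m₁ hm₁ hz => ?_
    refine (achieves_forFin_val (v := fun k => (p * q).coeff k) fun k m hm => ?_).bind
      fun r m hm hr => achieves_pure fun j => ?_
    · refine (achieves_dot (List.range (k.val + 1)) (x := fun i => p.coeff i)
        (y := fun i => q.coeff (k.val - i)) (fun i _ => (hp i).mono (hm₁.trans hm))
        (fun i _ => (hq _).mono (hm₁.trans hm))).mono ?_ fun l m' _ hl => ?_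
      · have : (k : ℕ) + 1 ≤ n + 1 := k.isLt
        have : ((k : ℕ) : ℝ) + 1 ≤ n + 1 := by exact_mod_cast this
        rw [List.length_range]
        push_cast
        linarith
      · rw [coeff_mul, Finset.Nat.sum_antidiagonal_eq_sum_range_succ_mk,
          Finset.sum_eq_multiset_sum, Finset.range_val, Multiset.range, Multiset.map_coe,
          Multiset.sum_coe]
        exact hl
    · split_ifs with h
      · exact hr ⟨j, h⟩
      · rw [coeff_eq_zero_of_natDegree_lt (by omega)]
        exact hz.mono hm
  · push_cast
    nlinarith [Nat.cast_nonneg (α := ℝ) n]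

namespace FastMul

variable {ω : ℝ} (F : FastMul ω) {ι κ : Type} [Fintype ι] [Fintype κ]

/-- A projection onto the span of `A ^ j B` for `j < 2 ^ L`, and the power `A ^ (2 ^ L)`. -/
noncomputable def krylov (hA : ι → ι → ℕ) (hB : ι → κ → ℕ) :
    ℕ → Prog ℂ ((ι → ι → ℕ) × (ι → ι → ℕ))
  | 0 => do
      let o ← F.inv hB
      let p ← F.mmul hB o.reg
      pure (p, hA)
  | L + 1 => do
      let r ← krylov hA hB L
      let w ← F.mmul r.2 r.1
      let o ← F.inv fun i => Sum.elim (r.1 i) (w i)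
      let p ← F.mmul (fun i => Sum.elim (r.1 i) (w i)) o.reg
      let a ← F.mmul r.2 r.2
      pure (p, a)

/-- The columns `A ^ j b` for `j < 2 ^ L`, and the power `A ^ (2 ^ L)`. -/
noncomputable def krylovCols (hA : ι → ι → ℕ) (hb : ι → ℕ) :
    (L : ℕ) → Prog ℂ ((ι → Fin (2 ^ L) → ℕ) × (ι → ι → ℕ))
  | 0 => pure (fun i _ => hb i, hA)
  | L + 1 => do
      let r ← krylovCols hA hb L
      let w ← F.mmul r.2 r.1
      let a ← F.mmul r.2 r.2
      pure (fun i j => if h : j.val < 2 ^ L then r.1 i ⟨j, h⟩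
        else w i ⟨j.val - 2 ^ L, by have := j.isLt; have := pow_succ 2 L; omega⟩, a)

/-- The characteristic polynomial of a matrix with a cyclic vector. -/
noncomputable def charpolyCyclic (hA : ι → ι → ℕ) (hb : ι → ℕ) : Prog ℂ (ℕ → ℕ) := do
  let r ← F.krylovCols hA hb (Nat.clog 2 (Fintype.card ι + 1))
  let o ← F.inv fun i (j : Fin (Fintype.card ι)) => r.1 i ⟨j.val,
    (j.isLt.trans (Nat.lt_succ_self _)).trans_le (Nat.le_pow_clog (by norm_num) _)⟩
  let v ← F.mmul o.reg fun i (_ : Unit) => r.1 i ⟨Fintype.card ι,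
    (Nat.lt_succ_self _).trans_le (Nat.le_pow_clog (by norm_num) _)⟩
  let z ← lit 0
  let e ← lit 1
  let u ← forFin (Fintype.card ι) fun j => arith .sub z (v j ()) ret
  pure fun j => if h : j < Fintype.card ι then u ⟨j, h⟩ else if j = Fintype.card ι then e else z

/-- The characteristic polynomial of a matrix `A` from `2 ^ k` generators of the space over
`ℂ[A]`: split off the subspace generated by the first half of the generators. -/
noncomputable def charpolyGen : (k : ℕ) → (ι : Type) → [Fintype ι] → (ι → ι → ℕ) →
    (ι → BinIdx k → ℕ) → Prog ℂ (ℕ → ℕ)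
  | 0, _, _, hA, hB => F.charpolyCyclic hA fun i => hB i ()
  | k + 1, ι, _, hA, hB => do
      let r ← F.krylov hA (fun i j => hB i (.inl j)) (Nat.clog 2 (Fintype.card ι))
      let o ← F.inv r.1
      let u ← F.mmul hA r.1
      let a₁ ← F.mmul o.reg u
      let w ← F.mmul r.1 o.reg
      let x ← F.mmul w hA
      let a₂ ← msub hA x
      let b₁ ← F.mmul o.reg fun i j => hB i (.inl j)
      let y ← F.mmul w fun i j => hB i (.inr j)
      let b₂ ← msub (fun i j => hB i (.inr j)) y
      let f ← charpolyGen k {j // o.col j = true} (fun i j => a₁ i j) (fun i j => b₁ i j)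
      let g ← charpolyGen k {i // o.row i = false} (fun i j => a₂ i j) (fun i j => b₂ i j)
      polyMul (Fintype.card ι) f g

variable [DecidableEq ι] [DecidableEq κ] {t : Prop} {mem : List ℂ} {s : ℕ}

/-- The size `s` must accommodate the 2n columns of [P, A^k P]. A doubling step uses one inversion
(25) and three products, whence 28. -/
theorem achieves_krylov {hA : ι → ι → ℕ} {hB : ι → κ → ℕ} {A : Matrix ι ι ℂ} {B : Matrix ι κ ℂ}
    (hAm : RegMat mem hA A) (hBm : RegMat mem hB B) (hs : 1 ≤ s)
    (hι : Fintype.card ι + Fintype.card ι ≤ s) (hκ : Fintype.card κ ≤ s) (L : ℕ) :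
    Achieves t (F.krylov hA hB L) mem
      ((L + 1) * (28 * (Nat.clog 2 s + 1) * F.cost (2 * s))) fun r m =>
        (∃ P : Matrix ι ι ℂ, RegMat m r.1 P ∧
          ∀ x, x ∈ krylovSpan A B (2 ^ L) ↔ ∃ y, x = P.mulVec y) ∧
        RegMat m r.2 (A ^ 2 ^ L) := by
  have hcs : F.cost s ≤ F.cost (2 * s) := F.cost_mono (by omega)
  have hc0 := F.cost_nonneg (2 * s)
  have hl : (0 : ℝ) ≤ Nat.clog 2 s := Nat.cast_nonneg _
  have hprod := mul_nonneg hl hc0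
  have hι' : Fintype.card ι ≤ s := by omega
  induction L with
  | zero =>
    refine Achieves.mono_cost (c := 25 * (Nat.clog 2 s + 1) * F.cost (2 * s) + (F.cost s + 0)) ?_
      (by push_cast; linarith)
    refine (F.achieves_inv hBm hs hι' hκ).bind fun o m₁ hm₁ ⟨G, hG, hinv⟩ => ?_
    refine (F.achieves_mmul (hBm.mono hm₁) hG hs hι' hκ hι').bind fun p m hm hp => ?_
    refine achieves_pure ⟨⟨_, hp, fun x => ?_⟩, ?_⟩
    · rw [← hinv.exists_mulVec_iff, pow_zero, mem_krylovSpan_one]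
    · rw [pow_zero, pow_one]
      exact hAm.mono (hm₁.trans hm)
  | succ L ih =>
    refine Achieves.mono_cost (c := (L + 1) * (28 * (Nat.clog 2 s + 1) * F.cost (2 * s)) +
      (F.cost s + (25 * (Nat.clog 2 s + 1) * F.cost (2 * s) + (F.cost s + (F.cost s + 0))))) ?_
      (by push_cast; linarith)
    refine ih.bind fun r m₁ hm₁ ⟨⟨P, hP, hspan⟩, hpow⟩ => ?_
    refine (F.achieves_mmul hpow hP hs hι' hι' hι').bind fun w m₂ hm₂ hw => ?_
    have hcols : RegMat m₂ (fun i => Sum.elim (r.1 i) (w i))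
        (Matrix.fromCols P (A ^ 2 ^ L * P)) := by
      rintro i (j | j)
      · exact (hP i j).mono hm₂
      · exact hw i j
    have hκ2 : Fintype.card (ι ⊕ ι) ≤ s := by rwa [Fintype.card_sum]
    refine (F.achieves_inv hcols hs hι' hκ2).bind fun o m₃ hm₃ ⟨G, hG, hinv⟩ => ?_
    refine (F.achieves_mmul (hcols.mono hm₃) hG hs hι' hκ2 hι').bind fun p m₄ hm₄ hp => ?_
    have hpow' := hpow.mono ((hm₂.trans hm₃).trans hm₄)
    refine (F.achieves_mmul hpow' hpow' hs hι' hι' hι').bind fun a m hm ha => ?_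
    refine achieves_pure ⟨⟨_, hp.mono hm, fun x => ?_⟩, ?_⟩
    · rw [← hinv.exists_mulVec_iff, pow_succ', mem_krylovSpan_two_mul hspan]
    · rwa [pow_succ, pow_mul, pow_two]

theorem achieves_krylovCols {hA : ι → ι → ℕ} {hb : ι → ℕ} {A : Matrix ι ι ℂ}
    {b : Matrix ι Unit ℂ} (hAm : RegMat mem hA A) (hbm : ∀ i, HasVal mem (hb i) (b i ()))
    (hs : 1 ≤ s) (hι : Fintype.card ι ≤ s) {L : ℕ} (hL : 2 ^ L ≤ s) :
    Achieves t (F.krylovCols hA hb L) mem (L * (2 * F.cost s)) fun r m =>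
      RegMat m r.1 (Matrix.of fun i (j : Fin (2 ^ L)) => (A ^ j.val * b) i ()) ∧
        RegMat m r.2 (A ^ 2 ^ L) := by
  induction L with
  | zero =>
    refine Achieves.mono_cost (c := 0) (achieves_pure ⟨fun i j => ?_, ?_⟩) (by simp)
    · have hj : j.val = 0 := by have := j.isLt; have := pow_zero 2; omega
      have hb' : (A ^ j.val * b) i () = b i () := by rw [hj, pow_zero, Matrix.one_mul]
      rw [Matrix.of_apply, hb']
      exact hbm i
    · rw [pow_zero, pow_one]
      exact hAm
  | succ L ih =>
    rw [pow_succ] at hL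
    refine Achieves.mono_cost (c := L * (2 * F.cost s) + (F.cost s + (F.cost s + 0))) ?_
      (by push_cast; linarith)
    refine (ih (by omega)).bind fun r m₁ hm₁ ⟨hK, hpow⟩ => ?_
    refine (F.achieves_mmul hpow hK hs hι hι (by simp; omega)).bind fun w m₂ hm₂ hw => ?_
    refine (F.achieves_mmul (hpow.mono hm₂) (hpow.mono hm₂) hs hι hι hι).bind
      fun a m hm ha => achieves_pure ⟨fun i j => ?_, ?_⟩
    · simp only [Matrix.of_apply]
      split_ifs with h
      · exact ((hK i ⟨j, h⟩).mono hm₂).mono hm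
      · have h1 := (hw i ⟨j.val - 2 ^ L, by have := j.isLt; have := pow_succ 2 L; omega⟩).mono hm
        have h2 : (A ^ j.val * b) i () =
            (A ^ 2 ^ L * (A ^ (j.val - 2 ^ L) * b) : Matrix ι Unit ℂ) i () := by
          rw [← Matrix.mul_assoc, ← pow_add, Nat.add_sub_cancel' (not_lt.1 h)]
        rw [h2]
        simpa only [Matrix.mul_apply, Matrix.of_apply] using h1
    · have h1 : A ^ 2 ^ (L + 1) = A ^ 2 ^ L * A ^ 2 ^ L := by rw [pow_succ, pow_mul, pow_two]
      rw [h1]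
      exact ha

theorem achieves_charpolyCyclic {hA : ι → ι → ℕ} {hb : ι → ℕ} {A : Matrix ι ι ℂ}
    {b : Matrix ι Unit ℂ} (hAm : RegMat mem hA A) (hbm : ∀ i, HasVal mem (hb i) (b i ()))
    (hgen : Generates A b) (hs : Fintype.card ι + 1 ≤ s) :
    Achieves t (F.charpolyCyclic hA hb) mem (31 * (Nat.clog 2 s + 1) * F.cost (2 * s))
      fun f m => RegPoly m f A.charpoly := by
  set n := Fintype.card ι with hn
  have hs1 : 1 ≤ s := by omega
  -- There are 2^L ≥ n + 1 Krylov columns: the columns 0, …, n - 1 form the matrix of the linear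
  -- system and column n is its right-hand side.
  have hL : Nat.clog 2 (n + 1) ≤ Nat.clog 2 s := Nat.clog_mono_right 2 hs
  have h2L : 2 ^ Nat.clog 2 (n + 1) ≤ 2 * s :=
    (Nat.pow_le_pow_right (by norm_num) hL).trans (two_pow_clog_le hs1)
  refine Achieves.mono_cost (c := Nat.clog 2 (n + 1) * (2 * F.cost (2 * s)) +
    (25 * (Nat.clog 2 s + 1) * F.cost (2 * s) + (F.cost s + (1 + (1 + (n * 1 + 0)))))) ?_ ?_
  · refine (F.achieves_krylovCols hAm hbm (by omega) (by omega) h2L).bind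
      fun r m₁ hm₁ ⟨hK, _⟩ => ?_
    refine (F.achieves_inv (M := Matrix.of fun i (j : Fin n) => (A ^ j.val * b) i ())
      (fun i j => hK i _) hs1 (by omega) (by simp; omega)).bind fun o m₂ hm₂ ⟨G, hG, hinv⟩ => ?_
    refine (F.achieves_mmul (B := A ^ n * b) hG (fun i j => (hK i _).mono hm₂) hs1 (by simp; omega)
      (by omega) (by simp; omega)).bind fun v m₃ hm₃ hv => ?_
    refine (achieves_lit 0).bind fun z m₄ hm₄ hz => ?_
    refine (achieves_lit 1).bind fun e m₅ hm₅ he => ?_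
    refine (achieves_forFin_val (v := fun j : Fin n => 0 - (G * (A ^ n * b)) j ()) fun j m hm =>
      achieves_arith .sub (hz.mono (hm₅.trans hm))
        ((hv j ()).mono ((hm₄.trans hm₅).trans hm))).bind fun u m hm hu => ?_
    refine achieves_pure fun j => ?_
    split_ifs with h1 h2
    · have h3 := charpoly_coeff_of_cyclic hgen (fun i j => rfl) hinv.mul_mul ⟨j, h1⟩
      rw [h3]
      exact hu ⟨j, h1⟩
    · have h3 : A.charpoly.coeff n = 1 := by
        rw [hn, ← A.charpoly_natDegree_eq_dim]
        exact A.charpoly_monic.coeff_natDegree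
      rw [h2, h3]
      exact he.mono hm
    · rw [coeff_eq_zero_of_natDegree_lt (by rw [A.charpoly_natDegree_eq_dim]; omega)]
      exact (hz.mono hm₅).mono hm
  · have h1 : F.cost s ≤ F.cost (2 * s) := F.cost_mono (by omega)
    have h2 := F.sq_le_cost s
    have h3 : (1 : ℝ) ≤ s := by exact_mod_cast hs1
    have h4 : (n : ℝ) + 1 ≤ s := by exact_mod_cast hs
    have h5 : (Nat.clog 2 (n + 1) : ℝ) ≤ Nat.clog 2 s := by exact_mod_cast hL
    have h6 : (0 : ℝ) ≤ Nat.clog 2 s := Nat.cast_nonneg _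
    have h7 := mul_le_mul_of_nonneg_right h5 (F.cost_nonneg (2 * s))
    have h8 := mul_nonneg h6 (F.cost_nonneg (2 * s))
    nlinarith

/-- For dimension n and 2^k generators put s = n + 2^k. The sizes of the two subproblems add up to
s, so by superadditivity each of the k + 1 levels costs at most 65 Λ² · `cost` (4s). Here 65 = 28 +
25 + 8 + 4 stands for the Krylov projection, a pivot inversion, eight products and differences, and
the product of polynomials. In 4s one factor 2 comes from the doubled Krylov matrix and one from
padding to a power of two. The bound `s₀` is fixed so that Λ is the same at all levels. -/
theorem achieves_charpolyGen (k : ℕ) {ι : Type} [Fintype ι] [DecidableEq ι] {hA : ι → ι → ℕ}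
    {hB : ι → BinIdx k → ℕ} {A : Matrix ι ι ℂ} {B : Matrix ι (BinIdx k) ℂ} {mem : List ℂ}
    (hAm : RegMat mem hA A) (hBm : RegMat mem hB B) (hgen : Generates A B) {s₀ : ℕ}
    (hs₀ : 2 * (Fintype.card ι + 2 ^ k) ≤ s₀) :
    Achieves t (F.charpolyGen k ι hA hB) mem
      (65 * ((Nat.clog 2 s₀ : ℝ) + 1) ^ 2 * (k + 1) * F.cost (4 * (Fintype.card ι + 2 ^ k)))
      fun f m => RegPoly m f A.charpoly := by
  set Λ : ℝ := (Nat.clog 2 s₀ : ℝ) + 1 with hΛ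
  have hΛ1 : 1 ≤ Λ := by rw [hΛ]; linarith [Nat.cast_nonneg (α := ℝ) (Nat.clog 2 s₀)]
  induction k generalizing ι mem with
  | zero =>
    refine Achieves.mono_cost (F.achieves_charpolyCyclic (b := B) hAm (fun i => hBm i ()) hgen
      (s := Fintype.card ι + 1) le_rfl) ?_
    have h1 : Nat.clog 2 (Fintype.card ι + 1) ≤ Nat.clog 2 s₀ :=
      Nat.clog_mono_right 2 (by omega)
    have h2 : (Nat.clog 2 (Fintype.card ι + 1) : ℝ) + 1 ≤ Λ := by
      rw [hΛ]; gcongr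
    have h3 : F.cost (2 * (Fintype.card ι + 1)) ≤ F.cost (4 * (Fintype.card ι + 2 ^ 0)) :=
      F.cost_mono (by omega)
    have h4 := F.cost_nonneg (2 * (Fintype.card ι + 1))
    have h5 := F.cost_nonneg (4 * (Fintype.card ι + 2 ^ 0))
    have h6 : Λ ≤ Λ ^ 2 := by nlinarith
    calc _ ≤ 31 * Λ * F.cost (4 * (Fintype.card ι + 2 ^ 0)) := by gcongr
      _ ≤ 65 * Λ ^ 2 * ((0 : ℕ) + 1) * F.cost (4 * (Fintype.card ι + 2 ^ 0)) := by
        have h7 := mul_le_mul_of_nonneg_right h6 h5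
        have h8 := mul_nonneg (sq_nonneg Λ) h5
        simp only [Nat.cast_zero, zero_add, mul_one]
        linarith
  | succ k ih =>
    set n := Fintype.card ι with hn
    set s := n + 2 ^ (k + 1) with hs
    have hs1 : 1 ≤ s := by have := Nat.one_le_two_pow (n := k + 1); omega
    have hB₁ : RegMat mem (fun i j => hB i (.inl j)) (Matrix.toCols₁ B) :=
      fun i j => hBm i (.inl j)
    have hB₂ : RegMat mem (fun i j => hB i (.inr j)) (Matrix.toCols₂ B) :=
      fun i j => hBm i (.inr j)
    have hk : Fintype.card (BinIdx k) ≤ s := by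
      have := Nat.one_le_two_pow (n := k)
      rw [BinIdx.card, hs, pow_succ]; omega
    have hns : n ≤ s := Nat.le_add_right _ _
    set c := F.cost (4 * s) with hc
    have hc0 : 0 ≤ c := F.cost_nonneg _
    have hcs : F.cost s ≤ c := F.cost_mono (by omega)
    have hlog : (Nat.clog 2 (2 * s) : ℝ) + 1 ≤ Λ := by
      have : Nat.clog 2 (2 * s) ≤ Nat.clog 2 s₀ := Nat.clog_mono_right 2 hs₀
      rw [hΛ]; gcongr
    have hlog' : (Nat.clog 2 n : ℝ) + 1 ≤ Λ := by
      have : Nat.clog 2 n ≤ Nat.clog 2 s₀ := Nat.clog_mono_right 2 (by omega)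
      rw [hΛ]; gcongr
    have h4s : 2 * (2 * s) = 4 * s := by ring
    refine Achieves.mono_cost (c := Λ * (28 * Λ * c) + (25 * Λ * c + (c + (c + (c + (c + (c + (c +
      (c + (c + (65 * Λ ^ 2 * (k + 1) * c + 4 * c))))))))))) ?_ ?_
    · refine Achieves.bind ((F.achieves_krylov (s := 2 * s) hAm hB₁ (by omega) (by omega)
        (by omega) (Nat.clog 2 n)).mono_cost ?_) fun r m₁ hm₁ ⟨⟨M, hM, hspan⟩, _⟩ => ?_
      · rw [h4s]
        gcongr
      have hkry : IsKrylov A (Matrix.toCols₁ B) M :=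
        isKrylov_of_mem_krylovSpan (Nat.le_pow_clog (by norm_num) _) hspan
      refine Achieves.bind ((F.achieves_inv (s := 2 * s) hM (by omega) (by omega)
        (by omega)).mono_cost ?_) fun o m₂ hm₂ ⟨G, hG, hinv⟩ => ?_
      · rw [h4s]
        gcongr
      have hAm₂ := hAm.mono (hm₁.trans hm₂)
      have hM₂ := hM.mono hm₂
      have hB₁₂ := hB₁.mono (hm₁.trans hm₂)
      have hB₂₂ := hB₂.mono (hm₁.trans hm₂)
      refine Achieves.bind ((F.achieves_mmul hAm₂ hM₂ hs1 hns hns hns).mono_cost hcs)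
        fun u m₃ hm₃ hu => ?_
      refine Achieves.bind ((F.achieves_mmul (hG.mono hm₃) hu hs1 hns hns hns).mono_cost hcs)
        fun a₁ m₄ hm₄ ha₁ => ?_
      have h24 := hm₃.trans hm₄
      refine Achieves.bind ((F.achieves_mmul (hM₂.mono h24) (hG.mono h24) hs1 hns hns
        hns).mono_cost hcs) fun w m₅ hm₅ hw => ?_
      have h25 := h24.trans hm₅
      refine Achieves.bind ((F.achieves_mmul hw (hAm₂.mono h25) hs1 hns hns hns).mono_cost hcs)
        fun x m₆ hm₆ hx => ?_
      refine Achieves.bind ((F.achieves_msub (hAm₂.mono (h25.trans hm₆)) hx hns hns).mono_cost hcs)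
        fun a₂ m₇ hm₇ ha₂ => ?_
      have h57 := hm₆.trans hm₇
      refine Achieves.bind ((F.achieves_mmul (hG.mono (h25.trans h57)) (hB₁₂.mono (h25.trans h57))
        hs1 hns hns hk).mono_cost hcs) fun b₁ m₈ hm₈ hb₁ => ?_
      have h58 := h57.trans hm₈
      refine Achieves.bind ((F.achieves_mmul (hw.mono h58) (hB₂₂.mono (h25.trans h58)) hs1 hns hns
        hk).mono_cost hcs) fun y m₉ hm₉ hy => ?_
      refine Achieves.bind ((F.achieves_msub (hB₂₂.mono (h25.trans (h58.trans hm₉))) hy hns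
        hk).mono_cost hcs) fun b₂ m hm hb₂ => ?_
      have h9 := hm₉.trans hm
      have hsp := hinv.isSplitting hkry.map_mem
      have hTB := hinv.proj_mul_eq_zero hkry.contains
        (Subtype.val : {i // o.row i = false} → ι)
      have hgen₁ := hsp.generates_left hTB (hkry.submatrix_mulVec_mem _)
      have hgen₂ := hsp.generates_right hTB hgen
      have hcard := hsp.card_add_card
      set n₁ := Fintype.card {j // o.col j = true} with hn₁
      set n₂ := Fintype.card {i // o.row i = false} with hn₂
      have hpow : 2 ^ (k + 1) = 2 ^ k + 2 ^ k := by rw [pow_succ]; ring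
      -- The dimensions add up because of the splitting, and the numbers of generators because
      -- 2^(k+1) = 2^k + 2^k.
      have hsum := F.cost_add_le (4 * (n₁ + 2 ^ k)) (4 * (n₂ + 2 ^ k))
      have hsum' : 4 * (n₁ + 2 ^ k) + 4 * (n₂ + 2 ^ k) = 4 * s := by
        rw [hs, hpow, hn, ← hcard]; ring
      rw [hsum', ← hc] at hsum
      refine Achieves.mono_cost (c := 65 * Λ ^ 2 * (k + 1) * F.cost (4 * (n₁ + 2 ^ k)) +
        (65 * Λ ^ 2 * (k + 1) * F.cost (4 * (n₂ + 2 ^ k)) + 4 * ((n : ℝ) + 1) ^ 2)) ?_ ?_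
      · refine (ih (fun i j => ?_) (fun i j => ?_) hgen₁ (by omega)).bind
          fun f m' hm' hf => ?_
        · have := (ha₁ i j).mono ((hm₅.trans h58).trans h9)
          simpa only [Matrix.mul_apply, Matrix.submatrix_apply, id] using this
        · have := (hb₁ i j).mono h9
          simpa only [Matrix.mul_apply, Matrix.submatrix_apply, id] using this
        refine (ih (fun i j => ?_) (fun i j => ?_) hgen₂ (by omega)).bind
          fun g m'' hm'' hg => ?_
        · rw [proj_mul_map_apply]
          exact (ha₂ i j).mono ((hm₈.trans h9).trans hm')
        · rw [proj_mul_apply]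
          exact (hb₂ i j).mono hm'
        rw [hsp.charpoly_eq]
        refine achieves_polyMul (hf.mono hm'') hg ?_
        rw [← hsp.charpoly_eq, A.charpoly_natDegree_eq_dim]
      · have h1 : ((n : ℝ) + 1) ^ 2 ≤ c := by
          refine le_trans ?_ ((F.sq_le_cost s).trans hcs)
          have h2 : n + 1 ≤ s := by
            have := Nat.one_le_two_pow (n := k + 1)
            omega
          have h3 : (n : ℝ) + 1 ≤ s := by exact_mod_cast h2
          gcongr
        have h4 : 0 ≤ 65 * Λ ^ 2 * ((k : ℝ) + 1) := by positivity
        nlinarith [mul_le_mul_of_nonneg_left hsum h4]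
    · have h1 : Λ ≤ Λ ^ 2 := by nlinarith
      have h2 := mul_le_mul_of_nonneg_right h1 hc0
      have h3 : (1 : ℝ) ≤ Λ ^ 2 := hΛ1.trans h1
      have h4 := mul_le_mul_of_nonneg_right h3 hc0
      push_cast
      linarith

end FastMul

/-! ### The characteristic polynomial routine and its cost -/

namespace FastMul

variable {ω : ℝ} (F : FastMul ω)

/-- The characteristic polynomial, with the unit vectors as generators. -/
noncomputable def charpolyRoutine : SimpleRR.CharpolyRoutine ℂ := fun n h => do
  let z ← lit 0
  let e ← lit 1
  let f ← F.charpolyGen (Nat.clog 2 n) (Fin n) h fun i x =>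
    if toBin (Fin n) ((Fintype.card_fin n).trans_le (Nat.le_pow_clog (by norm_num) n)) i = x
    then e else z
  pure fun j => f j

theorem generates_of_injective {n k : ℕ} (A : Matrix (Fin n) (Fin n) ℂ) {e : Fin n → BinIdx k}
    (he : e.Injective) :
    Generates A (Matrix.of fun i x => if e i = x then (1 : ℂ) else 0) := by
  intro N _ hB
  refine Submodule.eq_top_iff'.2 fun x => ?_
  have h := hB (Function.extend e x 0)
  convert h using 1
  ext i
  simp [Matrix.mulVec, dotProduct, he.extend_apply]

theorem achieves_charpolyRoutine {t : Prop} {n : ℕ} {h : Fin n → Fin n → ℕ}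
    {A : Matrix (Fin n) (Fin n) ℂ} {mem : List ℂ} (hA : RegMat mem h A) :
    Achieves t (F.charpolyRoutine n h) mem
      (2 + 65 * ((Nat.clog 2 (2 * (n + 2 ^ Nat.clog 2 n)) : ℝ) + 1) ^ 2 * (Nat.clog 2 n + 1) *
        F.cost (4 * (n + 2 ^ Nat.clog 2 n)))
      fun f m => ∀ j, HasVal m (f j) (A.charpoly.coeff j) := by
  refine Achieves.mono_cost (c := 1 + (1 + (65 *
    ((Nat.clog 2 (2 * (n + 2 ^ Nat.clog 2 n)) : ℝ) + 1) ^ 2 * (Nat.clog 2 n + 1) *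
        F.cost (4 * (Fintype.card (Fin n) + 2 ^ Nat.clog 2 n)) + 0))) ?_
    (by rw [Fintype.card_fin]; linarith)
  refine (achieves_lit 0).bind fun z m₁ hm₁ hz => ?_
  refine (achieves_lit 1).bind fun e m₂ hm₂ he => ?_
  refine (F.achieves_charpolyGen _ (hA.mono (hm₁.trans hm₂)) (fun i x => ?_)
    (generates_of_injective A (toBin (Fin n)
      ((Fintype.card_fin n).trans_le (Nat.le_pow_clog (by norm_num) n))).injective)
    (by rw [Fintype.card_fin])).bind fun f m hm hf => achieves_pure fun j => hf j
  rw [Matrix.of_apply]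
  split_ifs
  · exact he
  · exact hz.mono hm₂

theorem computesCharpoly_charpolyRoutine : SimpleRR.ComputesCharpoly F.charpolyRoutine :=
  fun _ _ _ _ hA => (F.achieves_charpolyRoutine (t := False) hA).post

theorem clog_le_log {s : ℕ} (hs : 1 ≤ s) : (Nat.clog 2 s : ℝ) ≤ 2 * Real.log (2 * s) := by
  have h1 : ((2 : ℝ)) ^ Nat.clog 2 s ≤ 2 * s := by exact_mod_cast two_pow_clog_le hs
  have h2 := Real.log_le_log (by positivity) h1
  rw [Real.log_pow] at h2
  have h3 := Real.log_two_gt_d9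
  nlinarith [Nat.cast_nonneg (α := ℝ) (Nat.clog 2 s)]

theorem one_le_log_add_two {x : ℝ} (hx : 1 ≤ x) : 1 ≤ Real.log (x + 2) := by
  rw [Real.le_log_iff_exp_le (by linarith)]
  linarith [Real.exp_one_lt_d9]

theorem log_twelve_mul_le {n : ℕ} (hn : 1 ≤ n) :
    Real.log (12 * n) ≤ 4 * Real.log ((n : ℝ) + 2) := by
  have hn' : (1 : ℝ) ≤ n := by exact_mod_cast hn
  rw [← Real.log_rpow (by linarith)]
  refine Real.log_le_log (by linarith) ?_
  norm_cast
  nlinarith [sq_nonneg ((n : ℝ) + 2), Nat.one_le_pow 2 (n + 2) (by omega),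
    pow_le_pow_left₀ (by omega) (show 3 ≤ n + 2 by omega) 3]

theorem exists_charpolyRoutine_cost : ∃ C : ℝ, 0 ≤ C ∧ ∀ n : ℕ, 1 ≤ n →
    2 + 65 * ((Nat.clog 2 (2 * (n + 2 ^ Nat.clog 2 n)) : ℝ) + 1) ^ 2 * (Nat.clog 2 n + 1) *
        F.cost (4 * (n + 2 ^ Nat.clog 2 n)) ≤ C * (n : ℝ) ^ ω * Real.log ((n : ℝ) + 2) ^ 3 := by
  have hC := F.one_le
  have hω := F.two_le
  -- Since 2^⌈log₂ n⌉ ≤ 2n, the size 4(n + 2^⌈log₂ n⌉) is at most 12n. Each of the three logarithmic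
  -- factors is at most 9 log(n + 2).
  refine ⟨2 + 65 * 9 ^ 3 * ((F.C + 1) * 12 ^ ω), by positivity, fun n hn => ?_⟩
  have hn' : (1 : ℝ) ≤ n := by exact_mod_cast hn
  set l := Real.log ((n : ℝ) + 2) with hl
  have hl1 : 1 ≤ l := one_le_log_add_two hn'
  have h2 := two_pow_clog_le hn
  have hlog : (Nat.clog 2 (6 * n) : ℝ) + 1 ≤ 9 * l := by
    have h3 := clog_le_log (s := 6 * n) (by omega)
    have h4 := log_twelve_mul_le hn
    push_cast at h3
    rw [← mul_assoc] at h3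
    norm_num at h3
    linarith
  have h5 : (Nat.clog 2 (2 * (n + 2 ^ Nat.clog 2 n)) : ℝ) + 1 ≤ 9 * l := by
    refine le_trans ?_ hlog
    have : Nat.clog 2 (2 * (n + 2 ^ Nat.clog 2 n)) ≤ Nat.clog 2 (6 * n) :=
      Nat.clog_mono_right 2 (by omega)
    gcongr
  have h6 : (Nat.clog 2 n : ℝ) + 1 ≤ 9 * l := by
    refine le_trans ?_ hlog
    have : Nat.clog 2 n ≤ Nat.clog 2 (6 * n) := Nat.clog_mono_right 2 (by omega)
    gcongr
  have h7 : F.cost (4 * (n + 2 ^ Nat.clog 2 n)) ≤ (F.C + 1) * 12 ^ ω * (n : ℝ) ^ ω := by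
    refine (F.cost_mono (s' := 12 * n) (by omega)).trans_eq ?_
    rw [cost]
    push_cast
    rw [Real.mul_rpow (by norm_num) (by positivity), mul_assoc]
  have h8 : 1 ≤ (n : ℝ) ^ ω := Real.one_le_rpow hn' (by linarith)
  have h9 : 1 ≤ l ^ 3 := one_le_pow₀ hl1
  calc _ ≤ 2 * ((n : ℝ) ^ ω * l ^ 3) +
        65 * (9 * l) ^ 2 * (9 * l) * ((F.C + 1) * 12 ^ ω * (n : ℝ) ^ ω) := by
        have h10 : 1 ≤ (n : ℝ) ^ ω * l ^ 3 := one_le_mul_of_one_le_of_one_le h8 h9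
        have h11 := F.cost_nonneg (4 * (n + 2 ^ Nat.clog 2 n))
        gcongr
        linarith
    _ = _ := by ring

end FastMul

/-! ### Interpolation at roots of unity by a mixed radix Fourier transform -/

/-- The discrete Fourier transform of length `l.prod` at powers of `w`. -/
noncomputable def dft : (l : List ℕ) → ℂ → (ℕ → ℕ) → Prog ℂ (ℕ → ℕ)
  | [], _, v => pure v
  | p :: l, w, v => do
      let f ← forFin p fun r => dft l (w ^ p) fun i => v (p * i + r.val)
      let y ← forFin (p * l.prod) fun j => do
        let c ← forFin p fun r => lit (w ^ (r.val * j.val))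
        dot ((List.finRange p).map fun r => (c r, f r (j.val % l.prod)))
      pure fun j => if h : j < p * l.prod then y ⟨j, h⟩ else 0

theorem sum_range_mul_eq {p m : ℕ} (f : ℕ → ℂ) :
    ∑ i ∈ Finset.range (p * m), f i = ∑ r : Fin p, ∑ i ∈ Finset.range m, f (p * i + r.val) := by
  rw [mul_comm, Finset.sum_range, ← finProdFinEquiv.sum_comp, Fintype.sum_prod_type_right]
  refine Finset.sum_congr rfl fun r _ => ?_
  rw [Finset.sum_range]
  refine Finset.sum_congr rfl fun i _ => ?_
  simp [add_comm]

/-- Write the summation index as p i + r. Since w^p has order dividing m, the inner transform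
depends on j modulo m only. -/
theorem dft_split {p m : ℕ} {w : ℂ} (hw : w ^ (p * m) = 1) (x : ℕ → ℂ) (j : ℕ) :
    ∑ i ∈ Finset.range (p * m), x i * w ^ (i * j) =
      ∑ r : Fin p, w ^ (r.val * j) *
        ∑ i ∈ Finset.range m, x (p * i + r.val) * (w ^ p) ^ (i * (j % m)) := by
  rw [sum_range_mul_eq]
  refine Finset.sum_congr rfl fun r _ => ?_
  rw [Finset.mul_sum]
  refine Finset.sum_congr rfl fun i _ => ?_
  have h1 : (w ^ p) ^ (i * (j % m)) = (w ^ p) ^ (i * j) := by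
    conv_rhs => rw [← Nat.mod_add_div j m, mul_add, pow_add, mul_left_comm, pow_mul (w ^ p) m,
      ← pow_mul w p m, hw, one_pow, mul_one]
  rw [h1, ← pow_mul, add_mul, pow_add, mul_assoc p i j]
  ring

/-- Combining p subtransforms takes 3p + 1 ≤ 4p operations per output value. Each radix thus adds
itself to the sum, and any factorization of the length is allowed. -/
theorem achieves_dft {t : Prop} (l : List ℕ) (hl : ∀ p ∈ l, 1 ≤ p) {w : ℂ} (hw : w ^ l.prod = 1)
    {v : ℕ → ℕ} {x : ℕ → ℂ} {mem : List ℂ} (hv : ∀ i < l.prod, HasVal mem (v i) (x i)) :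
    Achieves t (dft l w v) mem (4 * l.prod * l.sum) fun y m =>
      ∀ j < l.prod, HasVal m (y j) (∑ i ∈ Finset.range l.prod, x i * w ^ (i * j)) := by
  induction l generalizing w v x mem with
  | nil =>
    refine Achieves.mono_cost (c := 0) (achieves_pure fun j hj => ?_) (by simp)
    obtain rfl : j = 0 := by simpa using hj
    simpa using hv 0 (by simp)
  | cons p l ih =>
    have hp : 1 ≤ p := hl p (by simp)
    rw [List.prod_cons] at hw hv
    rw [List.prod_cons]
    refine Achieves.mono_cost (c := p * (4 * l.prod * l.sum) +
      ((p * l.prod : ℕ) * (p * 1 + (2 * p + 1)) + 0)) ?_ ?_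
    · refine (achieves_forFin (Q := fun (r : Fin p) (y : ℕ → ℕ) m => ∀ j < l.prod, HasVal m (y j)
        (∑ i ∈ Finset.range l.prod, x (p * i + r.val) * (w ^ p) ^ (i * j)))
        (fun r y m m' hm h j hj => (h j hj).mono hm) fun r m hm => ?_).bind fun f m₁ hm₁ hf => ?_
      · refine ih (fun q hq => hl q (by simp [hq])) (by rw [← pow_mul, hw]) fun i hi => ?_
        refine (hv _ ?_).mono hm
        calc p * i + r.val < p * i + p := by have := r.isLt; omega
          _ = p * (i + 1) := by ring
          _ ≤ p * l.prod := Nat.mul_le_mul_left _ hi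
      refine (achieves_forFin_val (v := fun j : Fin (p * l.prod) =>
        ∑ i ∈ Finset.range (p * l.prod), x i * w ^ (i * j.val)) fun j m hm => ?_).bind
          fun y m₂ hm₂ hy => achieves_pure fun j hj => ?_
      · refine (achieves_forFin_val (v := fun r : Fin p => w ^ (r.val * j.val))
          fun r m _ => achieves_lit _).bind fun c m' hm' hc => ?_
        have hj : j.val % l.prod < l.prod := Nat.mod_lt _ <| by
          have := j.isLt
          exact Nat.pos_of_ne_zero fun h0 => by simp [h0] at this
        refine (achieves_dot (List.finRange p) (fun r _ => hc r)
          (fun r _ => ((hf r _ hj).mono hm).mono hm')).mono (by simp) fun o m'' _ ho => ?_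
        rw [dft_split hw]
        rwa [← List.ofFn_eq_map, List.sum_ofFn] at ho
      · rw [dif_pos hj]
        exact hy ⟨j, hj⟩
    · have h1 : (1 : ℝ) ≤ p := by exact_mod_cast hp
      have h2 : (0 : ℝ) ≤ (l.prod : ℝ) := Nat.cast_nonneg _
      have h3 : (0 : ℝ) ≤ (p : ℝ) * l.prod := by positivity
      rw [List.sum_cons, Nat.cast_mul, Nat.cast_add]
      nlinarith

/-- Interpolation at the `N`-th roots of unity. -/
noncomputable def interpRoutine : SimpleRR.InterpRoutine ℂ := fun N h => do
  let y ← dft N.primeFactorsList (SimpleRR.rootOfUnity N)⁻¹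
    fun i => if hi : i < N then h ⟨i, hi⟩ else 0
  let c ← lit (1 / (N : ℂ))
  forFin N fun j => mul c (y j)

theorem isPrimitiveRoot_rootOfUnity {N : ℕ} (hN : N ≠ 0) :
    IsPrimitiveRoot (SimpleRR.rootOfUnity N) N := Complex.isPrimitiveRoot_exp N hN

theorem achieves_interpRoutine {t : Prop} {N : ℕ} (hN : N ≠ 0) {h : Fin N → ℕ} {v : Fin N → ℂ}
    {mem : List ℂ} (hv : ∀ i, HasVal mem (h i) (v i)) :
    Achieves t (interpRoutine N h) mem (4 * N * N.primeFactorsList.sum + (1 + N)) fun a m =>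
      ∀ j, HasVal m (a j)
        (1 / (N : ℂ) * ∑ i : Fin N, v i * (SimpleRR.rootOfUnity N)⁻¹ ^ (i.val * j.val)) := by
  have hprod := Nat.prod_primeFactorsList hN
  refine Achieves.mono_cost (c := 4 * (N.primeFactorsList.prod : ℕ) * N.primeFactorsList.sum +
    (1 + N * 1)) ?_ (by rw [hprod]; linarith)
  refine (achieves_dft N.primeFactorsList (x := fun i => if hi : i < N then v ⟨i, hi⟩ else 0)
    (fun p hp => (Nat.prime_of_mem_primeFactorsList hp).one_le) ?_ fun i hi => ?_).bind
    fun y m₁ hm₁ hy => ?_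
  · rw [hprod, inv_pow, (isPrimitiveRoot_rootOfUnity hN).pow_eq_one, inv_one]
  · rw [hprod] at hi
    rw [dif_pos hi, dif_pos hi]
    exact hv _
  refine (achieves_lit (1 / (N : ℂ))).bind fun c m₂ hm₂ hc => ?_
  refine achieves_forFin_val fun j m hm => ?_
  refine (achieves_mul (hc.mono hm) ((hy j (by rw [hprod]; exact j.isLt)).mono
    (hm₂.trans hm))).mono le_rfl fun r m' _ hr => ?_
  rw [hprod, Finset.sum_range] at hr
  simpa using hr

/-- Fourier inversion: the sum over j of (ζ^(k-i))^j is N for i = k and 0 otherwise. -/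
theorem interp_eq {N : ℕ} {ζ : ℂ} (hζ : IsPrimitiveRoot ζ N) (hN : N ≠ 0) (v : Fin N → ℂ)
    (k : Fin N) :
    ∑ j : Fin N, (1 / (N : ℂ) * ∑ i : Fin N, v i * ζ⁻¹ ^ (i.val * j.val)) *
      (ζ ^ k.val) ^ j.val = v k := by
  have hN' : (N : ℂ) ≠ 0 := Nat.cast_ne_zero.2 hN
  have hζ0 : ζ ≠ 0 := hζ.ne_zero hN
  have h1 : ∀ i : Fin N, ∑ j : Fin N, (ζ⁻¹ ^ i.val * ζ ^ k.val) ^ j.val =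
      if i = k then (N : ℂ) else 0 := by
    intro i
    split_ifs with h
    · rw [h, ← mul_pow, inv_mul_cancel₀ hζ0]
      simp
    · have h2 : ζ⁻¹ ^ i.val * ζ ^ k.val ≠ 1 := by
        intro h2
        rw [inv_pow, inv_mul_eq_one₀ (pow_ne_zero _ hζ0)] at h2
        exact h (Fin.ext (hζ.pow_inj i.isLt k.isLt h2))
      have h3 : (ζ⁻¹ ^ i.val * ζ ^ k.val) ^ N = 1 := by
        rw [mul_pow, ← pow_mul, ← pow_mul, mul_comm _ N, mul_comm _ N, pow_mul, pow_mul, inv_pow,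
          hζ.pow_eq_one]
        simp
      have h4 := mul_geom_sum (ζ⁻¹ ^ i.val * ζ ^ k.val) N
      rw [h3, sub_self, Finset.sum_range] at h4
      exact (mul_eq_zero.1 h4).resolve_left (sub_ne_zero.2 h2)
  calc _ = 1 / (N : ℂ) * ∑ i : Fin N, v i * ∑ j : Fin N, (ζ⁻¹ ^ i.val * ζ ^ k.val) ^ j.val := by
        simp only [Finset.mul_sum, Finset.sum_mul]
        rw [Finset.sum_comm]
        refine Finset.sum_congr rfl fun i _ => Finset.sum_congr rfl fun j _ => ?_
        rw [mul_pow, ← pow_mul ζ⁻¹]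
        ring
    _ = v k := by
        simp only [h1]
        simp [field]

theorem computesInterp_interpRoutine : SimpleRR.ComputesInterp interpRoutine := by
  intro N v h mem hv
  rcases Nat.eq_zero_or_pos N with rfl | hN
  · exact ⟨fun i => i.elim0, fun i => i.elim0, fun i => i.elim0⟩
  · exact ⟨_, interp_eq (isPrimitiveRoot_rootOfUnity hN.ne') hN.ne' v,
      (achieves_interpRoutine (t := False) hN.ne' hv).post⟩

/-! ### Sums of prime factors -/

theorem List.sum_le_prod_of_two_le (l : List ℕ) (hl : ∀ p ∈ l, 2 ≤ p) : l.sum ≤ l.prod := by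
  induction l with
  | nil => simp
  | cons p l ih =>
    have hp := hl p (by simp)
    have ih := ih fun q hq => hl q (by simp [hq])
    rcases l with _ | ⟨q, l⟩
    · simp
    · have hq := hl q (by simp)
      have h2 : 2 ≤ (q :: l).prod := le_trans (by simp; omega) ih
      rw [List.sum_cons, List.prod_cons]
      nlinarith

theorem sum_primeFactorsList_le {n : ℕ} (hn : n ≠ 0) : n.primeFactorsList.sum ≤ n := by
  conv_rhs => rw [← Nat.prod_primeFactorsList hn]
  exact List.sum_le_prod_of_two_le _ fun p hp => (Nat.prime_of_mem_primeFactorsList hp).two_le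

theorem sum_primeFactorsList_mul {a b : ℕ} (ha : a ≠ 0) (hb : b ≠ 0) :
    (a * b).primeFactorsList.sum = a.primeFactorsList.sum + b.primeFactorsList.sum := by
  rw [(Nat.perm_primeFactorsList_mul ha hb).sum_eq, List.sum_append]

/-! ### The Hankel matrix of scaled moments -/

section scaledMoment

variable {R S : Type} [CommRing R] [CommRing S]

/-- The recursion of Newton's identities with cleared denominators. -/
def scaledMoment (n : ℕ) (u : Fin n → R) : ℕ → R
  | 0 => n
  | k + 1 => (∑ j : Fin n, if j.val < k then u j * scaledMoment n u (k - j.val) else 0) +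
      if h : k < n then ((k : R) + 1) * u ⟨k, h⟩ else 0
  decreasing_by omega

theorem scaledMoment_zero (n : ℕ) (u : Fin n → R) : scaledMoment n u 0 = n := by
  rw [scaledMoment]

theorem scaledMoment_succ (n : ℕ) (u : Fin n → R) (k : ℕ) : scaledMoment n u (k + 1) =
    (∑ j : Fin n, if j.val < k then u j * scaledMoment n u (k - j.val) else 0) +
      if h : k < n then ((k : R) + 1) * u ⟨k, h⟩ else 0 := by
  rw [scaledMoment]

/-- The recursion is free of division, so computing over ℝ[γ] and then evaluating agrees with
evaluating first, as the program does. -/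
theorem map_scaledMoment (f : R →+* S) (n : ℕ) (u : Fin n → R) (k : ℕ) :
    f (scaledMoment n u k) = scaledMoment n (fun j => f (u j)) k := by
  induction k using Nat.strong_induction_on with
  | _ k ih =>
    rcases k with _ | k
    · rw [scaledMoment_zero, scaledMoment_zero, map_natCast]
    · rw [scaledMoment_succ, scaledMoment_succ, map_add, map_sum]
      congr 1
      · refine Finset.sum_congr rfl fun j _ => ?_
        split_ifs
        · rw [map_mul, ih _ (by omega)]
        · rw [map_zero]
      · split_ifs
        · simp
        · rw [map_zero]

/-- The scaled Hankel matrix as a function of `c_0, …, c_n`. -/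
def hankelMat {n : ℕ} (c : Fin (n + 1) → R) : Matrix (Fin n) (Fin n) R :=
  Matrix.of fun a b => c 0 ^ (SimpleRR.nu n - (a.val + b.val)) *
    scaledMoment n (fun j => (-1) ^ j.val * c j.succ * c 0 ^ j.val) (a.val + b.val)

theorem hankelMat_map {n : ℕ} (f : R →+* S) (c : Fin (n + 1) → R) :
    (hankelMat c).map f = hankelMat fun k => f (c k) := by
  ext a b
  simp [hankelMat, map_scaledMoment]

/-- The sum of the principal minors of size `k`. -/
def minorSum {n : ℕ} (k : ℕ) (A : Matrix (Fin n) (Fin n) R) : R :=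
  ∑ s ∈ (Finset.univ : Finset (Fin n)).powersetCard k,
    (A.submatrix (fun i : s => (i : Fin n)) fun i : s => (i : Fin n)).det

theorem map_minorSum {n : ℕ} (f : R →+* S) (k : ℕ) (A : Matrix (Fin n) (Fin n) R) :
    f (minorSum k A) = minorSum k (A.map f) := by
  rw [minorSum, minorSum, map_sum]
  refine Finset.sum_congr rfl fun s _ => ?_
  rw [RingHom.map_det]
  rfl

theorem minorSum_eq_coeff {n : ℕ} (A : Matrix (Fin n) (Fin n) R) (k : Fin n) :
    (-1) ^ (k.val + 1) * A.charpoly.coeff (n - (k.val + 1)) = minorSum (k.val + 1) A := by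
  have h := A.charpoly_coeff_eq_sum_minors (k.val + 1) (by simp)
  rw [Fintype.card_fin] at h
  rw [h, ← mul_assoc, ← pow_add, Even.neg_one_pow ⟨_, rfl⟩, one_mul]
  rfl

end scaledMoment

/-! ### Degree bounds for the Hankel matrix and its minors -/

theorem natDegree_scaledMoment_le {n d : ℕ} {u : Fin n → ℝ[X]}
    (hu : ∀ j, (u j).natDegree ≤ d * (j.val + 1)) (k : ℕ) :
    (scaledMoment n u k).natDegree ≤ d * k := by
  induction k using Nat.strong_induction_on with
  | _ k ih =>
    rcases k with _ | k
    · simp [scaledMoment_zero]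
    · rw [scaledMoment_succ]
      refine natDegree_add_le_of_degree_le (natDegree_sum_le_of_forall_le _ _ fun j _ => ?_) ?_
      · split_ifs with h
        · refine natDegree_mul_le.trans ((add_le_add (hu j) (ih _ (by omega))).trans ?_)
          rw [← mul_add]
          exact Nat.mul_le_mul_left _ (by omega)
        · simp
      · split_ifs with h
        · refine natDegree_mul_le.trans ?_
          have h1 : ((k : ℝ[X]) + 1).natDegree = 0 := by exact_mod_cast natDegree_natCast (k + 1)
          rw [h1, zero_add]
          exact hu ⟨k, h⟩
        · simp

theorem SimpleRR.le_nu (n : ℕ) : n ≤ nu n := by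
  have := le_max_left ((n + 1) / 2) (n - 1)
  simp only [nu]
  omega

theorem SimpleRR.two_mul_sub_le_nu (n : ℕ) : 2 * n - 2 ≤ nu n := by
  have := le_max_right ((n + 1) / 2) (n - 1)
  simp only [nu]
  omega

theorem SimpleRR.nu_le (n : ℕ) : nu n ≤ 2 * n := by
  have : max ((n + 1) / 2) (n - 1) ≤ n := max_le (by omega) (by omega)
  simp only [nu]
  omega

/-- The factor c_0^(ν-(a+b)) contributes d(ν-(a+b)) and r_{a+b} contributes d(a+b). The exponent is
not truncated because a + b ≤ 2n - 2 ≤ ν. -/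
theorem natDegree_hankelMat_le {n d : ℕ} {c : Fin (n + 1) → ℝ[X]} (hc : ∀ k, (c k).natDegree ≤ d)
    (a b : Fin n) : (hankelMat c a b).natDegree ≤ d * SimpleRR.nu n := by
  have hν := SimpleRR.two_mul_sub_le_nu n
  rw [hankelMat, Matrix.of_apply]
  refine natDegree_mul_le.trans ?_
  have h1 : (c 0 ^ (SimpleRR.nu n - (a.val + b.val))).natDegree ≤
      d * (SimpleRR.nu n - (a.val + b.val)) := by
    refine natDegree_pow_le.trans ?_
    rw [mul_comm]
    exact Nat.mul_le_mul_right _ (hc 0)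
  have h2 := natDegree_scaledMoment_le (d := d)
    (u := fun j : Fin n => (-1) ^ j.val * c j.succ * c 0 ^ j.val) (fun j => ?_) (a.val + b.val)
  · refine (add_le_add h1 h2).trans ?_
    rw [← mul_add]
    exact Nat.mul_le_mul_left _ (by omega)
  · refine natDegree_mul_le.trans ?_
    have h3 : ((-1) ^ j.val * c j.succ).natDegree ≤ d := by
      refine natDegree_mul_le.trans ?_
      have : ((-1 : ℝ[X]) ^ j.val).natDegree = 0 := by
        rcases neg_one_pow_eq_or ℝ[X] j.val with h | h <;> simp [h]
      rw [this, zero_add]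
      exact hc _
    have h4 : (c 0 ^ j.val).natDegree ≤ d * j.val := by
      refine natDegree_pow_le.trans ?_
      rw [mul_comm]
      exact Nat.mul_le_mul_right _ (hc 0)
    calc _ ≤ d + d * j.val := add_le_add h3 h4
      _ = d * (j.val + 1) := by ring

theorem natDegree_det_le {ι : Type} [Fintype ι] [DecidableEq ι] {A : Matrix ι ι ℝ[X]} {e : ℕ}
    (hA : ∀ i j, (A i j).natDegree ≤ e) : A.det.natDegree ≤ Fintype.card ι * e := by
  rw [Matrix.det_apply]
  refine natDegree_sum_le_of_forall_le _ _ fun σ _ => ?_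
  refine (natDegree_smul_le _ _).trans ((natDegree_prod_le _ _).trans ?_)
  refine (Finset.sum_le_card_nsmul _ _ e fun i _ => hA _ _).trans ?_
  simp

theorem natDegree_minorSum_le {n d : ℕ} {c : Fin (n + 1) → ℝ[X]} (hc : ∀ k, (c k).natDegree ≤ d)
    (k : Fin n) : (minorSum (k.val + 1) (hankelMat c)).natDegree ≤ n * (d * SimpleRR.nu n) := by
  refine natDegree_sum_le_of_forall_le _ _ fun s hs => ?_
  refine (natDegree_det_le fun i j => natDegree_hankelMat_le hc _ _).trans ?_
  rw [Fintype.card_coe, (Finset.mem_powersetCard.1 hs).2]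
  exact Nat.mul_le_mul_right _ k.isLt

/-- The factor d + 1 in N, together with ν ≥ n > 0, gives the strict inequality that unique
interpolation needs, also for d = 0. -/
theorem natDegree_minorSum_lt_numPoints {n d : ℕ} {c : Fin (n + 1) → ℝ[X]}
    (hc : ∀ k, (c k).natDegree ≤ d) (k : Fin n) :
    (minorSum (k.val + 1) (hankelMat c)).natDegree < SimpleRR.numPoints n d := by
  refine (natDegree_minorSum_le hc k).trans_lt ?_
  have hn : 0 < n := k.pos
  have hν := SimpleRR.le_nu n
  rw [SimpleRR.numPoints, mul_assoc]
  refine Nat.mul_lt_mul_of_pos_left ?_ hn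
  calc d * SimpleRR.nu n < (d + 1) * SimpleRR.nu n :=
        Nat.mul_lt_mul_of_pos_right (Nat.lt_succ_self d) (by omega)
    _ ≤ _ := Nat.mul_le_mul_left _ (by omega)

/-! ### Correctness and cost of the main loop -/

section loop

variable {t : Prop} {mem : List ℂ}

theorem List.sum_map_filter_eq {X : Type} (l : List X) (p : X → Prop) [DecidablePred p]
    (f : X → ℂ) :
    ((l.filter fun x => p x).map f).sum = (l.map fun x => if p x then f x else 0).sum := by
  induction l with
  | nil => simp
  | cons a l ih => by_cases h : p a <;> simp [h, ih]

theorem achieves_scaledMoments {n : ℕ} {u : Fin n → ℕ} {x : Fin n → ℂ}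
    (hu : ∀ j, HasVal mem (u j) (x j)) (k : ℕ) :
    Achieves t (SimpleRR.scaledMoments n u k) mem (1 + k * (2 * n + 4)) fun r m =>
      r.length = k + 1 ∧ ∀ j ≤ k, HasVal m (r.getD j 0) (scaledMoment n x j) := by
  induction k with
  | zero =>
    refine Achieves.mono_cost (c := 1 + 0) ?_ (by simp)
    refine (achieves_lit _).bind fun h m _ hh => achieves_pure ⟨rfl, fun j hj => ?_⟩
    obtain rfl : j = 0 := by omega
    rw [scaledMoment_zero]
    simpa using hh
  | succ k ih =>
    refine Achieves.mono_cost (c := (1 + k * (2 * n + 4)) + ((2 * n + 1) + (3 + 0))) ?_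
      (by push_cast; linarith)
    refine ih.bind fun r m₁ hm₁ ⟨hlen, hr⟩ => ?_
    refine Achieves.bind (Q := fun s m => HasVal m s
      (∑ j : Fin n, if j.val < k then x j * scaledMoment n x (k - j.val) else 0))
      ((achieves_dot _ (x := x) (y := fun j => scaledMoment n x (k - j.val))
        (fun j _ => (hu j).mono hm₁) fun j hj => hr _ (by omega)).mono ?_ fun s m _ hs => ?_)
      fun s m₂ hm₂ hs => ?_
    · have h1 : ((List.finRange n).filter fun j => j.val < k).length ≤ n :=
        (List.length_filter_le _ _).trans_eq (by simp)
      have h2 : ((((List.finRange n).filter fun j => j.val < k).length : ℕ) : ℝ) ≤ n := by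
        exact_mod_cast h1
      linarith
    · rwa [List.sum_map_filter_eq, ← List.ofFn_eq_map, List.sum_ofFn] at hs
    -- The last instruction is common to the two branches k < n and k ≥ n.
    have hfin : ∀ y m₃, m₂ <+: m₃ → HasVal m₃ y (scaledMoment n x (k + 1)) →
        Achieves t (pure (r ++ [y])) m₃ 0 fun r m => r.length = k + 1 + 1 ∧
          ∀ j ≤ k + 1, HasVal m (r.getD j 0) (scaledMoment n x j) := by
      refine fun y m₃ hm₃ hy => achieves_pure ⟨by simp [hlen], fun j hj => ?_⟩
      rcases Nat.lt_or_ge j (k + 1) with h | h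
      · rw [List.getD_append _ _ _ _ (by omega)]
        exact (hr j (by omega)).mono (hm₂.trans hm₃)
      · obtain rfl : j = k + 1 := by omega
        rw [List.getD_append_right _ _ _ _ (by omega), hlen]
        simpa using hy
    rw [scaledMoment_succ] at hfin
    dsimp only
    split_ifs with h
    · rw [dif_pos h] at hfin
      refine Achieves.mono_cost (c := 1 + (1 + (1 + 0))) ?_ (by norm_num)
      refine (achieves_lit _).bind fun a m hm ha => ?_
      refine (achieves_mul ha ((hu ⟨k, h⟩).mono ((hm₁.trans hm₂).trans hm))).bind
        fun w m' hm' hw => ?_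
      exact (achieves_add ((hs.mono hm).mono hm') hw).bind fun y m'' hm'' hy =>
        hfin y m'' ((hm.trans hm').trans hm'') hy
    · rw [dif_neg h, add_zero] at hfin
      refine Achieves.mono_cost (c := 0 + 0) ?_ (by norm_num)
      exact (achieves_pure hs).bind fun y m'' hm'' hy => hfin y m'' hm'' hy

/-- A bound for the cost of the Hankel matrix at one sample point. -/
def hankelCost (n d : ℕ) : ℝ :=
  1 + ((n + 1 : ℕ) * (2 * (d + 1 : ℕ) + 1) + ((SimpleRR.nu n + 1) + (n * 3 +
    ((1 + (2 * n - 2 : ℕ) * (2 * n + 4)) + ((2 * n - 1 : ℕ) * 1 + 0)))))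

theorem achieves_hankelProg {n d : ℕ} {h : Fin (n + 1) → Fin (d + 1) → ℕ}
    {a : Fin (n + 1) → Fin (d + 1) → ℂ} (ha : ∀ k j, HasVal mem (h k j) (a k j)) (s : ℂ) :
    Achieves t (SimpleRR.hankelProg n d h s) mem (hankelCost n d) fun H m =>
      RegMat m H (hankelMat fun k => ∑ j, a k j * s ^ j.val) := by
  set c : Fin (n + 1) → ℂ := fun k => ∑ j, a k j * s ^ j.val with hc
  have hν := SimpleRR.le_nu n
  have hν2 := SimpleRR.two_mul_sub_le_nu n
  refine (achieves_lit s).bind fun x m₁ hm₁ hx => ?_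
  refine (achieves_forFin_val (v := c) fun k m hm => achieves_horner_ofFn (hx.mono hm)
    fun j => (ha k j).mono (hm₁.trans hm)).bind fun cv m₂ hm₂ hcv => ?_
  refine (achieves_powers (hcv 0) (SimpleRR.nu n)).bind fun pw m₃ hm₃ ⟨_, hpw⟩ => ?_
  refine (achieves_forFin_val (v := fun j : Fin n => (-1) ^ j.val * c j.succ * c 0 ^ j.val)
    fun j m hm => ?_).bind fun u m₄ hm₄ hu => ?_
  · refine Achieves.mono_cost (c := 1 + (1 + 1)) ?_ (by norm_num)
    refine (achieves_lit _).bind fun sg m' hm' hsg => ?_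
    refine (achieves_mul hsg ((hcv j.succ).mono ((hm₃.trans hm).trans hm'))).bind
      fun w m'' hm'' hw => ?_
    exact achieves_mul hw ((hpw j.val (by omega)).mono ((hm.trans hm').trans hm''))
  refine (achieves_scaledMoments hu (2 * n - 2)).bind fun r m₅ hm₅ ⟨_, hr⟩ => ?_
  refine (achieves_forFin_val (v := fun j : Fin (2 * n - 1) => c 0 ^ (SimpleRR.nu n - j.val) *
    scaledMoment n (fun j => (-1) ^ j.val * c j.succ * c 0 ^ j.val) j.val) fun j m hm => ?_).bind
      fun h m hm hh => achieves_pure fun i j => hh _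
  exact achieves_mul ((hpw _ (by omega)).mono ((hm₄.trans hm₅).trans hm))
    ((hr j.val (by omega)).mono hm)

variable {charpolyR : SimpleRR.CharpolyRoutine ℂ} {interpR : SimpleRR.InterpRoutine ℂ} {n d : ℕ}
  {T T' : ℝ}

theorem achieves_sampleProg
    (hR : ∀ (A : Matrix (Fin n) (Fin n) ℂ) (h : Fin n → Fin n → ℕ) (mem : List ℂ),
      RegMat mem h A → Achieves t (charpolyR n h) mem T fun f m =>
        ∀ j, HasVal m (f j) (A.charpoly.coeff j))
    {h : Fin (n + 1) → Fin (d + 1) → ℕ} {a : Fin (n + 1) → Fin (d + 1) → ℂ}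
    (ha : ∀ k j, HasVal mem (h k j) (a k j)) (s : ℂ) :
    Achieves t (SimpleRR.sampleProg charpolyR n d h s) mem (hankelCost n d + (T + n * 2))
      fun e m => ∀ k : Fin n, HasVal m (e k)
        (minorSum (k.val + 1) (hankelMat fun k => ∑ j, a k j * s ^ j.val)) := by
  refine (achieves_hankelProg ha s).bind fun H m₁ hm₁ hH => ?_
  refine (hR _ _ _ hH).bind fun f m₂ hm₂ hf => ?_
  refine achieves_forFin_val fun k m hm => ?_
  refine Achieves.mono_cost (c := 1 + 1) ?_ (by norm_num)
  refine (achieves_lit _).bind fun sg m' hm' hsg => ?_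
  rw [← minorSum_eq_coeff]
  exact achieves_mul hsg ((hf _).mono (hm.trans hm'))

theorem achieves_progWith {N : ℕ} {ζ : ℂ}
    (hR : ∀ (A : Matrix (Fin n) (Fin n) ℂ) (h : Fin n → Fin n → ℕ) (mem : List ℂ),
      RegMat mem h A → Achieves t (charpolyR n h) mem T fun f m =>
        ∀ j, HasVal m (f j) (A.charpoly.coeff j))
    (hI : ∀ (v : Fin N → ℂ) (h : Fin N → ℕ) (mem : List ℂ), (∀ i, HasVal mem (h i) (v i)) →
      Achieves t (interpR N h) mem T' fun f m => ∃ b : Fin N → ℂ,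
        (∀ i : Fin N, ∑ j : Fin N, b j * (ζ ^ i.val) ^ j.val = v i) ∧ ∀ j, HasVal m (f j) (b j))
    {h : Fin (n + 1) → Fin (d + 1) → ℕ} {a : Fin (n + 1) → Fin (d + 1) → ℂ}
    (ha : ∀ k j, HasVal mem (h k j) (a k j)) :
    Achieves t (SimpleRR.progWith charpolyR interpR N ζ n d h) mem
      (N * (hankelCost n d + (T + n * 2)) + n * T')
      fun f m => ∀ k : Fin n, ∃ b : Fin N → ℂ, (∀ i : Fin N, ∑ j : Fin N, b j *
        (ζ ^ i.val) ^ j.val = minorSum (k.val + 1)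
          (hankelMat fun k => ∑ j, a k j * (ζ ^ i.val) ^ j.val)) ∧ ∀ j, HasVal m (f k j) (b j) := by
  refine (achieves_forFin (Q := fun (i : Fin N) (e : Fin n → ℕ) m => ∀ k : Fin n, HasVal m (e k)
    (minorSum (k.val + 1) (hankelMat fun k => ∑ j, a k j * (ζ ^ i.val) ^ j.val)))
    (fun i e m m' hm h k => (h k).mono hm) fun i m hm => achieves_sampleProg hR
      (fun k j => (ha k j).mono hm) _).bind fun e m₁ hm₁ he => ?_
  refine achieves_forFin (fun k f m m' hm ⟨b, hb, hf⟩ => ⟨b, hb, fun j => (hf j).mono hm⟩)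
    fun k m hm => hI _ _ _ fun i => (he i k).mono hm

end loop

/-! ### Hermite's criterion for real-rootedness -/

section roots

variable {n : ℕ}

/-- `∑ (-1)^k v_k x^(n-k)`. -/
noncomputable def altPoly (v : Fin (n + 1) → ℝ) : ℝ[X] :=
  ∑ k : Fin (n + 1), C ((-1) ^ k.val * v k) * X ^ (n - k.val)

theorem altPoly_coeff (v : Fin (n + 1) → ℝ) (k : Fin (n + 1)) :
    (altPoly v).coeff (n - k.val) = (-1) ^ k.val * v k := by
  rw [altPoly, finsetSum_coeff, Finset.sum_eq_single k]
  · rw [coeff_C_mul_X_pow, if_pos rfl]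
  · intro j _ hj
    rw [coeff_C_mul_X_pow, if_neg]
    intro h
    exact hj (Fin.ext (by omega))
  · simp

theorem altPoly_natDegree_le (v : Fin (n + 1) → ℝ) : (altPoly v).natDegree ≤ n :=
  natDegree_sum_le_of_forall_le _ _ fun _ _ => (natDegree_C_mul_X_pow_le _ _).trans (Nat.sub_le _ _)

theorem altPoly_natDegree {v : Fin (n + 1) → ℝ} (hv : v 0 ≠ 0) : (altPoly v).natDegree = n := by
  refine le_antisymm (altPoly_natDegree_le v) (le_natDegree_of_ne_zero ?_)
  have := altPoly_coeff v 0
  simp only [Fin.val_zero, Nat.sub_zero, pow_zero, one_mul] at this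
  rwa [this]

theorem altPoly_leadingCoeff {v : Fin (n + 1) → ℝ} (hv : v 0 ≠ 0) :
    (altPoly v).leadingCoeff = v 0 := by
  have := altPoly_coeff v 0
  simp only [Fin.val_zero, Nat.sub_zero, pow_zero, one_mul] at this
  rw [leadingCoeff, altPoly_natDegree hv, this]

theorem exists_aroots_eq {v : Fin (n + 1) → ℝ} (hv : v 0 ≠ 0) :
    ∃ x : Fin n → ℂ, (altPoly v).aroots ℂ = Finset.univ.val.map x := by
  have hcard : Multiset.card ((altPoly v).aroots ℂ) = n := by
    rw [IsAlgClosed.card_aroots_eq_natDegree, altPoly_natDegree hv]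
  generalize (altPoly v).aroots ℂ = s at hcard
  subst hcard
  induction s using Quotient.inductionOn with
  | _ l =>
    refine ⟨fun i => l.get i, ?_⟩
    have h : (Finset.univ : Finset (Fin l.length)).val.map (fun i => l.get i) =
        ((List.finRange l.length).map l.get : Multiset ℂ) := rfl
    exact (h.trans (congrArg _ (List.map_get_finRange l))).symm

variable {v : Fin (n + 1) → ℝ} {x : Fin n → ℂ}

/-- Vieta's formulas; the alternating signs in the family cancel those of the elementary symmetric
functions. -/
theorem coe_eq_mul_esymm (hv : v 0 ≠ 0) (hx : (altPoly v).aroots ℂ = Finset.univ.val.map x)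
    (k : Fin (n + 1)) :
    ((v k : ℝ) : ℂ) = (v 0 : ℂ) * MvPolynomial.aeval x (MvPolynomial.esymm (Fin n) ℂ k.val) := by
  set P := (altPoly v).map (algebraMap ℝ ℂ) with hP
  have hdeg : P.natDegree = n := by
    rw [hP, natDegree_map, altPoly_natDegree hv]
  have hroots : P.roots = Finset.univ.val.map x := hx
  have h := P.coeff_eq_esymm_roots_of_card (by rw [hroots, hdeg]; simp) (k := n - k.val)
    (by rw [hdeg]; omega)
  have hlc : P.leadingCoeff = (v 0 : ℂ) := by
    rw [hP, leadingCoeff_map, altPoly_leadingCoeff hv]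
    rfl
  rw [hdeg, hlc, Nat.sub_sub_self (by omega), hroots, hP, coeff_map, altPoly_coeff] at h
  rw [MvPolynomial.aeval_esymm_eq_multiset_esymm]
  have h1 : ((-1 : ℂ)) ^ k.val * (v k : ℂ) =
      (v 0 : ℂ) * (-1) ^ k.val * (Finset.univ.val.map x).esymm k.val := by
    simpa using h
  have h2 : ((-1 : ℂ)) ^ k.val ≠ 0 := pow_ne_zero _ (by norm_num)
  refine mul_left_cancel₀ h2 (h1.trans ?_)
  ring

theorem newton_power_sums (x : Fin n → ℂ) (k : ℕ) :
    ∑ i, x i ^ (k + 1) = (∑ j ∈ Finset.range k, (-1) ^ j *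
      MvPolynomial.aeval x (MvPolynomial.esymm (Fin n) ℂ (j + 1)) * ∑ i, x i ^ (k - j)) +
      (-1) ^ k * (k + 1) * MvPolynomial.aeval x (MvPolynomial.esymm (Fin n) ℂ (k + 1)) := by
  have h := congrArg (MvPolynomial.aeval x)
    (MvPolynomial.psum_eq_mul_esymm_sub_sum (Fin n) ℂ (k + 1) (Nat.succ_pos k))
  have hp : ∀ j, MvPolynomial.aeval x (MvPolynomial.psum (Fin n) ℂ j) = ∑ i, x i ^ j := by
    intro j
    simp [MvPolynomial.psum]
  rw [Finset.sum_filter, Finset.Nat.sum_antidiagonal_eq_sum_range_succ_mk,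
    Finset.sum_range_succ, Finset.sum_range_succ'] at h
  simp only [map_sub, map_mul, map_sum, hp, map_pow, map_neg, map_one, map_natCast,
    Set.mem_Ioo, lt_self_iff_false, and_false, if_false, false_and, add_zero] at h
  have hs : ∑ j ∈ Finset.range k, (MvPolynomial.aeval x)
      (if 0 < j + 1 ∧ j + 1 < k + 1 then (-1) ^ (j + 1) * MvPolynomial.esymm (Fin n) ℂ (j + 1) *
        MvPolynomial.psum (Fin n) ℂ (k + 1 - (j + 1)) else 0) =
      -∑ j ∈ Finset.range k, (-1) ^ j *
        MvPolynomial.aeval x (MvPolynomial.esymm (Fin n) ℂ (j + 1)) * ∑ i, x i ^ (k - j) := by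
    rw [← Finset.sum_neg_distrib]
    refine Finset.sum_congr rfl fun j hj => ?_
    have hj := Finset.mem_range.1 hj
    rw [if_pos ⟨by omega, by omega⟩, Nat.add_sub_add_right]
    simp only [map_mul, map_pow, map_neg, map_one, hp]
    ring
  rw [hs] at h
  rw [h]
  push_cast
  ring

theorem aeval_esymm_eq_zero (x : Fin n → ℂ) {k : ℕ} (hk : n < k) :
    MvPolynomial.aeval x (MvPolynomial.esymm (Fin n) ℂ k) = 0 := by
  rw [MvPolynomial.esymm, Finset.powersetCard_eq_empty.2 (by simpa using hk)]
  simp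

/-- Multiply Newton's identity by c_0^(k+1) and absorb one factor c_0 into each e_{j+1}, which
Vieta's formulas turn into c_{j+1}. -/
theorem scaledMoment_eq (hv : v 0 ≠ 0) (hx : (altPoly v).aroots ℂ = Finset.univ.val.map x)
    (k : ℕ) :
    scaledMoment n (fun j => (-1) ^ j.val * (v j.succ : ℂ) * (v 0 : ℂ) ^ j.val) k =
      (v 0 : ℂ) ^ k * ∑ i, x i ^ k := by
  induction k using Nat.strong_induction_on with
  | _ k ih =>
    rcases k with _ | k
    · simp [scaledMoment_zero]
    · rw [scaledMoment_succ, newton_power_sums, mul_add]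
      congr 1
      -- Newton's sum runs over j < k and the recursion over j < n; the terms with j ≥ n vanish with
      -- e_{j+1}.
      · have h1 : ∀ j : ℕ, j ∈ Finset.range k → n ≤ j → (-1) ^ j *
            MvPolynomial.aeval x (MvPolynomial.esymm (Fin n) ℂ (j + 1)) * ∑ i, x i ^ (k - j) =
              0 := fun j _ hj => by
          rw [aeval_esymm_eq_zero x (by omega)]; ring
        have h2 : ∑ j ∈ Finset.range k, (-1) ^ j *
            MvPolynomial.aeval x (MvPolynomial.esymm (Fin n) ℂ (j + 1)) * ∑ i, x i ^ (k - j) =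
            ∑ j : Fin n, if j.val < k then (-1) ^ j.val * MvPolynomial.aeval x
              (MvPolynomial.esymm (Fin n) ℂ (j.val + 1)) * ∑ i, x i ^ (k - j.val) else 0 := by
          rw [Fin.sum_univ_eq_sum_range (fun j : ℕ => if j < k then (-1) ^ j *
            MvPolynomial.aeval x (MvPolynomial.esymm (Fin n) ℂ (j + 1)) * ∑ i, x i ^ (k - j)
              else 0) n, ← Finset.sum_filter]
          refine (Finset.sum_subset (fun j hj => ?_) fun j hj hj' => h1 j hj ?_).symm
          · exact Finset.mem_range.2 (Finset.mem_filter.1 hj).2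
          · simp only [Finset.mem_filter, Finset.mem_range, not_and] at hj' hj
            by_contra! hlt
            exact hj' hlt hj
        rw [h2, Finset.mul_sum]
        refine Finset.sum_congr rfl fun j _ => ?_
        split_ifs with hj
        · rw [ih _ (by omega), coe_eq_mul_esymm hv hx j.succ, Fin.val_succ]
          have h3 : (v 0 : ℂ) ^ (k + 1) = v 0 * v 0 ^ j.val * v 0 ^ (k - j.val) := by
            rw [← pow_succ', ← pow_add]
            congr 1
            omega
          rw [h3]
          ring
        · rw [mul_zero]
      · split_ifs with h
        · rw [coe_eq_mul_esymm hv hx (Fin.succ ⟨k, h⟩), Fin.val_succ]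
          ring
        · rw [aeval_esymm_eq_zero x (by omega)]
          ring

theorem coe_hankelMat (hv : v 0 ≠ 0) (hx : (altPoly v).aroots ℂ = Finset.univ.val.map x)
    (a b : Fin n) :
    ((hankelMat v a b : ℝ) : ℂ) = (v 0 : ℂ) ^ SimpleRR.nu n * ∑ i, x i ^ (a.val + b.val) := by
  have h1 : ((hankelMat v a b : ℝ) : ℂ) = hankelMat (fun k => (v k : ℂ)) a b := by
    have := congrFun (congrFun (hankelMat_map Complex.ofRealHom v) a) b
    simpa using this
  have hν := SimpleRR.two_mul_sub_le_nu n
  rw [h1, hankelMat, Matrix.of_apply, scaledMoment_eq hv hx, ← mul_assoc, ← pow_add,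
    Nat.sub_add_cancel (by omega)]

theorem aeval_altPoly (hv : v 0 ≠ 0) (hx : (altPoly v).aroots ℂ = Finset.univ.val.map x) (z : ℂ) :
    aeval z (altPoly v) = (v 0 : ℂ) * ∏ i, (z - x i) := by
  have h1 := (IsAlgClosed.splits ((altPoly v).map (algebraMap ℝ ℂ))).eq_prod_roots
  have hroots : ((altPoly v).map (algebraMap ℝ ℂ)).roots = Finset.univ.val.map x := hx
  rw [hroots, leadingCoeff_map, altPoly_leadingCoeff hv, Multiset.map_map] at h1
  rw [← eval_map_algebraMap, h1, eval_mul, eval_C, eval_multiset_prod, Multiset.map_map]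
  congr 1
  simp [Finset.prod]

theorem realRooted_altPoly_iff (hv : v 0 ≠ 0)
    (hx : (altPoly v).aroots ℂ = Finset.univ.val.map x) :
    RealRooted (altPoly v) ↔ ∀ i, (x i).im = 0 := by
  have h0 : altPoly v ≠ 0 := fun h => hv (by rw [← altPoly_leadingCoeff hv, h, leadingCoeff_zero])
  have hv' : (v 0 : ℂ) ≠ 0 := by exact_mod_cast hv
  rw [RealRooted, or_iff_right h0]
  simp only [aeval_altPoly hv hx, mul_eq_zero, hv', false_or, Finset.prod_eq_zero_iff,
    Finset.mem_univ, true_and, sub_eq_zero]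
  exact ⟨fun h i => h _ ⟨i, rfl⟩, fun h z ⟨i, hi⟩ => hi ▸ h i⟩

/-- The Hankel matrix is c_0^ν VᵀV for the Vandermonde matrix V of the roots, with the plain
transpose, so the squares are complex and not absolute squares. -/
theorem coe_quadratic_form (hv : v 0 ≠ 0)
    (hx : (altPoly v).aroots ℂ = Finset.univ.val.map x) (y : Fin n → ℝ) :
    ((y ⬝ᵥ (hankelMat v).mulVec y : ℝ) : ℂ) =
      (v 0 : ℂ) ^ SimpleRR.nu n * ∑ i, (∑ a : Fin n, (y a : ℂ) * x i ^ a.val) ^ 2 := by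
  have h : ∀ i, (∑ a : Fin n, (y a : ℂ) * x i ^ a.val) ^ 2 =
      ∑ a : Fin n, ∑ b : Fin n, (y a : ℂ) * y b * x i ^ (a.val + b.val) := fun i => by
    rw [sq, Finset.sum_mul_sum]
    refine Finset.sum_congr rfl fun a _ => Finset.sum_congr rfl fun b _ => ?_
    rw [pow_add]
    ring
  simp only [h]
  rw [Finset.sum_comm, Finset.mul_sum]
  simp only [dotProduct, Matrix.mulVec, Complex.ofReal_sum, Complex.ofReal_mul]
  refine Finset.sum_congr rfl fun a _ => ?_
  rw [Finset.sum_comm, Finset.mul_sum, Finset.mul_sum]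
  refine Finset.sum_congr rfl fun b _ => ?_
  rw [coe_hankelMat hv hx, ← Finset.mul_sum]
  ring

end roots

/-! ### Positivity of the Hankel form and real roots -/

section hermite

variable {n : ℕ} {v : Fin (n + 1) → ℝ} {x : Fin n → ℂ}

theorem hankelMat_isHermitian (v : Fin (n + 1) → ℝ) : (hankelMat v).IsHermitian := by
  refine Matrix.IsHermitian.ext fun i j => ?_
  simp only [hankelMat, Matrix.of_apply, star_trivial, add_comm]

theorem pow_nu_pos (n : ℕ) {r : ℝ} (hr : r ≠ 0) : 0 < r ^ SimpleRR.nu n :=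
  (even_two_mul _).pow_pos hr

theorem posSemidef_hankelMat (hv : v 0 ≠ 0) (h : RealRooted (altPoly v)) :
    (hankelMat v).PosSemidef := by
  obtain ⟨x, hx⟩ := exists_aroots_eq hv
  have hre : ∀ i, x i = ((x i).re : ℂ) := fun i =>
    Complex.ext rfl ((realRooted_altPoly_iff hv hx).1 h i)
  refine .of_dotProduct_mulVec_nonneg (hankelMat_isHermitian v) fun y => ?_
  rw [star_trivial]
  have hq : y ⬝ᵥ (hankelMat v).mulVec y =
      v 0 ^ SimpleRR.nu n * ∑ i, (∑ a : Fin n, y a * (x i).re ^ a.val) ^ 2 := by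
    apply Complex.ofReal_injective
    rw [coe_quadratic_form hv hx]
    push_cast
    simp only [← hre]
  rw [hq]
  exact mul_nonneg (pow_nu_pos n hv).le (Finset.sum_nonneg fun i _ => sq_nonneg _)

theorem exists_index_conj (hv : v 0 ≠ 0) (hx : (altPoly v).aroots ℂ = Finset.univ.val.map x)
    (i : Fin n) : ∃ j, x j = (starRingEnd ℂ) (x i) := by
  have hv' : (v 0 : ℂ) ≠ 0 := by exact_mod_cast hv
  have h0 : aeval (x i) (altPoly v) = 0 := by
    rw [aeval_altPoly hv hx, Finset.prod_eq_zero (Finset.mem_univ i) (sub_self _), mul_zero]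
  have h1 : aeval ((starRingEnd ℂ) (x i)) (altPoly v) = 0 := by
    rw [aeval_conj, h0, map_zero]
  rw [aeval_altPoly hv hx, mul_eq_zero, or_iff_right hv', Finset.prod_eq_zero_iff] at h1
  obtain ⟨j, -, hj⟩ := h1
  exact ⟨j, (sub_eq_zero.1 hj).symm⟩

/-- A conjugation invariant function on the roots is a real polynomial of degree less than `n`. -/
theorem exists_real_interpolant (hv : v 0 ≠ 0)
    (hx : (altPoly v).aroots ℂ = Finset.univ.val.map x) (φ : ℂ → ℂ)
    (hφ : ∀ z, φ ((starRingEnd ℂ) z) = (starRingEnd ℂ) (φ z)) :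
    ∃ y : Fin n → ℝ, ∀ i, ∑ a : Fin n, (y a : ℂ) * x i ^ a.val = φ (x i) := by
  classical
  set s : Finset ℂ := Finset.univ.image x with hs
  set g : ℂ[X] := Lagrange.interpolate s id φ with hg
  have hinj : Set.InjOn (id : ℂ → ℂ) s := Function.injective_id.injOn
  have hcard : s.card ≤ n := by simpa using Finset.card_image_le (s := Finset.univ) (f := x)
  have hdeg : g.degree < n :=
    (Lagrange.degree_interpolate_lt φ hinj).trans_le (by exact_mod_cast hcard)
  have hsum : ∀ z, ∑ a : Fin n, g.coeff a.val * z ^ a.val = g.eval z := fun z => by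
    rw [Fin.sum_univ_eq_sum_range (fun a => g.coeff a * z ^ a) n]
    rcases eq_or_ne g 0 with h0 | h0
    · simp [h0]
    · exact (eval_eq_sum_range' ((natDegree_lt_iff_degree_lt h0).2 hdeg) z).symm
  have hval : ∀ i, g.eval (x i) = φ (x i) := fun i =>
    Lagrange.eval_interpolate_at_node φ hinj (Finset.mem_image_of_mem x (Finset.mem_univ i))
  -- Lagrange interpolation on the distinct roots gives a complex g. The polynomial with conjugate
  -- coefficients interpolates φ too, as φ and the set of roots are conjugation invariant, hence so
  -- does the average of the two.
  refine ⟨fun a => (g.coeff a.val).re, fun i => ?_⟩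
  obtain ⟨j, hj⟩ := exists_index_conj hv hx i
  have h1 : ∑ a : Fin n, (starRingEnd ℂ) (g.coeff a.val) * x i ^ a.val = φ (x i) := by
    have := congrArg (starRingEnd ℂ) ((hsum (x j)).trans (hval j))
    rw [hj, hφ, Complex.conj_conj, map_sum] at this
    simpa using this
  have h2 := (hsum (x i)).trans (hval i)
  have h3 : ∀ a : Fin n, (((g.coeff a.val).re : ℝ) : ℂ) * x i ^ a.val =
      (g.coeff a.val * x i ^ a.val + (starRingEnd ℂ) (g.coeff a.val) * x i ^ a.val) / 2 := by
    intro a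
    rw [← add_mul, Complex.add_conj]
    push_cast
    ring
  simp only [h3]
  rw [← Finset.sum_div, Finset.sum_add_distrib, h1, h2]
  ring

/-- If a root w is not real, a real test polynomial with value i at w, -i at the conjugate of w and
0 at all other roots makes the form equal to -c_0^ν times the number of indices i with x_i equal to
w or its conjugate. -/
theorem realRooted_of_posSemidef (hv : v 0 ≠ 0) (h : (hankelMat v).PosSemidef) :
    RealRooted (altPoly v) := by
  classical
  obtain ⟨x, hx⟩ := exists_aroots_eq hv
  rw [realRooted_altPoly_iff hv hx]
  by_contra! hne
  obtain ⟨i₀, hi₀⟩ := hne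
  set w := x i₀
  have hw : w ≠ (starRingEnd ℂ) w := fun h => hi₀ (Complex.conj_eq_iff_im.1 h.symm)
  set φ : ℂ → ℂ := fun z => if z = w then Complex.I else
    if z = (starRingEnd ℂ) w then -Complex.I else 0 with hφdef
  have hφ : ∀ z, φ ((starRingEnd ℂ) z) = (starRingEnd ℂ) (φ z) := by
    intro z
    simp only [hφdef]
    have e1 : (starRingEnd ℂ) z = w ↔ z = (starRingEnd ℂ) w :=
      ⟨fun h => by rw [← h, Complex.conj_conj], fun h => by rw [h, Complex.conj_conj]⟩
    have e2 : (starRingEnd ℂ) z = (starRingEnd ℂ) w ↔ z = w := (starRingEnd ℂ).injective.eq_iff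
    simp only [e1, e2]
    by_cases h1 : z = w
    · rw [if_neg (h1 ▸ hw), if_pos h1, if_pos h1, Complex.conj_I]
    · by_cases h2 : z = (starRingEnd ℂ) w
      · rw [if_pos h2, if_neg h1, if_pos h2, map_neg, Complex.conj_I, neg_neg]
      · simp [h1, h2]
  obtain ⟨y, hy⟩ := exists_real_interpolant hv hx φ hφ
  have hsq : ∀ z, φ z ^ 2 = (((if z = w ∨ z = (starRingEnd ℂ) w then -1 else 0 : ℝ)) : ℂ) := by
    intro z
    simp only [hφdef]
    by_cases h1 : z = w
    · simp [h1]
    · by_cases h2 : z = (starRingEnd ℂ) w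
      · rw [if_neg h1, if_pos h2, if_pos (Or.inr h2)]
        simp
      · simp [h1, h2]
  have hq : y ⬝ᵥ (hankelMat v).mulVec y = v 0 ^ SimpleRR.nu n *
      ∑ i, if x i = w ∨ x i = (starRingEnd ℂ) w then (-1 : ℝ) else 0 := by
    apply Complex.ofReal_injective
    rw [coe_quadratic_form hv hx]
    simp only [hy, hsq]
    push_cast
    rfl
  have hpos := h.dotProduct_mulVec_nonneg y
  rw [star_trivial, hq] at hpos
  refine absurd (nonneg_of_mul_nonneg_right hpos (pow_nu_pos n hv)) (not_le.2 ?_)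
  refine Finset.sum_neg' (fun i _ => ?_) ⟨i₀, Finset.mem_univ _, ?_⟩
  · split_ifs <;> norm_num
  · rw [if_pos (Or.inl rfl)]
    norm_num

end hermite

/-- For l < 0 the value (-1)^n χ(l) is the sum of the e_{n-j} (-l)^j, with positive term (-l)^n. If
all e_k are nonnegative, no negative l can be an eigenvalue. -/
theorem posSemidef_iff_minorSum_nonneg {n : ℕ} {A : Matrix (Fin n) (Fin n) ℝ}
    (hA : A.IsHermitian) : A.PosSemidef ↔ ∀ k : Fin n, 0 ≤ minorSum (k.val + 1) A := by
  refine ⟨fun h k => Finset.sum_nonneg fun S _ => (h.submatrix _).det_nonneg, fun h => ?_⟩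
  rw [hA.posSemidef_iff_eigenvalues_nonneg]
  intro i
  by_contra hneg
  set l := hA.eigenvalues i
  have hl : l < 0 := not_le.1 hneg
  have hroot : A.charpoly.eval l = 0 := by
    rw [hA.charpoly_eq, eval_prod]
    exact Finset.prod_eq_zero (Finset.mem_univ i) (by simp [l])
  have hdeg : A.charpoly.natDegree = n := by simp
  rw [eval_eq_sum_range, hdeg] at hroot
  have hterm : ∀ j ∈ Finset.range (n + 1), 0 ≤ (-1) ^ n * (A.charpoly.coeff j * l ^ j) := by
    intro j hj
    have hj := Finset.mem_range.1 hj
    have e : (-1 : ℝ) ^ n * (A.charpoly.coeff j * l ^ j) =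
        ((-1) ^ (n - j) * A.charpoly.coeff j) * (-l) ^ j := by
      have : (-1 : ℝ) ^ n = (-1) ^ (n - j) * (-1) ^ j := by
        rw [← pow_add, Nat.sub_add_cancel (by omega)]
      rw [this, neg_pow l]
      ring
    rw [e]
    refine mul_nonneg ?_ (pow_nonneg (by linarith) _)
    rcases Nat.lt_or_ge j n with hjn | hjn
    · have h1 := minorSum_eq_coeff A ⟨n - j - 1, by omega⟩
      have h2 := h ⟨n - j - 1, by omega⟩
      rw [← h1] at h2
      simp only at h2
      have e1 : n - j - 1 + 1 = n - j := by omega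
      rwa [e1, Nat.sub_sub_self hjn.le] at h2
    · obtain rfl : j = n := by omega
      have := A.charpoly_monic.coeff_natDegree
      rw [hdeg] at this
      simp [this]
  have hlast : 0 < (-1) ^ n * (A.charpoly.coeff n * l ^ n) := by
    have := A.charpoly_monic.coeff_natDegree
    rw [hdeg] at this
    rw [this, one_mul, ← mul_pow]
    exact pow_pos (by linarith) _
  have := Finset.sum_pos' hterm ⟨n, Finset.self_mem_range_succ n, hlast⟩
  rw [← Finset.mul_sum, hroot, mul_zero] at this
  exact lt_irrefl _ this

theorem realRooted_altPoly_iff_minorSum {n : ℕ} {v : Fin (n + 1) → ℝ} (hv : v 0 ≠ 0) :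
    RealRooted (altPoly v) ↔ ∀ k : Fin n, 0 ≤ minorSum (k.val + 1) (hankelMat v) :=
  ⟨fun h => (posSemidef_iff_minorSum_nonneg (hankelMat_isHermitian v)).1
      (posSemidef_hankelMat hv h),
    fun h => realRooted_of_posSemidef hv
      ((posSemidef_iff_minorSum_nonneg (hankelMat_isHermitian v)).2 h)⟩

/-! ### Degenerate parameters -/

theorem dense_eval_ne_zero {p : ℝ[X]} (hp : p ≠ 0) : Dense {γ : ℝ | p.eval γ ≠ 0} := by
  have : {γ : ℝ | p.eval γ ≠ 0} = (p.rootSet ℝ)ᶜ := by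
    ext γ
    simp [mem_rootSet, hp]
  rw [this]
  exact (rootSet_finite p ℝ).countable.dense_compl ℝ

theorem le_of_eval_ne_zero {p : ℝ[X]} (hp : p ≠ 0) {f g : ℝ → ℝ} (hf : Continuous f)
    (hg : Continuous g) (h : ∀ γ, p.eval γ ≠ 0 → f γ ≤ g γ) (γ : ℝ) : f γ ≤ g γ := by
  have hcl : IsClosed {γ | f γ ≤ g γ} := isClosed_le hf hg
  have := hcl.closure_subset_iff.2 (show {γ : ℝ | p.eval γ ≠ 0} ⊆ {γ | f γ ≤ g γ} from h)
  rw [(dense_eval_ne_zero hp).closure_eq] at this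
  exact this (Set.mem_univ γ)

/-- For a real root x, |a + isb - x|² = (a - x)² + s²b² increases with s ≥ 0. Unlike the location of
the roots, this inequality survives a vanishing leading coefficient in the limit. -/
theorem norm_aeval_altPoly_le {n : ℕ} {v : Fin (n + 1) → ℝ} (hv : v 0 ≠ 0)
    (h : RealRooted (altPoly v)) (a b : ℝ) {s : ℝ} (hs0 : 0 ≤ s) (hs1 : s ≤ 1) :
    ‖aeval (⟨a, s * b⟩ : ℂ) (altPoly v)‖ ≤ ‖aeval (⟨a, b⟩ : ℂ) (altPoly v)‖ := by
  obtain ⟨x, hx⟩ := exists_aroots_eq hv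
  have him := (realRooted_altPoly_iff hv hx).1 h
  rw [aeval_altPoly hv hx, aeval_altPoly hv hx, norm_mul, norm_mul, norm_prod, norm_prod]
  refine mul_le_mul_of_nonneg_left (Finset.prod_le_prod (fun i _ => norm_nonneg _) fun i _ => ?_)
    (norm_nonneg _)
  rw [Complex.norm_def, Complex.norm_def]
  refine Real.sqrt_le_sqrt ?_
  simp only [Complex.normSq_apply, Complex.sub_re, Complex.sub_im, him i, sub_zero]
  have h1 : s * s ≤ 1 := by nlinarith
  nlinarith [mul_nonneg (sub_nonneg.2 h1) (mul_self_nonneg b)]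

theorem continuous_norm_aeval_family {n : ℕ} (c : Fin (n + 1) → ℝ[X]) (z : ℂ) :
    Continuous fun γ => ‖aeval z (family c γ)‖ := by
  simp only [family, map_sum, map_mul, aeval_C, map_pow, aeval_X, Complex.coe_algebraMap]
  refine continuous_norm.comp (continuous_finsetSum _ fun k _ => ?_)
  exact (continuous_const.mul (Complex.continuous_ofReal.comp (c k).continuous)).mul
    continuous_const

/-- The inequality of `norm_aeval_altPoly_le` holds for a dense set of γ, hence for all. A non-real
zero at a degenerate γ thus forces zeros on the whole vertical segment from the zero to the real
axis, and the polynomial vanishes identically. -/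
theorem realRooted_family_of_eval_ne_zero {n : ℕ} {c : Fin (n + 1) → ℝ[X]} (hc : c 0 ≠ 0)
    (h : ∀ γ, (c 0).eval γ ≠ 0 → RealRooted (family c γ)) (γ : ℝ) : RealRooted (family c γ) := by
  rw [RealRooted, or_iff_not_imp_right]
  intro hne
  push Not at hne
  obtain ⟨z, hz, him⟩ := hne
  have hle : ∀ s : ℝ, 0 ≤ s → s ≤ 1 → aeval (⟨z.re, s * z.im⟩ : ℂ) (family c γ) = 0 := by
    intro s hs0 hs1
    have := le_of_eval_ne_zero hc (continuous_norm_aeval_family c ⟨z.re, s * z.im⟩)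
      (continuous_norm_aeval_family c ⟨z.re, z.im⟩)
      (fun γ hγ => norm_aeval_altPoly_le (v := fun k => (c k).eval γ) hγ (h γ hγ) z.re z.im hs0 hs1)
      γ
    have e : (⟨z.re, z.im⟩ : ℂ) = z := rfl
    rw [e, hz, norm_zero] at this
    exact norm_le_zero_iff.1 this
  have hzero : (family c γ).map (algebraMap ℝ ℂ) = 0 := by
    refine eq_zero_of_infinite_isRoot _ (Set.Infinite.mono (s := (fun s : ℝ =>
      (⟨z.re, s * z.im⟩ : ℂ)) '' Set.Icc 0 1) ?_ ((Set.Icc_infinite one_pos).image ?_))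
    · rintro _ ⟨s, ⟨hs0, hs1⟩, rfl⟩
      rw [Set.mem_ofPred_eq, IsRoot.def, eval_map_algebraMap]
      exact hle s hs0 hs1
    · intro s _ t _ hst
      exact mul_right_cancel₀ him (congrArg Complex.im hst)
  exact (Polynomial.map_eq_zero _).1 hzero

/-- The family is real-rooted if and only if the sums of principal minors of its Hankel matrix are
nonnegative. -/
theorem forall_realRooted_family_iff {n : ℕ} {c : Fin (n + 1) → ℝ[X]} (hc : c 0 ≠ 0) :
    (∀ γ, RealRooted (family c γ)) ↔
      ∀ (k : Fin n) (γ : ℝ), 0 ≤ (minorSum (k.val + 1) (hankelMat c)).eval γ := by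
  have hev : ∀ (k : ℕ) (γ : ℝ), (minorSum k (hankelMat c)).eval γ =
      minorSum k (hankelMat fun k => (c k).eval γ) := fun k γ => by
    rw [← coe_evalRingHom, map_minorSum, hankelMat_map]
  constructor
  · intro h k γ
    refine le_of_eval_ne_zero hc continuous_const (Polynomial.continuous _) (fun γ hγ => ?_) γ
    rw [hev]
    exact (realRooted_altPoly_iff_minorSum (v := fun k => (c k).eval γ) hγ).1 (h γ) k
  · refine fun h => realRooted_family_of_eval_ne_zero hc fun γ hγ => ?_
    refine (realRooted_altPoly_iff_minorSum (v := fun k => (c k).eval γ) hγ).2 fun k => ?_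
    rw [← hev]
    exact h k γ

theorem coe_eval_minorSum_hankelMat {n : ℕ} {c : Fin (n + 1) → ℝ[X]} (k : ℕ) {γ : ℝ}
    (hγ : (c 0).eval γ ≠ 0) :
    (((minorSum k (hankelMat c)).eval γ : ℝ) : ℂ) = sumPrincipalMinors k (hankel c γ) := by
  have h : hankel c γ = (hankelMat fun k => (c k).eval γ).map Complex.ofRealHom := by
    obtain ⟨x, hx⟩ := exists_aroots_eq (v := fun k => (c k).eval γ) hγ
    have hx' : (family c γ).aroots ℂ = Finset.univ.val.map x := hx
    ext a b
    rw [Matrix.map_apply, Complex.ofRealHom_eq_coe,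
      coe_hankelMat (v := fun k => (c k).eval γ) hγ hx, hankel, Matrix.of_apply, rootMoment, hx',
      Multiset.map_map]
    rfl
  rw [h, ← coe_evalRingHom, map_minorSum, hankelMat_map]
  exact map_minorSum Complex.ofRealHom k (hankelMat fun k => (c k).eval γ)

/-! ### The algorithm as a whole -/

theorem SimpleRR.numPoints_le {n d : ℕ} (hn : 1 ≤ n) (hd : 1 ≤ d) :
    SimpleRR.numPoints n d ≤ 8 * n ^ 2 * d := by
  have hν := SimpleRR.nu_le n
  calc n * (d + 1) * (2 * n - 2 + SimpleRR.nu n) ≤ n * (2 * d) * (4 * n) :=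
        Nat.mul_le_mul (Nat.mul_le_mul_left _ (by omega)) (by omega)
    _ = _ := by ring

/-- Sums of prime factors are additive over products and at most the number itself, so the three
factors of N contribute O(n), d + 1 and O(n). -/
theorem SimpleRR.sum_primeFactorsList_numPoints_le {n d : ℕ} (hn : 1 ≤ n) :
    (SimpleRR.numPoints n d).primeFactorsList.sum ≤ 6 * n + d := by
  have hν := SimpleRR.nu_le n
  have hν' := SimpleRR.le_nu n
  have h1 := sum_primeFactorsList_le (n := n) (by omega)
  have h2 := sum_primeFactorsList_le (n := d + 1) (by omega)
  have h3 := sum_primeFactorsList_le (n := 2 * n - 2 + SimpleRR.nu n) (by omega)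
  rw [SimpleRR.numPoints, sum_primeFactorsList_mul (by positivity) (by omega),
    sum_primeFactorsList_mul (by omega) (by omega)]
  omega

theorem hankelCost_le {n d : ℕ} (hn : 1 ≤ n) (hd : 1 ≤ d) :
    hankelCost n d ≤ 10 * n * d + 22 * n ^ 2 := by
  have hν : (SimpleRR.nu n : ℝ) ≤ 2 * n := by exact_mod_cast SimpleRR.nu_le n
  have hn' : (1 : ℝ) ≤ n := by exact_mod_cast hn
  have hd' : (1 : ℝ) ≤ d := by exact_mod_cast hd
  have h1 : ((2 * n - 2 : ℕ) : ℝ) = 2 * n - 2 := by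
    rw [Nat.cast_sub (by omega)]
    push_cast
    ring
  have h2 : ((2 * n - 1 : ℕ) : ℝ) = 2 * n - 1 := by
    rw [Nat.cast_sub (by omega)]
    push_cast
    ring
  rw [hankelCost, h1, h2]
  push_cast
  nlinarith [mul_le_mul hn' hd' zero_le_one (by positivity : (0 : ℝ) ≤ n)]

/-- The total cost, when the characteristic polynomial costs at most `K`. -/
theorem total_cost_le {n d : ℕ} (hn : 1 ≤ n) (hd : 1 ≤ d) {C ω K l : ℝ} (hω : 2 ≤ ω) (hC : 0 ≤ C)
    (hl : 1 ≤ l) (hK : K ≤ C * (n : ℝ) ^ ω * l) :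
    SimpleRR.numPoints n d * (hankelCost n d + (K + n * 2)) +
        n * (4 * SimpleRR.numPoints n d * (SimpleRR.numPoints n d).primeFactorsList.sum +
          (1 + SimpleRR.numPoints n d)) ≤
      (8 * C + 1000) * ((d : ℝ) * (n : ℝ) ^ (2 + ω) + (d : ℝ) ^ 2 * (n : ℝ) ^ 3) * l := by
  have hN : (SimpleRR.numPoints n d : ℝ) ≤ 8 * n ^ 2 * d := by
    exact_mod_cast SimpleRR.numPoints_le hn hd
  have hS : ((SimpleRR.numPoints n d).primeFactorsList.sum : ℝ) ≤ 6 * n + d := by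
    exact_mod_cast SimpleRR.sum_primeFactorsList_numPoints_le (d := d) hn
  have hH := hankelCost_le hn hd
  have hn' : (1 : ℝ) ≤ n := by exact_mod_cast hn
  have hd' : (1 : ℝ) ≤ d := by exact_mod_cast hd
  have hn0 : (0 : ℝ) < n := by linarith
  have hN0 : (0 : ℝ) ≤ SimpleRR.numPoints n d := Nat.cast_nonneg _
  have hS0 : (0 : ℝ) ≤ (SimpleRR.numPoints n d).primeFactorsList.sum := Nat.cast_nonneg _
  have hpow : (n : ℝ) ^ (2 + ω) = (n : ℝ) ^ 2 * (n : ℝ) ^ ω := by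
    rw [Real.rpow_add hn0, Real.rpow_two]
  have hsq : (n : ℝ) ^ 2 ≤ (n : ℝ) ^ ω := by
    rw [← Real.rpow_two]
    exact Real.rpow_le_rpow_of_exponent_le hn' hω
  have hE : (d : ℝ) * (n : ℝ) ^ 4 ≤ d * (n : ℝ) ^ (2 + ω) := by
    rw [hpow, show (n : ℝ) ^ 4 = n ^ 2 * n ^ 2 by ring]
    gcongr
  have h34 : (n : ℝ) ^ 3 * d ≤ d * n ^ 4 := by
    rw [mul_comm]
    gcongr
    norm_num
  have h14 : (n : ℝ) ≤ d * n ^ 4 :=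
    (le_self_pow₀ hn' (four_ne_zero (α := ℕ))).trans (le_mul_of_one_le_left (by positivity) hd')
  have hloop : SimpleRR.numPoints n d * (hankelCost n d + (K + n * 2)) ≤
      (8 * n ^ 2 * d) * ((10 * n * d + 22 * n ^ 2) + (C * (n : ℝ) ^ ω * l + n ^ 2 * 2)) := by
    have hl0 : 0 ≤ l := zero_le_one.trans hl
    refine (mul_le_mul_of_nonneg_left ?_ hN0).trans (mul_le_mul_of_nonneg_right hN (by positivity))
    linarith [le_self_pow₀ hn' (two_ne_zero (α := ℕ))]
  have hinterp : (n : ℝ) * (4 * SimpleRR.numPoints n d *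
      (SimpleRR.numPoints n d).primeFactorsList.sum + (1 + SimpleRR.numPoints n d)) ≤
      n * (4 * (8 * n ^ 2 * d) * (6 * n + d) + (1 + 8 * n ^ 2 * d)) := by
    gcongr
  have hA0 : 0 ≤ (d : ℝ) * (n : ℝ) ^ (2 + ω) := by positivity
  have hB0 : 0 ≤ (d : ℝ) ^ 2 * (n : ℝ) ^ 3 := by positivity
  calc _ ≤ 8 * C * (d * (n : ℝ) ^ (2 + ω)) * l +
        (112 * ((d : ℝ) ^ 2 * n ^ 3) + 384 * (d * n ^ 4) + n + 8 * (n ^ 3 * d)) := by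
        refine (add_le_add hloop hinterp).trans_eq ?_
        rw [hpow]
        ring
    -- Both n and n³d are at most dn⁴ ≤ dn^(2+ω), and 112 + 384 + 1 + 8 is below 1000.
    _ ≤ 8 * C * (d * (n : ℝ) ^ (2 + ω) + (d : ℝ) ^ 2 * n ^ 3) * l +
        1000 * (d * (n : ℝ) ^ (2 + ω) + (d : ℝ) ^ 2 * n ^ 3) * 1 := by
        refine add_le_add ?_ (by linarith)
        gcongr
        linarith
    _ ≤ 8 * C * (d * (n : ℝ) ^ (2 + ω) + (d : ℝ) ^ 2 * n ^ 3) * l +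
        1000 * (d * (n : ℝ) ^ (2 + ω) + (d : ℝ) ^ 2 * n ^ 3) * l := by
        gcongr
    _ = _ := by ring

/-! ### Exactness of the interpolation and the final assembly -/

theorem sum_coeff_mul_pow {p : ℝ[X]} {d : ℕ} (hp : p.natDegree < d) (s : ℂ) :
    ∑ j : Fin d, ((p.coeff j.val : ℝ) : ℂ) * s ^ j.val = aeval s p := by
  rw [Fin.sum_univ_eq_sum_range (fun j => ((p.coeff j : ℝ) : ℂ) * s ^ j) d,
    aeval_eq_sum_range' hp]
  simp only [Algebra.smul_def, Complex.coe_algebraMap]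

/-- The Vandermonde matrix of the N distinct sample points is invertible. A correct interpolation
routine thus has no choice of output. -/
theorem eq_coeff_of_forall_sum_eq {N : ℕ} {ζ : ℂ} (hζ : IsPrimitiveRoot ζ N) {q : ℝ[X]}
    (hq : q.natDegree < N) {b : Fin N → ℂ}
    (hb : ∀ i : Fin N, ∑ j : Fin N, b j * (ζ ^ i.val) ^ j.val = aeval (ζ ^ i.val) q) (j : Fin N) :
    b j = ((q.coeff j.val : ℝ) : ℂ) := by
  have hinj : Function.Injective fun i : Fin N => ζ ^ i.val := fun i i' h =>
    Fin.ext (hζ.pow_inj i.isLt i'.isLt h)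
  have := Matrix.eq_zero_of_forall_index_sum_mul_pow_eq_zero (f := fun i : Fin N => ζ ^ i.val)
    (v := fun j => b j - ((q.coeff j.val : ℝ) : ℂ)) hinj fun i => by
      simp only [sub_mul, Finset.sum_sub_distrib]
      rw [hb, sum_coeff_mul_pow hq, sub_self]
  exact sub_eq_zero.1 (congrFun this j)

theorem SimpleRR.outputs_prog {charpolyR : SimpleRR.CharpolyRoutine ℂ}
    {interpR : SimpleRR.InterpRoutine ℂ} (hR : SimpleRR.ComputesCharpoly charpolyR)
    (hI : SimpleRR.ComputesInterp interpR) {n d : ℕ} {c : Fin (n + 1) → ℝ[X]}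
    {h : Fin (n + 1) → Fin (d + 1) → ℕ} {mem : List ℂ} (hin : SimpleRR.ValidInput d c h mem) :
    SimpleRR.Outputs ((SimpleRR.prog charpolyR interpR n d h).run mem)
      fun k => minorSum (k.val + 1) (hankelMat c) := by
  obtain ⟨hdeg, -, hmem⟩ := hin
  -- Nothing is known about the cost of arbitrary subroutines, so the timing clause is switched off
  -- and the costs 0 are dummies.
  have hrun := achieves_progWith (t := False) (T := 0) (T' := 0) (n := n) (d := d)
    (N := SimpleRR.numPoints n d) (ζ := SimpleRR.rootOfUnity (SimpleRR.numPoints n d))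
    (charpolyR := charpolyR) (interpR := interpR)
    (fun A h mem hA => ⟨hR n A h mem hA, False.elim⟩)
    (fun v h mem hv => ⟨hI _ v h mem hv, False.elim⟩)
    (a := fun k j => (((c k).coeff j.val : ℝ) : ℂ)) hmem
  intro k
  have hlt := natDegree_minorSum_lt_numPoints hdeg k
  refine ⟨hlt, fun j => ?_⟩
  obtain ⟨b, hb, hval⟩ := hrun.post k
  refine (hval j).trans (congrArg some (eq_coeff_of_forall_sum_eq
    (isPrimitiveRoot_rootOfUnity (Nat.ne_zero_of_lt hlt)) hlt (fun i => (hb i).trans ?_) j))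
  simp only [sum_coeff_mul_pow (Nat.lt_succ_of_le (hdeg _))]
  exact ((map_minorSum (aeval _ : ℝ[X] →ₐ[ℝ] ℂ).toRingHom _ _).trans
    (congrArg _ (hankelMat_map _ c))).symm

theorem mainTheorem4 :
    -- Correctness, whatever correct subroutines are used.
    (∀ (charpolyR : SimpleRR.CharpolyRoutine ℂ) (interpR : SimpleRR.InterpRoutine ℂ),
      SimpleRR.ComputesCharpoly charpolyR → SimpleRR.ComputesInterp interpR →
      ∀ (n d : ℕ) (c : Fin (n + 1) → Polynomial ℝ) (h : Fin (n + 1) → Fin (d + 1) → ℕ)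
        (mem : List ℂ), SimpleRR.ValidInput d c h mem →
        ∃ q : Fin n → Polynomial ℝ,
          SimpleRR.Outputs ((SimpleRR.prog charpolyR interpR n d h).run mem) q ∧
          (∀ k, (q k).natDegree ≤ 3 * n ^ 2 * d) ∧
          (∀ (k : Fin n) (γ : ℝ), (c 0).eval γ ≠ 0 →
            (((q k).eval γ : ℝ) : ℂ) = sumPrincipalMinors (k.val + 1) (hankel c γ)) ∧
          ((∀ γ : ℝ, RealRooted (family c γ)) ↔ ∀ (k : Fin n) (γ : ℝ), 0 ≤ (q k).eval γ)) ∧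
    -- Running time, for suitable correct subroutines.
    (∀ ω : ℝ, IsMatMulExponent ω →
      ∃ (charpolyR : SimpleRR.CharpolyRoutine ℂ) (interpR : SimpleRR.InterpRoutine ℂ),
        SimpleRR.ComputesCharpoly charpolyR ∧ SimpleRR.ComputesInterp interpR ∧
        ∃ (C : ℝ) (κ : ℕ), ∀ (n d : ℕ), 1 ≤ n → 1 ≤ d →
          ∀ (c : Fin (n + 1) → Polynomial ℝ) (h : Fin (n + 1) → Fin (d + 1) → ℕ) (mem : List ℂ),
            SimpleRR.ValidInput d c h mem →
            (((SimpleRR.prog charpolyR interpR n d h).run mem).cost : ℝ) ≤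
              C * ((d : ℝ) * (n : ℝ) ^ (2 + ω) + (d : ℝ) ^ 2 * (n : ℝ) ^ 3) *
                Real.log ((n : ℝ) * (d : ℝ) + 2) ^ κ) := by
  constructor
  · intro charpolyR interpR hR hI n d c h mem hin
    refine ⟨fun k => minorSum (k.val + 1) (hankelMat c), SimpleRR.outputs_prog hR hI hin,
      fun k => (natDegree_minorSum_le hin.1 k).trans ?_,
      fun k γ hγ => coe_eval_minorSum_hankelMat _ hγ, forall_realRooted_family_iff hin.2.1⟩
    calc n * (d * SimpleRR.nu n) ≤ n * (d * (3 * n)) := by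
          have := SimpleRR.nu_le n
          gcongr
          omega
      _ = _ := by ring
  · intro ω hω
    obtain ⟨F⟩ := hω.nonempty_fastMul
    obtain ⟨C, hC, hcost⟩ := F.exists_charpolyRoutine_cost
    refine ⟨F.charpolyRoutine, interpRoutine, F.computesCharpoly_charpolyRoutine,
      computesInterp_interpRoutine, 8 * C + 1000, 3, fun n d hn hd c h mem hin => ?_⟩
    have hn' : (1 : ℝ) ≤ n := by exact_mod_cast hn
    have hd' : (1 : ℝ) ≤ d := by exact_mod_cast hd
    have hN : SimpleRR.numPoints n d ≠ 0 := by
      have := SimpleRR.le_nu n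
      have : 2 * n - 2 + SimpleRR.nu n ≠ 0 := by omega
      exact mul_ne_zero (mul_ne_zero (by omega) (by omega)) this
    have hrun := achieves_progWith (t := True) (n := n) (d := d)
      (N := SimpleRR.numPoints n d) (ζ := SimpleRR.rootOfUnity (SimpleRR.numPoints n d))
      (charpolyR := F.charpolyRoutine) (interpR := interpRoutine)
      (fun A h mem hA => F.achieves_charpolyRoutine hA)
      (fun v h mem hv => (achieves_interpRoutine hN hv).mono le_rfl fun f m _ hf =>
        ⟨_, interp_eq (isPrimitiveRoot_rootOfUnity hN) hN v, hf⟩)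
      (a := fun k j => (((c k).coeff j.val : ℝ) : ℂ)) hin.2.2
    have hl : Real.log ((n : ℝ) + 2) ≤ Real.log ((n : ℝ) * d + 2) :=
      Real.log_le_log (by positivity) (by nlinarith)
    have hl1 : 1 ≤ Real.log ((n : ℝ) + 2) := FastMul.one_le_log_add_two hn'
    refine (hrun.cost_le trivial).trans (total_cost_le hn hd hω.two_le hC
      (one_le_pow₀ (hl1.trans hl)) ((hcost n hn).trans ?_))
    gcongr
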